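/- **Setting.** Let $W_1,W_2,\dots$ be i.i.d. with distribution $F_0$ on a measurable space $\mathcal W$; write $E$ for expectation, $|\cdot|$ for the Euclidean norm, and for functions of one or of two observations let $\|\cdot\|$ be the $L_2(F_0)$ or the $L_2(F_0\otimes F_0)$ norm. Let $\Gamma$ and $\mathcal A$ be classes of square-integrable first steps $\gamma=\gamma(w)$ and $\alpha=\alpha(w,w')$, let $\gamma_0\in\Gamma$, $\alpha_0\in\mathcal A$, $\Theta\subseteq\mathbb R^k$, $\theta_0\in\Theta$. Let $g(w,w',\gamma,\theta)$ and $\phi(w,w',\gamma,\alpha,\theta)$ be $\mathbb R^k$-valued, symmetric in $(w,w')$ and measurable where needed (also after insertion of the estimators below), with $E[g(W_i,W_j,\gamma_0,\theta_0)]=0$ and $E[\phi(W_i,W_j,\gamma_0,\alpha_0,\theta_0)]=0$ for $i\ne j$. Put $\psi=g+\phi$ and $\bar\psi(\gamma,\alpha,\theta)=\iint\psi(w,w',\gamma,\alpha,\theta)\,F_0(dw)F_0(dw')$. *Cross-fitting.* Fix $K$. For each $n$ partition $\{1,\dots,n\}$ into $K$ cells $C_1,\dots,C_K$. For each of the $L=K(K+1)/2$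 unordered pairs $l=\{a,b\}$ (with $a=b$ allowed) let $I_l$ be the set of pairs $i<j$ such that one of $i,j$ lies in $C_a$ and the other in $C_b$. The estimators $\hat\gamma_l\in\Gamma$, $\hat\alpha_l\in\mathcal A$ are functions of the observations that occur in no pair of $I_l$; $\hat\gamma\in\Gamma$, $\hat\alpha\in\mathcal A$ are functions of the full sample. With probability approaching one the estimator $\hat\theta$, a measurable function of the sample, lies in $\Theta$ and satisfies $\hat\psi(\hat\theta)=0$, where $$\hat\psi(\theta)=\binom n2^{-1}\sum_{l=1}^L\sum_{(i,j)\in I_l}\bigl(g(W_i,W_j,\hat\gamma_l,\theta)+\phi(W_i,W_j,\hat\gamma_l,\hat\alpha_l,\theta)\bigr).$$ Let $$B=\frac{\partial E[\psi(W_i,W_j,\gamma_0,\alpha_0,\theta)]}{\partial\theta}\Big|_{\theta=\theta_0},\qquad \Sigma=4\operatorname{Var}\bigl(E[\psi(W_i,W_j,\gamma_0,\alpha_0,\theta_0)\mid W_i]\bigr),\qquad V=B^{-1}\Sigma B'^{-1},$$ and, with $\hat\psi_{ij}(\theta)=\psi(W_i,W_j,\hat\gamma,\hat\alpha,\theta)$,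 $$\hat B=\binom n2^{-1}\sum_{i<j}\frac{\partial\hat\psi_{ij}(\hat\theta)}{\partial\theta},\qquad \hat\Sigma=\frac{4}{n(n-1)^2}\sum_{i=1}^n\Bigl[\sum_{j\ne i}\hat\psi_{ij}(\hat\theta)\Bigr]\Bigl[\sum_{j\ne i}\hat\psi_{ij}(\hat\theta)\Bigr]',\qquad \hat V=\hat B^{-1}\hat\Sigma\hat B'^{-1}.$$ **Assumptions.** 1. (*Mean-square consistency.*) $E|\psi(W_i,W_j,\gamma_0,\alpha_0,\theta_0)|^2<\infty$, and for each $l$ the integrals $\iint|\cdot|^2\,F_0(dw)F_0(dw')$ of $g(w,w',\hat\gamma_l,\theta_0)-g(w,w',\gamma_0,\theta_0)$, of $\phi(w,w',\hat\gamma_l,\alpha_0,\theta_0)-\phi(w,w',\gamma_0,\alpha_0,\theta_0)$ and of $\phi(w,w',\gamma_0,\hat\alpha_l,\theta_0)-\phi(w,w',\gamma_0,\alpha_0,\theta_0)$ converge to $0$ in probability. 2. (*Interaction.*) Let $\hat\xi_l(w,w')=\phi(w,w',\hat\gamma_l,\hat\alpha_l,\theta_0)-\phi(w,w',\gamma_0,\hat\alpha_l,\theta_0)-\phi(w,w',\hat\gamma_l,\alpha_0,\theta_0)+\phi(w,w',\gamma_0,\alpha_0,\theta_0)$.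 For each $l$: either (i) $\sqrt n\iint\hat\xi_l\,dF_0dF_0\to_p0$ and $\iint|\hat\xi_l|^2dF_0dF_0\to_p0$; or (ii) $\sqrt n\binom n2^{-1}\sum_{(i,j)\in I_l}|\hat\xi_l(W_i,W_j)|\to_p0$; or (iii) $\sqrt n\binom n2^{-1}\sum_{(i,j)\in I_l}\hat\xi_l(W_i,W_j)\to_p0$. 3. (*Global robustness and small bias.*) For each $l$: (i) for every $\theta\in\Theta$, with probability approaching one $\phi(\cdot,\cdot,\gamma_0,\hat\alpha_l,\theta)$ is integrable and $\iint\phi(w,w',\gamma_0,\hat\alpha_l,\theta)F_0(dw)F_0(dw')=0$; and either (ii) $\|\hat\gamma_l-\gamma_0\|=o_p(n^{-1/4})$ and there is $C$ with $|\bar\psi(\gamma,\alpha_0,\theta_0)|\le C\|\gamma-\gamma_0\|^2$ for all $\gamma\in\Gamma$ with $\|\gamma-\gamma_0\|$ small enough; or (iii) $\sqrt n\,\bar\psi(\hat\gamma_l,\alpha_0,\theta_0)\to_p0$. 4. (*Jacobian.*) $B$ exists: $\psi(W_i,W_j,\gamma_0,\alpha_0,\theta)$ is integrable for $\theta$ near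 $\theta_0$ and its mean is differentiable at $\theta_0$. (i) $\|\hat\gamma-\gamma_0\|\to_p0$, and $\|\hat\gamma_l-\gamma_0\|\to_p0$, $\|\hat\alpha_l-\alpha_0\|\to_p0$ for each $l$. (ii) There are a neighborhood $\mathcal N\subseteq\Theta$ of $\theta_0$ in $\mathbb R^k$, a constant $C>0$ and a measurable $d(w,w',\gamma,\alpha)\ge0$ such that the property $(*)$ $\theta\mapsto\psi(w,w',\gamma,\alpha,\theta)$ is differentiable on $\mathcal N$ and, for $\theta\in\mathcal N$, $\bigl|\frac{\partial\psi(w,w',\gamma,\alpha,\theta)}{\partial\theta}-\frac{\partial\psi(w,w',\gamma,\alpha,\theta_0)}{\partial\theta}\bigr|\le d(w,w',\gamma,\alpha)\,|\theta-\theta_0|^{1/C}$ holds as follows. For all $\gamma\in\Gamma$, $\alpha\in\mathcal A$ with $\|\gamma-\gamma_0\|$ and $\|\alpha-\alpha_0\|$ small enough, it holds for $F_0\otimes F_0$-almost every $(w,w')$, and $\iint d(w,w',\gamma,\alpha)F_0(dw)F_0(dw')\le C$. With probability approaching one it holds at $(W_i,W_j,\hat\gamma_l,\hat\alpha_l)$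 for all $(i,j)\in I_l$ (each $l$), and at $(W_i,W_j,\hat\gamma,\hat\alpha)$ for all $i<j\le n$. Finally $\binom n2^{-1}\sum_{i<j}E[d(W_i,W_j,\hat\gamma,\hat\alpha)]\le C$ for all large $n$. (iii) For each coordinate $\theta_b$, $$\binom n2^{-1}\sum_{i<j}E\Bigl|\frac{\partial\psi(W_i,W_j,\hat\gamma,\hat\alpha,\theta_0)}{\partial\theta_b}-\frac{\partial\psi(W_i,W_j,\gamma_0,\alpha_0,\theta_0)}{\partial\theta_b}\Bigr|\to0,$$ and, for each $l$, $$\iint\Bigl|\frac{\partial\psi(w,w',\hat\gamma_l,\hat\alpha_l,\theta_0)}{\partial\theta_b}-\frac{\partial\psi(w,w',\gamma_0,\alpha_0,\theta_0)}{\partial\theta_b}\Bigr|F_0(dw)F_0(dw')\to_p0.$$ 5. (*Variance.*) With $\hat g_{-i}=(n-1)^{-1}\sum_{j\ne i}g(W_i,W_j,\hat\gamma,\hat\theta)$, $g_{-i}=(n-1)^{-1}\sum_{j\ne i}g(W_i,W_j,\gamma_0,\theta_0)$ and $\hat\phi_{-i},\phi_{-i}$ defined in the same way from $\phi(W_i,W_j,\hat\gamma,\hat\alpha,\hat\theta)$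 and $\phi(W_i,W_j,\gamma_0,\alpha_0,\theta_0)$: $n^{-1}\sum_{i=1}^n|\hat g_{-i}-g_{-i}|^2\to_p0$ and $n^{-1}\sum_{i=1}^n|\hat\phi_{-i}-\phi_{-i}|^2\to_p0$. **Theorem.** Under Assumptions 1–5, if $\hat\theta\to_p\theta_0$, $B$ is invertible and $V=B^{-1}\Sigma B'^{-1}$ is nonsingular, then $$\sqrt n(\hat\theta-\theta_0)\to_d\mathcal N(0,V)\qquad\text{and}\qquad\hat V\to_pV.$$ -/

import Mathlib

open MeasureTheory ProbabilityTheory Filter Topology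
open scoped ENNReal NNReal

noncomputable section

/-- `ℝ^k` with the Euclidean norm. -/
abbrev Vec (k : ℕ) := EuclideanSpace ℝ (Fin k)

/-- `X n → 0` in probability, for sizes `X n` with values in `[0, ∞]`.
For a vector-valued `Y n`, `Y n = o_p(1)` is `ToZeroInProb P (fun n ω => ‖Y n ω‖ₑ)`. -/
def ToZeroInProb {Ω : Type*} [MeasurableSpace Ω] (P : Measure Ω) (X : ℕ → Ω → ℝ≥0∞) : Prop :=
  ∀ ε : ℝ≥0∞, 0 < ε → Tendsto (fun n => P {ω | ε ≤ X n ω}) atTop (𝓝 0)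

/-- The events `{ω | E n ω}` hold with probability approaching one. -/
def WithProbToOne {Ω : Type*} [MeasurableSpace Ω] (P : Measure Ω) (E : ℕ → Ω → Prop) : Prop :=
  Tendsto (fun n => P {ω | ¬ E n ω}) atTop (𝓝 0)

/-- The pairs `i < j` of observation indices of a sample of size `n`. -/
def indexPairs (n : ℕ) : Finset (Fin n × Fin n) :=
  Finset.univ.filter fun p => p.1 < p.2

/-- The data of a cross-fitted semiparametric U-statistic problem: `Z`-valued observations,
first steps `γ : Z → G` and `α : Z × Z → A`, a `k`-dimensional parameter and `K` folds.
A function of some components of an observation is regarded as a function of the observation;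
`Γ` and `𝒜` are the classes of admissible first steps. Estimators are functions of the sample. -/
structure UModel (Ω Z G A : Type*) [MeasurableSpace Z] (k K : ℕ) where
  /-- the observations -/
  W : ℕ → Ω → Z
  /-- the distribution of one observation -/
  F₀ : Measure Z
  /-- the parameter set -/
  Θ : Set (Vec k)
  /-- the true parameter -/
  θ₀ : Vec k
  /-- the class of admissible first steps `γ` -/
  Γ : Set (Z → G)
  /-- the class of admissible first steps `α` -/
  𝒜 : Set (Z × Z → A)
  /-- the limit of the first step `γ` -/
  γ₀ : Z → G
  /-- the limit of the first step `α` -/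
  α₀ : Z × Z → A
  /-- the identifying quadratic moment function -/
  g : Z → Z → (Z → G) → Vec k → Vec k
  /-- the adjustment term, the U-moment representation of the first step influence function -/
  φ : Z → Z → (Z → G) → (Z × Z → A) → Vec k → Vec k
  /-- the partition `C_1, …, C_K` of the indices: `fold n i` is the cell of `i` -/
  fold : (n : ℕ) → Fin n → Fin K
  /-- the cross-fitted estimators `γ̂_l`; a block `l` is an unordered pair of cells -/
  γcf : (n : ℕ) → Sym2 (Fin K) → (Fin n → Z) → (Z → G)
  /-- the cross-fitted estimators `α̂_l` -/
  αcf : (n : ℕ) → Sym2 (Fin K) → (Fin n → Z) → (Z × Z → A)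
  /-- the full-sample estimator `γ̂`, used for the variance -/
  γhat : (n : ℕ) → (Fin n → Z) → (Z → G)
  /-- the full-sample estimator `α̂`, used for the variance -/
  αhat : (n : ℕ) → (Fin n → Z) → (Z × Z → A)
  /-- the debiased estimator `θ̂` -/
  θhat : (n : ℕ) → (Fin n → Z) → Vec k

namespace UModel

variable {Ω Z G A : Type*} [MeasurableSpace Ω] [MeasurableSpace Z]
  [NormedAddCommGroup G] [NormedAddCommGroup A] {k K : ℕ}

/-- The sample of size `n`. -/
def sample (M : UModel Ω Z G A k K) (n : ℕ) (ω : Ω) : Fin n → Z := fun i => M.W i ω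

/-- The block `I_l`: the pairs `i < j` whose cells are the two members of `l`. As `l` ranges over
the `K (K + 1) / 2` unordered pairs of cells, the blocks partition the pairs `i < j`. -/
def block (M : UModel Ω Z G A k K) (n : ℕ) (l : Sym2 (Fin K)) : Finset (Fin n × Fin n) :=
  (indexPairs n).filter fun p => s(M.fold n p.1, M.fold n p.2) = l

/-- The observations that do not occur in a pair of the block `I_l`. -/
def outside (M : UModel Ω Z G A k K) (n : ℕ) (l : Sym2 (Fin K)) : Set (Fin n) :=
  {i | ∀ p ∈ M.block n l, p.1 ≠ i ∧ p.2 ≠ i}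

/-- The orthogonal moment function `ψ = g + φ`. -/
def ψ (M : UModel Ω Z G A k K) (w w' : Z) (γ : Z → G) (α : Z × Z → A) (θ : Vec k) : Vec k :=
  M.g w w' γ θ + M.φ w w' γ α θ

/-- The mean `E[ψ(W_i, W_j, γ, α, θ)]` at fixed `γ, α, θ`. -/
def ψbar (M : UModel Ω Z G A k K) (γ : Z → G) (α : Z × Z → A) (θ : Vec k) : Vec k :=
  ∫ z, M.ψ z.1 z.2 γ α θ ∂(M.F₀.prod M.F₀)

/-- The Jacobian of `ψ` in `θ`, as a linear map. -/
def Dψ (M : UModel Ω Z G A k K) (w w' : Z) (γ : Z → G) (α : Z × Z → A) (θ : Vec k) :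
    Vec k →L[ℝ] Vec k :=
  fderiv ℝ (fun t => M.ψ w w' γ α t) θ

/-- The partial derivative `∂ψ/∂θ_b`. -/
def pψ (M : UModel Ω Z G A k K) (b : Fin k) (w w' : Z) (γ : Z → G) (α : Z × Z → A)
    (θ : Vec k) : Vec k :=
  M.Dψ w w' γ α θ (EuclideanSpace.single b 1)

/-- The `L₂` distance of `γ` to `γ₀`. -/
def γdist (M : UModel Ω Z G A k K) (γ : Z → G) : ℝ≥0∞ := eLpNorm (γ - M.γ₀) 2 M.F₀

/-- The `L₂` distance of `α` to `α₀`. -/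
def αdist (M : UModel Ω Z G A k K) (α : Z × Z → A) : ℝ≥0∞ :=
  eLpNorm (α - M.α₀) 2 (M.F₀.prod M.F₀)

/-- The cross-fitted debiased sample moment `ψ̂(θ)`. -/
def ψhat (M : UModel Ω Z G A k K) (n : ℕ) (x : Fin n → Z) (θ : Vec k) : Vec k :=
  ((n.choose 2 : ℝ)⁻¹) • ∑ l : Sym2 (Fin K), ∑ p ∈ M.block n l,
    (M.g (x p.1) (x p.2) (M.γcf n l x) θ + M.φ (x p.1) (x p.2) (M.γcf n l x) (M.αcf n l x) θ)

/-- The interaction term `ξ̂_l(w, w')`. -/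
def ξhat (M : UModel Ω Z G A k K) (n : ℕ) (l : Sym2 (Fin K)) (x : Fin n → Z) (w w' : Z) : Vec k :=
  M.φ w w' (M.γcf n l x) (M.αcf n l x) M.θ₀ - M.φ w w' M.γ₀ (M.αcf n l x) M.θ₀
    - M.φ w w' (M.γcf n l x) M.α₀ M.θ₀ + M.φ w w' M.γ₀ M.α₀ M.θ₀

/-- `B = ∂E[ψ(W_i, W_j, γ₀, α₀, θ)]/∂θ` at `θ₀`. -/
def B (M : UModel Ω Z G A k K) : Matrix (Fin k) (Fin k) ℝ :=
  Matrix.of fun a b =>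
    fderiv ℝ (fun t => M.ψbar M.γ₀ M.α₀ t) M.θ₀ (EuclideanSpace.single b 1) a

/-- The conditional mean `E[ψ(W_i, W_j, γ₀, α₀, θ₀) | W_i]` (with `i = 0`, `j = 1`). -/
def ψproj (M : UModel Ω Z G A k K) (P : Measure Ω) : Ω → Vec k :=
  P[fun ω => M.ψ (M.W 0 ω) (M.W 1 ω) M.γ₀ M.α₀ M.θ₀ |
    MeasurableSpace.comap (M.W 0) inferInstance]

/-- `Σ = 4 Var(E[ψ(W_i, W_j, γ₀, α₀, θ₀) | W_i])`. -/
def Sig (M : UModel Ω Z G A k K) (P : Measure Ω) : Matrix (Fin k) (Fin k) ℝ :=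
  Matrix.of fun a b => 4 * cov[fun ω => M.ψproj P ω a, fun ω => M.ψproj P ω b; P]

/-- `V = B⁻¹ Σ B'⁻¹`. -/
def V (M : UModel Ω Z G A k K) (P : Measure Ω) : Matrix (Fin k) (Fin k) ℝ :=
  M.B⁻¹ * M.Sig P * (M.B.transpose)⁻¹

/-- `B̂`, computed without cross-fitting. -/
def Bhat (M : UModel Ω Z G A k K) (n : ℕ) (x : Fin n → Z) : Matrix (Fin k) (Fin k) ℝ :=
  Matrix.of fun a b => (n.choose 2 : ℝ)⁻¹ * ∑ p ∈ indexPairs n,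
    M.pψ b (x p.1) (x p.2) (M.γhat n x) (M.αhat n x) (M.θhat n x) a

/-- `Σ̂`, computed without cross-fitting. -/
def Sighat (M : UModel Ω Z G A k K) (n : ℕ) (x : Fin n → Z) : Matrix (Fin k) (Fin k) ℝ :=
  Matrix.of fun a b => 4 / ((n : ℝ) * ((n : ℝ) - 1) ^ 2) * ∑ i : Fin n,
    (∑ j ∈ Finset.univ.erase i,
        M.ψ (x i) (x j) (M.γhat n x) (M.αhat n x) (M.θhat n x)) a
      * (∑ j ∈ Finset.univ.erase i,
        M.ψ (x i) (x j) (M.γhat n x) (M.αhat n x) (M.θhat n x)) b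

/-- `V̂ = B̂⁻¹ Σ̂ B̂'⁻¹`. -/
def Vhat (M : UModel Ω Z G A k K) (n : ℕ) (x : Fin n → Z) : Matrix (Fin k) (Fin k) ℝ :=
  (M.Bhat n x)⁻¹ * M.Sighat n x * ((M.Bhat n x).transpose)⁻¹

/-- The setting: i.i.d. data, square integrable first steps, symmetric kernels with mean zero at
the truth, cross-fitting, and `θ̂` a solution of `ψ̂(θ) = 0` (up to events of vanishing
probability). -/
structure Standing (M : UModel Ω Z G A k K) (P : Measure Ω) : Prop where
  measurable_W : ∀ i, Measurable (M.W i)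
  law : ∀ i, P.map (M.W i) = M.F₀
  indep : iIndepFun M.W P
  memLp_γ : ∀ γ ∈ M.Γ, MemLp γ 2 M.F₀
  memLp_α : ∀ α ∈ M.𝒜, MemLp α 2 (M.F₀.prod M.F₀)
  γ₀_mem : M.γ₀ ∈ M.Γ
  α₀_mem : M.α₀ ∈ M.𝒜
  γcf_mem : ∀ n l x, M.γcf n l x ∈ M.Γ
  αcf_mem : ∀ n l x, M.αcf n l x ∈ M.𝒜
  γhat_mem : ∀ n x, M.γhat n x ∈ M.Γ
  αhat_mem : ∀ n x, M.αhat n x ∈ M.𝒜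
  θ₀_mem : M.θ₀ ∈ M.Θ
  g_symm : ∀ γ ∈ M.Γ, ∀ θ ∈ M.Θ, ∀ w w', M.g w w' γ θ = M.g w' w γ θ
  φ_symm : ∀ γ ∈ M.Γ, ∀ α ∈ M.𝒜, ∀ θ ∈ M.Θ, ∀ w w', M.φ w w' γ α θ = M.φ w' w γ α θ
  /-- `E[g(W_i, W_j, γ₀, θ₀)] = 0`. -/
  g_mean : Integrable (fun z : Z × Z => M.g z.1 z.2 M.γ₀ M.θ₀) (M.F₀.prod M.F₀) ∧
    ∫ z, M.g z.1 z.2 M.γ₀ M.θ₀ ∂(M.F₀.prod M.F₀) = 0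
  /-- `E[φ(W_i, W_j, γ₀, α₀, θ₀)] = 0`. -/
  φ_mean : Integrable (fun z : Z × Z => M.φ z.1 z.2 M.γ₀ M.α₀ M.θ₀) (M.F₀.prod M.F₀) ∧
    ∫ z, M.φ z.1 z.2 M.γ₀ M.α₀ M.θ₀ ∂(M.F₀.prod M.F₀) = 0
  /-- `γ̂_l` uses only observations that do not occur in `I_l`. -/
  γcf_dependsOn : ∀ n l, DependsOn (M.γcf n l) (M.outside n l)
  /-- `α̂_l` uses only observations that do not occur in `I_l`. -/
  αcf_dependsOn : ∀ n l, DependsOn (M.αcf n l) (M.outside n l)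
  measurable_θhat : ∀ n, Measurable (M.θhat n)
  solves : WithProbToOne P fun n ω =>
    M.θhat n (M.sample n ω) ∈ M.Θ ∧ M.ψhat n (M.sample n ω) (M.θhat n (M.sample n ω)) = 0
  measurable_g₀ : Measurable fun z : Z × Z => M.g z.1 z.2 M.γ₀ M.θ₀
  measurable_φ₀ : Measurable fun z : Z × Z => M.φ z.1 z.2 M.γ₀ M.α₀ M.θ₀
  measurable_gcf : ∀ n l, Measurable fun q : (Fin n → Z) × (Z × Z) =>
    M.g q.2.1 q.2.2 (M.γcf n l q.1) M.θ₀
  measurable_φcf : ∀ n l, Measurable fun q : (Fin n → Z) × (Z × Z) =>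
    M.φ q.2.1 q.2.2 (M.γcf n l q.1) (M.αcf n l q.1) M.θ₀
  measurable_φcf_γ : ∀ n l, Measurable fun q : (Fin n → Z) × (Z × Z) =>
    M.φ q.2.1 q.2.2 (M.γcf n l q.1) M.α₀ M.θ₀
  measurable_φcf_α : ∀ n l, Measurable fun q : (Fin n → Z) × (Z × Z) =>
    M.φ q.2.1 q.2.2 M.γ₀ (M.αcf n l q.1) M.θ₀
  measurable_p₀ : ∀ b, Measurable fun z : Z × Z => M.pψ b z.1 z.2 M.γ₀ M.α₀ M.θ₀
  measurable_pcf : ∀ b n l, Measurable fun q : (Fin n → Z) × (Z × Z) =>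
    M.pψ b q.2.1 q.2.2 (M.γcf n l q.1) (M.αcf n l q.1) M.θ₀
  measurable_phat : ∀ b n (i j : Fin n), Measurable fun x : Fin n → Z =>
    M.pψ b (x i) (x j) (M.γhat n x) (M.αhat n x) M.θ₀

/-- Square integrability of `ψ` at the truth and mean-square consistency. -/
structure MeanSquare (M : UModel Ω Z G A k K) (P : Measure Ω) : Prop where
  memLp : MemLp (fun z : Z × Z => M.ψ z.1 z.2 M.γ₀ M.α₀ M.θ₀) 2 (M.F₀.prod M.F₀)
  g_γ : ∀ l, ToZeroInProb P fun n ω => ∫⁻ z,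
    ‖M.g z.1 z.2 (M.γcf n l (M.sample n ω)) M.θ₀ - M.g z.1 z.2 M.γ₀ M.θ₀‖ₑ ^ 2
      ∂(M.F₀.prod M.F₀)
  φ_γ : ∀ l, ToZeroInProb P fun n ω => ∫⁻ z,
    ‖M.φ z.1 z.2 (M.γcf n l (M.sample n ω)) M.α₀ M.θ₀ - M.φ z.1 z.2 M.γ₀ M.α₀ M.θ₀‖ₑ ^ 2
      ∂(M.F₀.prod M.F₀)
  φ_α : ∀ l, ToZeroInProb P fun n ω => ∫⁻ z,
    ‖M.φ z.1 z.2 M.γ₀ (M.αcf n l (M.sample n ω)) M.θ₀ - M.φ z.1 z.2 M.γ₀ M.α₀ M.θ₀‖ₑ ^ 2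
      ∂(M.F₀.prod M.F₀)

/-- The rate condition on the interaction term, one of three alternatives for each block. -/
def InteractionRate (M : UModel Ω Z G A k K) (P : Measure Ω) : Prop :=
  ∀ l : Sym2 (Fin K),
    (ToZeroInProb P (fun n ω =>
        ‖Real.sqrt n • ∫ z, M.ξhat n l (M.sample n ω) z.1 z.2 ∂(M.F₀.prod M.F₀)‖ₑ) ∧
      ToZeroInProb P (fun n ω =>
        ∫⁻ z, ‖M.ξhat n l (M.sample n ω) z.1 z.2‖ₑ ^ 2 ∂(M.F₀.prod M.F₀))) ∨
    ToZeroInProb P (fun n ω => ‖Real.sqrt n * (n.choose 2 : ℝ)⁻¹ * ∑ p ∈ M.block n l,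
      ‖M.ξhat n l (M.sample n ω) (M.W p.1 ω) (M.W p.2 ω)‖‖ₑ) ∨
    ToZeroInProb P (fun n ω => ‖(Real.sqrt n * (n.choose 2 : ℝ)⁻¹) • ∑ p ∈ M.block n l,
      M.ξhat n l (M.sample n ω) (M.W p.1 ω) (M.W p.2 ω)‖ₑ)

/-- Global robustness in `α` and small bias, one of two alternatives for each block. -/
structure SmallBias (M : UModel Ω Z G A k K) (P : Measure Ω) : Prop where
  robust : ∀ l, ∀ θ ∈ M.Θ, WithProbToOne P fun n ω =>
    Integrable (fun z : Z × Z => M.φ z.1 z.2 M.γ₀ (M.αcf n l (M.sample n ω)) θ)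
        (M.F₀.prod M.F₀) ∧
      ∫ z, M.φ z.1 z.2 M.γ₀ (M.αcf n l (M.sample n ω)) θ ∂(M.F₀.prod M.F₀) = 0
  bias : ∀ l,
    (ToZeroInProb P (fun n ω =>
        ENNReal.ofReal ((n : ℝ) ^ (1 / 4 : ℝ)) * M.γdist (M.γcf n l (M.sample n ω))) ∧
      ∃ C : ℝ≥0, 0 < C ∧ ∃ ε : ℝ≥0∞, 0 < ε ∧ ∀ γ ∈ M.Γ, M.γdist γ < ε →
        ‖M.ψbar γ M.α₀ M.θ₀‖ₑ ≤ C * M.γdist γ ^ 2) ∨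
    ToZeroInProb P (fun n ω =>
      ‖Real.sqrt n • M.ψbar (M.γcf n l (M.sample n ω)) M.α₀ M.θ₀‖ₑ)

/-- On the pair `(w, w')`, `ψ` is differentiable in `θ` on `N`, and its Jacobian satisfies a
Hölder bound at `θ₀` with constant `δ` and exponent `1 / C`. -/
def SmoothOn (M : UModel Ω Z G A k K) (N : Set (Vec k)) (C δ : ℝ≥0) (γ : Z → G)
    (α : Z × Z → A) (w w' : Z) : Prop :=
  ∀ θ ∈ N, DifferentiableAt ℝ (fun t => M.ψ w w' γ α t) θ ∧
    ‖M.Dψ w w' γ α θ - M.Dψ w w' γ α M.θ₀‖ ≤ δ * ‖θ - M.θ₀‖ ^ (1 / (C : ℝ))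

/-- Jacobian regularity. The conditions are imposed both on the cross-fitted first steps, which
enter `ψ̂`, and on the full-sample first steps, which enter `B̂`. For the latter `E[…]` is the
expectation over the sample, with `W_i, W_j` among the observations used by `γ̂, α̂`. -/
structure JacobianRegular (M : UModel Ω Z G A k K) (P : Measure Ω) : Prop where
  /-- `B` exists. -/
  integrable : ∀ᶠ θ in 𝓝 M.θ₀,
    Integrable (fun z : Z × Z => M.ψ z.1 z.2 M.γ₀ M.α₀ θ) (M.F₀.prod M.F₀)
  differentiable : DifferentiableAt ℝ (fun t => M.ψbar M.γ₀ M.α₀ t) M.θ₀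
  γcf_consistent : ∀ l, ToZeroInProb P fun n ω => M.γdist (M.γcf n l (M.sample n ω))
  αcf_consistent : ∀ l, ToZeroInProb P fun n ω => M.αdist (M.αcf n l (M.sample n ω))
  γhat_consistent : ToZeroInProb P fun n ω => M.γdist (M.γhat n (M.sample n ω))
  smooth : ∃ N ∈ 𝓝 M.θ₀, N ⊆ M.Θ ∧ ∃ C : ℝ≥0, 0 < C ∧ ∃ ε : ℝ≥0∞, 0 < ε ∧
    ∃ d : Z → Z → (Z → G) → (Z × Z → A) → ℝ≥0,
      (∀ γ ∈ M.Γ, ∀ α ∈ M.𝒜, Measurable fun z : Z × Z => d z.1 z.2 γ α) ∧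
      (∀ n l, Measurable fun q : (Fin n → Z) × (Z × Z) =>
        d q.2.1 q.2.2 (M.γcf n l q.1) (M.αcf n l q.1)) ∧
      (∀ n (i j : Fin n), Measurable fun x : Fin n → Z =>
        d (x i) (x j) (M.γhat n x) (M.αhat n x)) ∧
      -- at fixed first steps near `(γ₀, α₀)`
      (∀ γ ∈ M.Γ, ∀ α ∈ M.𝒜, M.γdist γ < ε → M.αdist α < ε →
        (∀ᵐ z ∂(M.F₀.prod M.F₀), M.SmoothOn N C (d z.1 z.2 γ α) γ α z.1 z.2) ∧
        ∫⁻ z, (d z.1 z.2 γ α : ℝ≥0∞) ∂(M.F₀.prod M.F₀) ≤ C) ∧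
      -- on the sample, at the cross-fitted first steps
      (∀ l, WithProbToOne P fun n ω => ∀ p ∈ M.block n l,
        M.SmoothOn N C (d (M.W p.1 ω) (M.W p.2 ω) (M.γcf n l (M.sample n ω))
            (M.αcf n l (M.sample n ω)))
          (M.γcf n l (M.sample n ω)) (M.αcf n l (M.sample n ω)) (M.W p.1 ω) (M.W p.2 ω)) ∧
      -- on the sample, at the full-sample first steps
      (WithProbToOne P fun n ω => ∀ p ∈ indexPairs n,
        M.SmoothOn N C (d (M.W p.1 ω) (M.W p.2 ω) (M.γhat n (M.sample n ω))
            (M.αhat n (M.sample n ω)))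
          (M.γhat n (M.sample n ω)) (M.αhat n (M.sample n ω)) (M.W p.1 ω) (M.W p.2 ω)) ∧
      (∀ᶠ n : ℕ in atTop, (n.choose 2 : ℝ≥0∞)⁻¹ * ∑ p ∈ indexPairs n,
        ∫⁻ ω, (d (M.W p.1 ω) (M.W p.2 ω) (M.γhat n (M.sample n ω))
          (M.αhat n (M.sample n ω)) : ℝ≥0∞) ∂P ≤ C)
  partial_cf : ∀ b l, ToZeroInProb P fun n ω => ∫⁻ z,
    ‖M.pψ b z.1 z.2 (M.γcf n l (M.sample n ω)) (M.αcf n l (M.sample n ω)) M.θ₀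
      - M.pψ b z.1 z.2 M.γ₀ M.α₀ M.θ₀‖ₑ ∂(M.F₀.prod M.F₀)
  partial_hat : ∀ b, Tendsto (fun n : ℕ => (n.choose 2 : ℝ≥0∞)⁻¹ * ∑ p ∈ indexPairs n,
    ∫⁻ ω, ‖M.pψ b (M.W p.1 ω) (M.W p.2 ω) (M.γhat n (M.sample n ω))
        (M.αhat n (M.sample n ω)) M.θ₀
      - M.pψ b (M.W p.1 ω) (M.W p.2 ω) M.γ₀ M.α₀ M.θ₀‖ₑ ∂P) atTop (𝓝 0)

/-- The conditions for the consistency of `Σ̂`, on leave-one-out averages. -/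
structure VarianceConditions (M : UModel Ω Z G A k K) (P : Measure Ω) : Prop where
  memLp : MemLp (fun z : Z × Z => M.ψ z.1 z.2 M.γ₀ M.α₀ M.θ₀) 2 (M.F₀.prod M.F₀)
  g_loo : ToZeroInProb P fun n ω => ‖(n : ℝ)⁻¹ * ∑ i : Fin n,
    ‖((n : ℝ) - 1)⁻¹ • ∑ j ∈ Finset.univ.erase i,
        M.g (M.W i ω) (M.W j ω) (M.γhat n (M.sample n ω)) (M.θhat n (M.sample n ω))
      - ((n : ℝ) - 1)⁻¹ • ∑ j ∈ Finset.univ.erase i,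
        M.g (M.W i ω) (M.W j ω) M.γ₀ M.θ₀‖ ^ 2‖ₑ
  φ_loo : ToZeroInProb P fun n ω => ‖(n : ℝ)⁻¹ * ∑ i : Fin n,
    ‖((n : ℝ) - 1)⁻¹ • ∑ j ∈ Finset.univ.erase i,
        M.φ (M.W i ω) (M.W j ω) (M.γhat n (M.sample n ω)) (M.αhat n (M.sample n ω))
          (M.θhat n (M.sample n ω))
      - ((n : ℝ) - 1)⁻¹ • ∑ j ∈ Finset.univ.erase i,
        M.φ (M.W i ω) (M.W j ω) M.γ₀ M.α₀ M.θ₀‖ ^ 2‖ₑ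

end UModel

end

/-!
The estimator solves `ψ̂(θ̂) = 0`, and its limit law follows from an expansion of `ψ̂` at the
true parameter. Stochastic orders are handled through the filter `probFilter P` on `ℕ × Ω`:
convergence along it is convergence in probability, so `o_p(1)` statements are `Tendsto`
statements.

*The moment at the truth* (`UModel.tendsto_sqrt_smul_ψhat_sub`). On a block `I_l`, the
difference between `ψ` at the estimated and at the true first steps is the sum of an error from
`γ̂_l` at `α₀`, an error from `α̂_l` at `γ₀`, and the interaction `ξ̂_l`. The cross-fitted first
steps depend on observations outside the block only, so that given those observations each of
the first two errors is a sum of values of a fixed kernel over pairs of i.i.d. observations.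
Only pairs with a common index are correlated, whence the centered sum, at scale `√n`, has
conditional second moment at most a constant times that of the kernel
(`lintegral_enorm_sq_centered_sum_le`), and the latter tends to zero by mean-square consistency.
The conditional Markov inequality (`meas_ge_crossfit_le`), which rests on replacing the
coordinates inside the block by those of an independent copy, makes the centered sums
negligible. The conditional means are negligible by the small bias condition for `γ̂_l` and
vanish by global robustness for `α̂_l`. The interaction is negligible by assumption or by the
same argument.

*The projection* (`tendsto_pairAverage_sub_projection`). The U-statistic with the true first
steps differs from the sum of its Hoeffding projections by a degenerate U-statistic, whose terms
are uncorrelated.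

*Linearization* (`UModel.tendsto_linearization`). The Hölder bound on the Jacobian and its
consistency give `ψ̂(θ̂) = ψ̂(θ₀) + B (θ̂ - θ₀) + o_p(‖θ̂ - θ₀‖)`. The derivative of the mean is
the mean of the derivative (`UModel.JacobianRegular.integrable_pψ`), so that the Jacobian at the
truth converges to `B` by the law of large numbers for U-statistics (`tendsto_pairAverage`). As
`B` is invertible and `√n ψ̂(θ₀)` is bounded in probability, `θ̂ - θ₀` has the order `n^{-1/2}`
and the remainder is negligible. The central limit theorem then applies to the sum of the values
of the influence function, whose second moment matrix is `V` (`UModel.V_apply`).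

*The variance.* `B̂` is compared with the average Jacobian at the truth, and in `Σ̂` the
leave-one-out averages are compared with the projections (`tendsto_leaveOneOut_sub_projection`),
whose second moments obey the law of large numbers. Inversion of matrices is continuous at `B`.
-/

/-! ### Convergence in probability as convergence along a filter -/

lemma tendsto_zero_of_enorm_sq {α E : Type*} [NormedAddCommGroup E] {l : Filter α} {X : α → E}
    (h : Tendsto (fun a => ‖X a‖ₑ ^ 2) l (𝓝 0)) : Tendsto X l (𝓝 0) := by
  rw [tendsto_zero_iff_enorm_tendsto_zero]
  have := (ENNReal.continuous_rpow_const (y := (1 / 2 : ℝ))).tendsto 0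
  rw [ENNReal.zero_rpow_of_pos (by norm_num)] at this
  refine (this.comp h).congr fun q => ?_
  rw [Function.comp, ← ENNReal.rpow_natCast, ← ENNReal.rpow_mul]
  norm_num

section ProbFilter

variable {Ω : Type*} [MeasurableSpace Ω] {P : Measure Ω}

/-- The filter on `ℕ × Ω` whose sets are the sequences of events of probability tending to one.
Its eventual statements are those holding with probability approaching one, and convergence along
it is convergence in probability, so that the calculus of `Tendsto` serves as the calculus of
`o_p(1)`. -/
def probFilter (P : Measure Ω) : Filter (ℕ × Ω) where
  sets := {S | Tendsto (fun n => P {ω | (n, ω) ∉ S}) atTop (𝓝 0)}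
  univ_sets := by simp
  sets_of_superset := by
    intro S T hS hST
    refine tendsto_of_tendsto_of_tendsto_of_le_of_le tendsto_const_nhds hS (fun _ => zero_le)
      fun n => measure_mono fun ω hω h => hω (hST h)
  inter_sets := by
    intro S T hS hT
    have h := Tendsto.add hS hT
    rw [add_zero] at h
    refine tendsto_of_tendsto_of_tendsto_of_le_of_le tendsto_const_nhds h (fun _ => zero_le)
      fun n => (measure_mono fun ω hω => ?_).trans (measure_union_le _ _)
    by_cases h : (n, ω) ∈ S
    · exact Or.inr fun h' => hω ⟨h, h'⟩
    · exact Or.inl h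

lemma eventually_probFilter {p : ℕ × Ω → Prop} :
    (∀ᶠ q in probFilter P, p q) ↔ Tendsto (fun n => P {ω | ¬ p (n, ω)}) atTop (𝓝 0) := Iff.rfl

lemma WithProbToOne.eventually {E : ℕ → Ω → Prop} (h : WithProbToOne P E) :
    ∀ᶠ q in probFilter P, E q.1 q.2 := h

lemma tendsto_fst_probFilter : Tendsto Prod.fst (probFilter P) atTop := by
  intro S hS
  rw [mem_map, ← Filter.eventually_mem_set, eventually_probFilter]
  refine tendsto_const_nhds.congr' ?_
  filter_upwards [hS] with n hn
  simp [hn]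

lemma ToZeroInProb.tendsto {X : ℕ → Ω → ℝ≥0∞} (h : ToZeroInProb P X) :
    Tendsto (fun q => X q.1 q.2) (probFilter P) (𝓝 0) := by
  rw [ENNReal.nhds_zero_basis.tendsto_right_iff]
  intro ε hε
  simpa [eventually_probFilter] using h ε hε

lemma tendstoInMeasure_iff_tendsto_probFilter {E : Type*} [PseudoEMetricSpace E]
    {X : ℕ → Ω → E} {c : E} :
    TendstoInMeasure P X atTop (fun _ => c) ↔
      Tendsto (fun q => X q.1 q.2) (probFilter P) (𝓝 c) := by
  simp [EMetric.tendsto_nhds, TendstoInMeasure, eventually_probFilter]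

/-- Convergence of first moments to `0` gives convergence to `0` in probability. -/
lemma tendsto_probFilter_of_lintegral {X : ℕ → Ω → ℝ≥0∞} (hX : ∀ n, AEMeasurable (X n) P)
    (h : Tendsto (fun n => ∫⁻ ω, X n ω ∂P) atTop (𝓝 0)) :
    Tendsto (fun q => X q.1 q.2) (probFilter P) (𝓝 0) := by
  refine ToZeroInProb.tendsto fun ε hε => ?_
  rcases eq_or_ne ε ∞ with rfl | hε'
  · have h1 := ENNReal.Tendsto.div_const h (b := 1) (by simp)
    rw [ENNReal.zero_div] at h1
    refine tendsto_of_tendsto_of_tendsto_of_le_of_le tendsto_const_nhds h1 (fun _ => zero_le)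
      fun n => (measure_mono fun ω hω => ?_).trans
        (meas_ge_le_lintegral_div (hX n) one_ne_zero ENNReal.one_ne_top)
    exact le_trans (le_top (a := (1 : ℝ≥0∞))) hω
  · have h1 := ENNReal.Tendsto.div_const h (b := ε) (Or.inr hε.ne')
    rw [ENNReal.zero_div] at h1
    exact tendsto_of_tendsto_of_tendsto_of_le_of_le tendsto_const_nhds h1 (fun _ => zero_le)
      fun n => meas_ge_le_lintegral_div (hX n) hε.ne' hε'

/-- `X n = O_p(1)`, for sizes `X n` with values in `[0, ∞]`. -/
def BddInProb (P : Measure Ω) (X : ℕ × Ω → ℝ≥0∞) : Prop :=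
  ∀ η : ℝ≥0∞, 0 < η → ∃ M : ℝ≥0∞, M ≠ ∞ ∧ ∀ᶠ n in atTop, P {ω | M < X (n, ω)} ≤ η

lemma BddInProb.mono {X Y : ℕ × Ω → ℝ≥0∞} (hX : BddInProb P X)
    (h : ∀ᶠ q in probFilter P, Y q ≤ X q) : BddInProb P Y := by
  intro η hη
  obtain ⟨M, hM, hX⟩ := hX (η / 2) (ENNReal.half_pos hη.ne')
  refine ⟨M, hM, ?_⟩
  have h2 := (ENNReal.tendsto_nhds_zero.1 (eventually_probFilter.1 h)) (η / 2)
    (ENNReal.half_pos hη.ne')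
  filter_upwards [hX, h2] with n h1 h2
  refine (measure_mono (t := {ω | M < X (n, ω)} ∪ {ω | ¬ Y (n, ω) ≤ X (n, ω)})
    fun ω hω => ?_).trans ((measure_union_le _ _).trans ?_)
  · by_cases h : Y (n, ω) ≤ X (n, ω)
    · exact Or.inl (lt_of_lt_of_le hω h)
    · exact Or.inr h
  · exact (add_le_add h1 h2).trans (ENNReal.add_halves η).le

/-- A sequence bounded in mean is `O_p(1)`. -/
lemma BddInProb.of_lintegral_le {X : ℕ × Ω → ℝ≥0∞} {C : ℝ≥0∞} (hC : C ≠ ∞)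
    (hX : ∀ n, AEMeasurable (fun ω => X (n, ω)) P)
    (h : ∀ᶠ n in atTop, ∫⁻ ω, X (n, ω) ∂P ≤ C) : BddInProb P X := by
  intro η hη
  rcases eq_or_ne η ∞ with rfl | hη'
  · exact ⟨0, by simp, by simp⟩
  have hM : (C + 1) / η ≠ ∞ := ENNReal.div_ne_top (by simp [hC]) hη.ne'
  refine ⟨(C + 1) / η, hM, ?_⟩
  filter_upwards [h] with n hn
  have h0 : (C + 1) / η ≠ 0 := (ENNReal.div_pos (by simp) hη').ne'
  refine (measure_mono (t := {ω | (C + 1) / η ≤ X (n, ω)})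
    fun ω hω => le_of_lt (Set.mem_ofPred_eq ▸ hω)).trans
      ((meas_ge_le_lintegral_div (hX n) h0 hM).trans ?_)
  refine ENNReal.div_le_of_le_mul ?_
  rw [ENNReal.mul_div_cancel hη.ne' hη']
  exact hn.trans le_self_add

lemma BddInProb.add {X Y : ℕ × Ω → ℝ≥0∞} (hX : BddInProb P X) (hY : BddInProb P Y) :
    BddInProb P (fun q => X q + Y q) := by
  intro η hη
  obtain ⟨M, hM, hX⟩ := hX (η / 2) (ENNReal.half_pos hη.ne')
  obtain ⟨N, hN, hY⟩ := hY (η / 2) (ENNReal.half_pos hη.ne')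
  refine ⟨M + N, by simp [hM, hN], ?_⟩
  filter_upwards [hX, hY] with n h1 h2
  refine (measure_mono (t := {ω | M < X (n, ω)} ∪ {ω | N < Y (n, ω)})
    fun ω hω => ?_).trans ((measure_union_le _ _).trans
      ((add_le_add h1 h2).trans (ENNReal.add_halves η).le))
  by_contra h
  simp only [Set.mem_union, Set.mem_ofPred_eq, not_or, not_lt] at h
  exact absurd hω (not_lt.2 (add_le_add h.1 h.2))

lemma BddInProb.sum {ι : Type*} {s : Finset ι} {X : ι → ℕ × Ω → ℝ≥0∞}
    (h : ∀ i ∈ s, BddInProb P (X i)) : BddInProb P (fun q => ∑ i ∈ s, X i q) := by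
  classical
  induction s using Finset.induction_on with
  | empty => exact fun η hη => ⟨0, by simp, by simp⟩
  | insert i s hi ih =>
    simp only [Finset.sum_insert hi]
    exact (h i (by simp)).add (ih fun j hj => h j (by simp [hj]))

/-- A sequence converging to a finite limit in probability is `O_p(1)`. -/
lemma BddInProb.of_tendsto {X : ℕ × Ω → ℝ≥0∞} {c : ℝ≥0∞} (hc : c ≠ ∞)
    (h : Tendsto X (probFilter P) (𝓝 c)) : BddInProb P X := by
  intro η hη
  have h1 : ∀ᶠ q in probFilter P, X q < c + 1 :=
    h.eventually_lt_const (ENNReal.lt_add_right hc one_ne_zero)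
  refine ⟨c + 1, by simp [hc], ?_⟩
  have h2 := ENNReal.tendsto_nhds_zero.1 (eventually_probFilter.1 h1) η hη
  filter_upwards [h2] with n hn
  exact (measure_mono fun ω hω => by simpa using (le_of_lt hω)).trans hn

/-- `O_p(1) · o_p(1) = o_p(1)`. -/
lemma BddInProb.mul_tendsto_zero {X Y : ℕ × Ω → ℝ≥0∞} (hX : BddInProb P X)
    (hY : Tendsto Y (probFilter P) (𝓝 0)) :
    Tendsto (fun q => X q * Y q) (probFilter P) (𝓝 0) := by
  rw [ENNReal.tendsto_nhds_zero]
  intro ε hε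
  rw [eventually_probFilter, ENNReal.tendsto_nhds_zero]
  intro η hη
  obtain ⟨M, hM, hX⟩ := hX (η / 2) (ENNReal.half_pos hη.ne')
  have h1 : ∀ᶠ q in probFilter P, Y q ≤ ε / (M + 1) :=
    ENNReal.tendsto_nhds_zero.1 hY _ (ENNReal.div_pos hε.ne' (by simp [hM]))
  have h2 := ENNReal.tendsto_nhds_zero.1 (eventually_probFilter.1 h1) (η / 2)
    (ENNReal.half_pos hη.ne')
  filter_upwards [hX, h2] with n h3 h4
  refine (measure_mono (t := {ω | M < X (n, ω)} ∪ {ω | ¬ Y (n, ω) ≤ ε / (M + 1)})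
    fun ω hω => ?_).trans ((measure_union_le _ _).trans
      ((add_le_add h3 h4).trans (ENNReal.add_halves η).le))
  by_contra h
  simp only [Set.mem_union, Set.mem_ofPred_eq, not_or, not_lt, not_not] at h
  refine hω ((mul_le_mul' (h.1.trans (le_self_add (b := 1))) h.2).trans ?_)
  exact ENNReal.mul_div_le

end ProbFilter

/-! ### Second moments of sums over pairs of independent observations -/

section SecondMoments

open scoped RealInnerProductSpace

variable {Ω Z H : Type*} [MeasurableSpace Ω] [MeasurableSpace Z] {μ : Measure Ω}
  [NormedAddCommGroup H] [InnerProductSpace ℝ H]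

lemma integrable_norm_sq_of_memLp {E : Type*} [NormedAddCommGroup E] {f : Ω → E}
    (hf : MemLp f 2 μ) : Integrable (fun ω => ‖f ω‖ ^ 2) μ :=
  hf.integrable_norm_pow (p := 2) two_ne_zero

lemma integral_norm_sq_comp {E Ω' : Type*} [NormedAddCommGroup E] [MeasurableSpace Ω']
    {ν : Measure Ω'} {φ : Ω → Ω'} (hφ : MeasurePreserving φ μ ν) {f : Ω' → E}
    (hf : StronglyMeasurable f) : ∫ ω, ‖f (φ ω)‖ ^ 2 ∂μ = ∫ z, ‖f z‖ ^ 2 ∂ν := by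
  rw [← hφ.map_eq, integral_map hφ.aemeasurable
    (f := fun z => ‖f z‖ ^ 2) (hf.norm.pow 2).aestronglyMeasurable]

lemma lintegral_enorm_sq_eq {E : Type*} [NormedAddCommGroup E] {f : Ω → E} (hf : MemLp f 2 μ) :
    ∫⁻ ω, ‖f ω‖ₑ ^ 2 ∂μ = ENNReal.ofReal (∫ ω, ‖f ω‖ ^ 2 ∂μ) := by
  rw [ofReal_integral_eq_lintegral_ofReal (integrable_norm_sq_of_memLp hf)
    (ae_of_all _ fun _ => by positivity)]
  simp [ENNReal.ofReal_pow]

lemma memLp_two_of_lintegral {E : Type*} [NormedAddCommGroup E] {f : Ω → E}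
    (hf : AEStronglyMeasurable f μ) (h : ∫⁻ ω, ‖f ω‖ₑ ^ 2 ∂μ < ∞) : MemLp f 2 μ := by
  refine ⟨hf, ?_⟩
  rw [eLpNorm_lt_top_iff_lintegral_rpow_enorm_lt_top (by simp) (by simp)]
  simpa using h

lemma integrable_inner_of_memLp {f g : Ω → H} (hf : MemLp f 2 μ) (hg : MemLp g 2 μ) :
    Integrable (fun ω => ⟪f ω, g ω⟫) μ := by
  refine Integrable.mono' ((integrable_norm_sq_of_memLp hf).add (integrable_norm_sq_of_memLp hg))
    (hf.1.inner hg.1) (ae_of_all _ fun ω => ?_)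
  have h := norm_inner_le_norm (𝕜 := ℝ) (f ω) (g ω)
  simp only [Pi.add_apply]
  nlinarith [sq_nonneg (‖f ω‖ - ‖g ω‖), sq_nonneg (‖f ω‖ + ‖g ω‖)]

/-- The second moment of a sum is at most the number of pairs of possibly correlated summands,
times a bound for the second moments of the summands. -/
lemma integral_norm_sq_sum_le {ι : Type*} (S : Finset ι) {X : ι → Ω → H}
    (hX : ∀ i ∈ S, MemLp (X i) 2 μ) (R : ι → ι → Prop) [DecidableRel R]
    (h0 : ∀ i ∈ S, ∀ j ∈ S, ¬ R i j → ∫ ω, ⟪X i ω, X j ω⟫ ∂μ = 0) {σ : ℝ}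
    (hσ : ∀ i ∈ S, ∫ ω, ‖X i ω‖ ^ 2 ∂μ ≤ σ) :
    ∫ ω, ‖∑ i ∈ S, X i ω‖ ^ 2 ∂μ ≤ (∑ i ∈ S, (S.filter (R i)).card : ℕ) * σ := by
  have h1 : ∀ ω, ‖∑ i ∈ S, X i ω‖ ^ 2 = ∑ i ∈ S, ∑ j ∈ S, ⟪X i ω, X j ω⟫ := by
    intro ω
    rw [← real_inner_self_eq_norm_sq, sum_inner]
    simp_rw [inner_sum]
  simp_rw [h1]
  have hint : ∀ i ∈ S, ∀ j ∈ S, Integrable (fun ω => ⟪X i ω, X j ω⟫) μ := fun i hi j hj =>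
    integrable_inner_of_memLp (hX i hi) (hX j hj)
  rw [integral_finsetSum _ fun i hi => integrable_finsetSum _ (hint i hi)]
  push_cast
  rw [Finset.sum_mul]
  refine Finset.sum_le_sum fun i hi => ?_
  rw [integral_finsetSum _ (hint i hi), ← Finset.sum_filter_add_sum_filter_not S (R i),
    Finset.sum_eq_zero (s := S.filter fun j => ¬ R i j), add_zero, ← nsmul_eq_mul]
  · refine Finset.sum_le_card_nsmul _ _ _ fun j hj => ?_
    have hj := (Finset.mem_filter.1 hj).1
    have h2 : ∫ ω, ⟪X i ω, X j ω⟫ ∂μ ≤ ∫ ω, (‖X i ω‖ ^ 2 + ‖X j ω‖ ^ 2) / 2 ∂μ := by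
      refine integral_mono (hint i hi j hj)
        (((integrable_norm_sq_of_memLp (hX i hi)).add
          (integrable_norm_sq_of_memLp (hX j hj))).div_const 2) fun ω => ?_
      have := real_inner_le_norm (X i ω) (X j ω)
      simp only
      nlinarith [sq_nonneg (‖X i ω‖ - ‖X j ω‖)]
    rw [integral_div, integral_add (integrable_norm_sq_of_memLp (hX i hi))
      (integrable_norm_sq_of_memLp (hX j hj))] at h2
    linarith [hσ i hi, hσ j hj]
  · intro j hj
    exact h0 i hi j (Finset.mem_filter.1 hj).1 (Finset.mem_filter.1 hj).2

lemma integral_norm_sub_mean_sq_le [CompleteSpace H] [IsProbabilityMeasure μ] {f : Ω → H}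
    (hf : MemLp f 2 μ) :
    ∫ ω, ‖f ω - ∫ x, f x ∂μ‖ ^ 2 ∂μ ≤ ∫ ω, ‖f ω‖ ^ 2 ∂μ := by
  have hi : Integrable f μ := hf.integrable one_le_two
  have hc : Integrable (fun ω => ⟪∫ x, f x ∂μ, f ω⟫) μ := hi.const_inner _
  have h1 : ∀ ω, ‖f ω - ∫ x, f x ∂μ‖ ^ 2
      = ‖f ω‖ ^ 2 - 2 * ⟪∫ x, f x ∂μ, f ω⟫ + ‖∫ x, f x ∂μ‖ ^ 2 := by
    intro ω
    rw [norm_sub_sq_real, real_inner_comm]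
  simp_rw [h1]
  have hn := integrable_norm_sq_of_memLp hf
  rw [integral_add (f := fun ω => ‖f ω‖ ^ 2 - 2 * ⟪∫ x, f x ∂μ, f ω⟫)
    (hn.sub (hc.const_mul 2)) (integrable_const _), integral_sub hn (hc.const_mul 2),
    integral_const_mul, integral_inner hi, real_inner_self_eq_norm_sq]
  simp only [integral_const, probReal_univ, smul_eq_mul, one_mul]
  nlinarith [sq_nonneg ‖∫ x, f x ∂μ‖]

/-- A square integrable function of `(X, Y)` with conditional mean zero given `X` is orthogonal to
the functions of `X`, for independent `X` and `Y`. -/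
lemma integral_inner_eq_zero_of_indepFun [CompleteSpace H] [IsProbabilityMeasure μ]
    {U V : Type*} [MeasurableSpace U]
    [MeasurableSpace V] {X : Ω → U} {Y : Ω → V} (hX : Measurable X) (hY : Measurable Y)
    (hXY : X ⟂ᵢ[μ] Y) {u : U → H} {v : U × V → H} (hu : StronglyMeasurable u)
    (hv : StronglyMeasurable v) (hu2 : MemLp (fun ω => u (X ω)) 2 μ)
    (hv2 : MemLp (fun ω => v (X ω, Y ω)) 2 μ)
    (h0 : ∀ᵐ x ∂μ.map X, ∫ y, v (x, y) ∂μ.map Y = 0) :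
    ∫ ω, ⟪u (X ω), v (X ω, Y ω)⟫ ∂μ = 0 := by
  have := Measure.isProbabilityMeasure_map (μ := μ) hX.aemeasurable
  have := Measure.isProbabilityMeasure_map (μ := μ) hY.aemeasurable
  have hlaw := (indepFun_iff_map_prod_eq_prod_map_map hX.aemeasurable hY.aemeasurable).1 hXY
  have hm : AEMeasurable (fun ω => (X ω, Y ω)) μ := (hX.prodMk hY).aemeasurable
  have hw : StronglyMeasurable fun z : U × V => ⟪u z.1, v z⟫ :=
    (hu.comp_measurable measurable_fst).inner hv
  have h1 : ∫ ω, ⟪u (X ω), v (X ω, Y ω)⟫ ∂μ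
      = ∫ z, ⟪u z.1, v z⟫ ∂((μ.map X).prod (μ.map Y)) := by
    rw [← hlaw, integral_map hm hw.aestronglyMeasurable]
  have hi : Integrable (fun z : U × V => ⟪u z.1, v z⟫) ((μ.map X).prod (μ.map Y)) := by
    rw [← hlaw, integrable_map_measure hw.aestronglyMeasurable hm]
    exact integrable_inner_of_memLp hu2 hv2
  have hvi : Integrable v ((μ.map X).prod (μ.map Y)) := by
    rw [← hlaw, integrable_map_measure hv.aestronglyMeasurable hm]
    exact hv2.integrable one_le_two
  rw [h1, integral_prod _ hi]
  refine integral_eq_zero_of_ae ?_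
  filter_upwards [h0, hvi.prod_right_ae] with x hx hx'
  simp only [Pi.zero_apply]
  rw [integral_inner hx', hx, inner_zero_right]

end SecondMoments

section Pairs

open scoped RealInnerProductSpace

variable {Ω Z H ι : Type*} [MeasurableSpace Ω] [MeasurableSpace Z] {μ : Measure Ω}
  [IsProbabilityMeasure μ] {F : Measure Z} {Y : ι → Ω → Z}
  [NormedAddCommGroup H] [InnerProductSpace ℝ H]

lemma measurePreserving_pair (hY : ∀ i, Measurable (Y i)) (hlaw : ∀ i, μ.map (Y i) = F)
    (hind : iIndepFun Y μ) {i j : ι} (hij : i ≠ j) :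
    MeasurePreserving (fun ω => (Y i ω, Y j ω)) μ (F.prod F) :=
  ⟨(hY i).prodMk (hY j), by
    rw [(indepFun_iff_map_prod_eq_prod_map_map (hY i).aemeasurable (hY j).aemeasurable).1
      (hind.indepFun hij), hlaw, hlaw]⟩

lemma integral_inner_disjoint_pairs [CompleteSpace H] (hY : ∀ i, Measurable (Y i))
    (hlaw : ∀ i, μ.map (Y i) = F) (hind : iIndepFun Y μ) {f : Z × Z → H}
    (hf : StronglyMeasurable f) (hf2 : MemLp f 2 (F.prod F)) (hf0 : ∫ z, f z ∂F.prod F = 0)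
    {i j i' j' : ι} (hij : i ≠ j) (hij' : i' ≠ j') (h1 : i ≠ i') (h2 : i ≠ j') (h3 : j ≠ i')
    (h4 : j ≠ j') :
    ∫ ω, ⟪f (Y i ω, Y j ω), f (Y i' ω, Y j' ω)⟫ ∂μ = 0 := by
  have hp := measurePreserving_pair hY hlaw hind hij
  have hp' := measurePreserving_pair hY hlaw hind hij'
  refine integral_inner_eq_zero_of_indepFun (X := fun ω => (Y i ω, Y j ω))
    (Y := fun ω => (Y i' ω, Y j' ω)) (u := f) (v := fun z => f z.2) hp.measurable hp'.measurable
    (hind.indepFun_prodMk_prodMk hY _ _ _ _ h1 h2 h3 h4) hf (hf.comp_measurable measurable_snd)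
    (hf2.comp_measurePreserving hp) (hf2.comp_measurePreserving hp') (ae_of_all _ fun _ => ?_)
  rw [hp'.map_eq]
  exact hf0

/-- Two values of a degenerate kernel that share their first argument only are orthogonal: given
the first pair, the second value has conditional mean zero. -/
lemma integral_inner_shared_index [CompleteSpace H] (hY : ∀ i, Measurable (Y i))
    (hlaw : ∀ i, μ.map (Y i) = F) (hind : iIndepFun Y μ) {f : Z × Z → H}
    (hf : StronglyMeasurable f) (hf2 : MemLp f 2 (F.prod F))
    (hf0 : ∀ᵐ w ∂F, ∫ w', f (w, w') ∂F = 0)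
    {i j k : ι} (hij : i ≠ j) (hik : i ≠ k) (hjk : j ≠ k) :
    ∫ ω, ⟪f (Y i ω, Y j ω), f (Y i ω, Y k ω)⟫ ∂μ = 0 := by
  have hp := measurePreserving_pair hY hlaw hind hij
  have hp' := measurePreserving_pair hY hlaw hind hik
  have hF : IsProbabilityMeasure F := by
    rw [← hlaw i]; exact Measure.isProbabilityMeasure_map (hY i).aemeasurable
  refine integral_inner_eq_zero_of_indepFun (X := fun ω => (Y i ω, Y j ω))
    (Y := Y k) (u := f) (v := fun z => f (z.1.1, z.2)) hp.measurable (hY k)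
    (hind.indepFun_prodMk hY _ _ _ hik hjk) hf (hf.comp_measurable (by fun_prop))
    (hf2.comp_measurePreserving hp) (hf2.comp_measurePreserving hp') ?_
  rw [hp.map_eq, hlaw]
  exact Measure.quasiMeasurePreserving_fst.ae hf0

lemma mem_indexPairs {n : ℕ} {p : Fin n × Fin n} : p ∈ indexPairs n ↔ p.1 < p.2 := by
  simp [indexPairs]

lemma card_indexPairs (n : ℕ) : (indexPairs n).card = n.choose 2 := by
  simpa [indexPairs] using Fintype.card_product_filter_lt (α := Fin n)

/-- The sum of a mean-zero kernel over a set of pairs: only pairs with a common index are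
correlated, and a pair has a common index with at most `4 n` pairs. -/
lemma integral_norm_sq_sum_pairs_le [CompleteSpace H] {n : ℕ} {Y : Fin n → Ω → Z}
    (hY : ∀ i, Measurable (Y i))
    (hlaw : ∀ i, μ.map (Y i) = F) (hind : iIndepFun Y μ) {f : Z × Z → H}
    (hf : StronglyMeasurable f) (hf2 : MemLp f 2 (F.prod F)) (hf0 : ∫ z, f z ∂F.prod F = 0)
    {S : Finset (Fin n × Fin n)} (hS : S ⊆ indexPairs n) :
    ∫ ω, ‖∑ p ∈ S, f (Y p.1 ω, Y p.2 ω)‖ ^ 2 ∂μ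
      ≤ 4 * n * S.card * ∫ z, ‖f z‖ ^ 2 ∂F.prod F := by
  have hne : ∀ p ∈ S, p.1 ≠ p.2 := fun p hp => (mem_indexPairs.1 (hS hp)).ne
  have hp : ∀ p ∈ S, MeasurePreserving (fun ω => (Y p.1 ω, Y p.2 ω)) μ (F.prod F) := fun p hp =>
    measurePreserving_pair hY hlaw hind (hne p hp)
  let R : Fin n × Fin n → Fin n × Fin n → Prop := fun p q =>
    p.1 = q.1 ∨ p.1 = q.2 ∨ p.2 = q.1 ∨ p.2 = q.2
  have h1 := integral_norm_sq_sum_le (μ := μ) S (X := fun p ω => f (Y p.1 ω, Y p.2 ω))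
    (fun p hpS => hf2.comp_measurePreserving (hp p hpS)) R (fun p hpS q hqS hR => by
      simp only [R, not_or] at hR
      exact integral_inner_disjoint_pairs hY hlaw hind hf hf2 hf0 (hne p hpS) (hne q hqS)
        hR.1 hR.2.1 hR.2.2.1 hR.2.2.2)
    (σ := ∫ z, ‖f z‖ ^ 2 ∂F.prod F) (fun p hpS => by
      exact (integral_norm_sq_comp (hp p hpS) hf).le)
  refine h1.trans (mul_le_mul_of_nonneg_right ?_ (integral_nonneg fun _ => by positivity))
  have h2 : ∀ p ∈ S, (S.filter (R p)).card ≤ 4 * n := by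
    intro p _
    have hsub : S.filter (R p) ⊆ (({p.1} ×ˢ Finset.univ) ∪ (Finset.univ ×ˢ {p.1})) ∪
        (({p.2} ×ˢ Finset.univ) ∪ (Finset.univ ×ˢ {p.2})) := by
      intro q hq
      have := (Finset.mem_filter.1 hq).2
      simp only [R] at this
      simp only [Finset.mem_union, Finset.mem_product, Finset.mem_singleton, Finset.mem_univ,
        and_true, true_and]
      tauto
    refine (Finset.card_le_card hsub).trans ((Finset.card_union_le _ _).trans ?_)
    have h3 := Finset.card_union_le (({p.1} : Finset (Fin n)) ×ˢ (Finset.univ : Finset (Fin n)))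
      (Finset.univ ×ˢ {p.1})
    have h4 := Finset.card_union_le (({p.2} : Finset (Fin n)) ×ˢ (Finset.univ : Finset (Fin n)))
      (Finset.univ ×ˢ {p.2})
    simp only [Finset.card_product, Finset.card_singleton, Finset.card_univ, Fintype.card_fin]
      at h3 h4
    omega
  have h5 := Finset.sum_le_card_nsmul S _ _ h2
  rw [smul_eq_mul] at h5
  have h6 : ((∑ p ∈ S, (S.filter (R p)).card : ℕ) : ℝ) ≤ (S.card * (4 * n) : ℕ) := by
    exact_mod_cast h5
  refine h6.trans (le_of_eq ?_)
  push_cast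
  ring

/-- The sum of a symmetric degenerate kernel over all pairs: distinct pairs are uncorrelated. -/
lemma integral_norm_sq_sum_degenerate_le [CompleteSpace H] {n : ℕ} {Y : Fin n → Ω → Z}
    (hY : ∀ i, Measurable (Y i))
    (hlaw : ∀ i, μ.map (Y i) = F) (hind : iIndepFun Y μ) {f : Z × Z → H}
    (hf : StronglyMeasurable f) (hf2 : MemLp f 2 (F.prod F))
    (hf0 : ∀ᵐ w ∂F, ∫ w', f (w, w') ∂F = 0) (hsymm : ∀ w w', f (w, w') = f (w', w)) :
    ∫ ω, ‖∑ p ∈ indexPairs n, f (Y p.1 ω, Y p.2 ω)‖ ^ 2 ∂μ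
      ≤ n.choose 2 * ∫ z, ‖f z‖ ^ 2 ∂F.prod F := by
  have hne : ∀ p ∈ indexPairs n, p.1 ≠ p.2 := fun p hp => (mem_indexPairs.1 hp).ne
  have hp : ∀ p ∈ indexPairs n, MeasurePreserving (fun ω => (Y p.1 ω, Y p.2 ω)) μ (F.prod F) :=
    fun p hp => measurePreserving_pair hY hlaw hind (hne p hp)
  have h1 := integral_norm_sq_sum_le (μ := μ) (indexPairs n)
    (X := fun p ω => f (Y p.1 ω, Y p.2 ω))
    (fun p hpS => hf2.comp_measurePreserving (hp p hpS)) (fun p q => q = p)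
    (fun p hpS q hqS hpq => ?_)
    (σ := ∫ z, ‖f z‖ ^ 2 ∂F.prod F) (fun p hpS => by
      exact (integral_norm_sq_comp (hp p hpS) hf).le)
  · refine h1.trans (mul_le_mul_of_nonneg_right ?_ (integral_nonneg fun _ => by positivity))
    have : ∀ p ∈ indexPairs n, ((indexPairs n).filter fun q => q = p).card ≤ 1 := fun p hp => by
      rw [Finset.filter_eq', if_pos hp, Finset.card_singleton]
    have h5 := Finset.sum_le_card_nsmul _ _ _ this
    rw [smul_eq_mul, mul_one, card_indexPairs] at h5
    exact_mod_cast h5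
  · have hshare := fun {i j k : Fin n} => integral_inner_shared_index hY hlaw hind hf hf2 hf0
      (i := i) (j := j) (k := k)
    have hF : IsProbabilityMeasure F := by
      rw [← hlaw p.1]; exact Measure.isProbabilityMeasure_map (hY p.1).aemeasurable
    have hf00 : ∫ z, f z ∂F.prod F = 0 := by
      rw [integral_prod _ (hf2.integrable one_le_two)]
      exact integral_eq_zero_of_ae hf0
    obtain ⟨i, j⟩ := p
    obtain ⟨i', j'⟩ := q
    have hij := hne _ hpS
    have hij' := hne _ hqS
    simp only [ne_eq, Prod.mk.injEq, not_and] at hij hij' hpq ⊢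
    -- by symmetry of the kernel, a common index can be moved to the first place in both factors
    by_cases h1 : i = i'
    · subst h1
      exact hshare hij hij' (fun h => hpq rfl h.symm)
    by_cases h2 : i = j'
    · subst h2
      simp_rw [hsymm (Y i' _) (Y i _)]
      refine hshare hij (Ne.symm hij') fun h => ?_
      subst h
      exact absurd ((mem_indexPairs.1 hpS).trans (mem_indexPairs.1 hqS)) (lt_irrefl _)
    by_cases h3 : j = i'
    · subst h3
      simp_rw [hsymm (Y i _) (Y j _)]
      exact hshare (Ne.symm hij) hij' h2
    by_cases h4 : j = j'
    · subst h4
      simp_rw [hsymm (Y i _) (Y j _), hsymm (Y i' _) (Y j _)]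
      exact hshare (Ne.symm hij) (Ne.symm hij') h1
    exact integral_inner_disjoint_pairs hY hlaw hind hf hf2 hf00 hij hij' h1 h2 h3 h4

/-- The sum over `j ≠ i` of a kernel that is degenerate in its second argument. -/
lemma integral_norm_sq_sum_erase_le [CompleteSpace H] {n : ℕ} {Y : Fin n → Ω → Z}
    (hY : ∀ i, Measurable (Y i))
    (hlaw : ∀ i, μ.map (Y i) = F) (hind : iIndepFun Y μ) {f : Z × Z → H}
    (hf : StronglyMeasurable f) (hf2 : MemLp f 2 (F.prod F))
    (hf0 : ∀ᵐ w ∂F, ∫ w', f (w, w') ∂F = 0) (i : Fin n) :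
    ∫ ω, ‖∑ j ∈ Finset.univ.erase i, f (Y i ω, Y j ω)‖ ^ 2 ∂μ
      ≤ (n - 1) * ∫ z, ‖f z‖ ^ 2 ∂F.prod F := by
  have hp : ∀ j ∈ Finset.univ.erase i,
      MeasurePreserving (fun ω => (Y i ω, Y j ω)) μ (F.prod F) := fun j hj =>
    measurePreserving_pair hY hlaw hind (Finset.ne_of_mem_erase hj).symm
  have h1 := integral_norm_sq_sum_le (μ := μ) (Finset.univ.erase i)
    (X := fun j ω => f (Y i ω, Y j ω))
    (fun j hj => hf2.comp_measurePreserving (hp j hj)) (fun j j' => j' = j)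
    (fun j hj j' hj' hjj => integral_inner_shared_index hY hlaw hind hf hf2 hf0
      (Finset.ne_of_mem_erase hj).symm (Finset.ne_of_mem_erase hj').symm (Ne.symm hjj))
    (σ := ∫ z, ‖f z‖ ^ 2 ∂F.prod F) (fun j hj => by
      exact (integral_norm_sq_comp (hp j hj) hf).le)
  refine h1.trans (mul_le_mul_of_nonneg_right ?_ (integral_nonneg fun _ => by positivity))
  have : ∀ p ∈ Finset.univ.erase i, ((Finset.univ.erase i).filter fun q => q = p).card ≤ 1 :=
    fun p hp => by rw [Finset.filter_eq', if_pos hp, Finset.card_singleton]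
  have h5 := Finset.sum_le_card_nsmul _ _ _ this
  rw [smul_eq_mul, mul_one, Finset.card_erase_of_mem (Finset.mem_univ i), Finset.card_univ,
    Fintype.card_fin] at h5
  have hn : 1 ≤ n := i.pos
  have h6 : ((∑ p ∈ Finset.univ.erase i,
      ((Finset.univ.erase i).filter fun q => q = p).card : ℕ) : ℝ) ≤ (n - 1 : ℕ) := by
    exact_mod_cast h5
  rwa [Nat.cast_sub hn, Nat.cast_one] at h6

end Pairs

/-! ### Limit theorems for U-statistics -/

section UStatistics

variable {Ω Z H : Type*} [MeasurableSpace Ω] [MeasurableSpace Z] {μ : Measure Ω}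
  [IsProbabilityMeasure μ] {F : Measure Z}
  [NormedAddCommGroup H] [InnerProductSpace ℝ H]

lemma sq_lintegral_le {X : Ω → ℝ≥0∞} (hX : AEMeasurable X μ) :
    (∫⁻ ω, X ω ∂μ) ^ 2 ≤ ∫⁻ ω, X ω ^ 2 ∂μ := by
  have h := ENNReal.lintegral_mul_le_Lp_mul_Lq μ Real.HolderConjugate.two_two hX
    (aemeasurable_const (b := (1 : ℝ≥0∞)))
  simp only [Pi.mul_apply, mul_one, ENNReal.one_rpow, lintegral_const, measure_univ] at h
  refine (pow_le_pow_left' h 2).trans (le_of_eq ?_)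
  rw [← ENNReal.rpow_natCast, ← ENNReal.rpow_mul]
  norm_num

lemma sq_div_four_le_choose_two {n : ℕ} (hn : 2 ≤ n) : (n : ℝ) ^ 2 / 4 ≤ (n.choose 2 : ℝ) := by
  have h2 : (2 : ℝ) ≤ n := by exact_mod_cast hn
  rw [Nat.cast_choose_two]
  nlinarith

lemma choose_two_pos {n : ℕ} (hn : 2 ≤ n) : (0 : ℝ) < (n.choose 2 : ℝ) := by
  exact_mod_cast Nat.choose_pos hn

/-- Second moment bound for `√n` times a centered sum over a set of pairs, normalised as a
U-statistic. The bound is uniform in the sample size and in the kernel, which allows the kernel to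
be an estimate. -/
lemma lintegral_enorm_sq_centered_sum_le [CompleteSpace H] {n : ℕ} (hn : 2 ≤ n)
    {Y : Fin n → Ω → Z} (hY : ∀ i, Measurable (Y i))
    (hlaw : ∀ i, μ.map (Y i) = F) (hind : iIndepFun Y μ) {f : Z × Z → H}
    (hf : StronglyMeasurable f) {S : Finset (Fin n × Fin n)} (hS : S ⊆ indexPairs n) :
    ∫⁻ ω, ‖(Real.sqrt n * (n.choose 2 : ℝ)⁻¹) •
        ∑ p ∈ S, (f (Y p.1 ω, Y p.2 ω) - ∫ z, f z ∂F.prod F)‖ₑ ^ 2 ∂μ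
      ≤ 16 * ∫⁻ z, ‖f z‖ₑ ^ 2 ∂F.prod F := by
  rcases eq_or_ne (∫⁻ z, ‖f z‖ₑ ^ 2 ∂F.prod F) ∞ with h | h
  · simp [h]
  have hF : IsProbabilityMeasure F := by
    rw [← hlaw ⟨0, by omega⟩]
    exact Measure.isProbabilityMeasure_map (hY _).aemeasurable
  have hf2 : MemLp f 2 (F.prod F) :=
    memLp_two_of_lintegral hf.aestronglyMeasurable (lt_top_iff_ne_top.2 h)
  set m := ∫ z, f z ∂F.prod F with hm
  have hg2 : MemLp (fun z => f z - m) 2 (F.prod F) := hf2.sub (memLp_const m)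
  have hg0 : ∫ z, (f z - m) ∂F.prod F = 0 := by
    rw [integral_sub (hf2.integrable one_le_two) (integrable_const _)]
    simp [hm]
  have hp : ∀ p ∈ S, MeasurePreserving (fun ω => (Y p.1 ω, Y p.2 ω)) μ (F.prod F) := fun p hp =>
    measurePreserving_pair hY hlaw hind (mem_indexPairs.1 (hS hp)).ne
  have hX : MemLp (fun ω => (Real.sqrt n * (n.choose 2 : ℝ)⁻¹) •
      ∑ p ∈ S, (f (Y p.1 ω, Y p.2 ω) - m)) 2 μ :=
    (memLp_finsetSum S fun p hpS => hg2.comp_measurePreserving (hp p hpS)).const_smul _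
  rw [lintegral_enorm_sq_eq hX, lintegral_enorm_sq_eq hf2,
    show (16 : ℝ≥0∞) = ENNReal.ofReal 16 by simp, ← ENNReal.ofReal_mul (by norm_num)]
  refine ENNReal.ofReal_le_ofReal ?_
  have h1 : ∫ ω, ‖∑ p ∈ S, (f (Y p.1 ω, Y p.2 ω) - m)‖ ^ 2 ∂μ
      ≤ 4 * n * S.card * ∫ z, ‖f z - m‖ ^ 2 ∂F.prod F :=
    integral_norm_sq_sum_pairs_le hY hlaw hind (hf.sub stronglyMeasurable_const) hg2 hg0 hS
  have h2 := integral_norm_sub_mean_sq_le hf2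
  rw [← hm] at h2
  have h3 : (S.card : ℝ) ≤ n.choose 2 := by
    rw [← card_indexPairs]; exact_mod_cast Finset.card_le_card hS
  have hc := choose_two_pos hn
  have hc4 := sq_div_four_le_choose_two hn
  simp_rw [norm_smul, mul_pow]
  rw [integral_const_mul]
  have h4 : ‖Real.sqrt n * (n.choose 2 : ℝ)⁻¹‖ ^ 2 = n / (n.choose 2 : ℝ) ^ 2 := by
    rw [Real.norm_eq_abs, sq_abs, mul_pow, Real.sq_sqrt (Nat.cast_nonneg n), inv_pow,
      div_eq_mul_inv]
  rw [h4]
  have hI : 0 ≤ ∫ z, ‖f z‖ ^ 2 ∂F.prod F := integral_nonneg fun _ => by positivity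
  have hI' : 0 ≤ ∫ z, ‖f z - m‖ ^ 2 ∂F.prod F := integral_nonneg fun _ => by positivity
  calc (n : ℝ) / (n.choose 2 : ℝ) ^ 2 * ∫ ω, ‖∑ p ∈ S, (f (Y p.1 ω, Y p.2 ω) - m)‖ ^ 2 ∂μ
      ≤ (n : ℝ) / (n.choose 2 : ℝ) ^ 2 *
          (4 * n * (n.choose 2 : ℝ) * ∫ z, ‖f z‖ ^ 2 ∂F.prod F) := by
        refine mul_le_mul_of_nonneg_left (h1.trans ?_) (by positivity)
        gcongr
    _ = (4 * n ^ 2 / (n.choose 2 : ℝ)) * ∫ z, ‖f z‖ ^ 2 ∂F.prod F := by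
        field_simp
    _ ≤ 16 * ∫ z, ‖f z‖ ^ 2 ∂F.prod F := by
        refine mul_le_mul_of_nonneg_right ?_ hI
        rw [div_le_iff₀ hc]
        linarith

variable {W : ℕ → Ω → Z}

lemma enorm_sq_sqrt_mul (n : ℕ) (x : H) :
    ‖Real.sqrt n • x‖ₑ ^ 2 = n * ‖x‖ₑ ^ 2 := by
  rw [enorm_smul, mul_pow, ← enorm_pow, Real.sq_sqrt (Nat.cast_nonneg n), Real.enorm_natCast]

/-- The average of an integrable kernel over the pairs `i < j` converges in mean: the kernel is
approximated in `L₁` by a simple function, for which a second moment bound is available. -/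
lemma tendsto_lintegral_pairAverage [CompleteSpace H] [MeasurableSpace H] [BorelSpace H]
    [SecondCountableTopology H] (hW : ∀ i, Measurable (W i)) (hlaw : ∀ i, μ.map (W i) = F)
    (hind : iIndepFun W μ) {f : Z × Z → H} (hf : StronglyMeasurable f)
    (hfi : Integrable f (F.prod F)) :
    Tendsto (fun n : ℕ => ∫⁻ ω, ‖(n.choose 2 : ℝ)⁻¹ •
      ∑ p ∈ indexPairs n, f (W p.1 ω, W p.2 ω) - ∫ z, f z ∂F.prod F‖ₑ ∂μ) atTop (𝓝 0) := by
  have hF : IsProbabilityMeasure F := by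
    rw [← hlaw 0]
    exact Measure.isProbabilityMeasure_map (hW _).aemeasurable
  rw [ENNReal.tendsto_nhds_zero]
  intro ε hε
  have hε3 : ε / 3 ≠ 0 := (ENNReal.div_pos hε.ne' (by simp)).ne'
  obtain ⟨g, hg, hgi⟩ := (memLp_one_iff_integrable.2 hfi).exists_simpleFunc_eLpNorm_sub_lt
    (by simp) hε3
  have hg2 : MemLp g 2 (F.prod F) := g.memLp_of_isFiniteMeasure 2 _
  have hgm : StronglyMeasurable g := g.stronglyMeasurable
  rw [memLp_one_iff_integrable] at hgi
  rw [eLpNorm_one_eq_lintegral_enorm] at hg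
  have hC : 16 * ∫⁻ z, ‖g z‖ₑ ^ 2 ∂F.prod F ≠ ∞ := by
    rw [lintegral_enorm_sq_eq hg2]
    exact ENNReal.mul_ne_top (by simp) ENNReal.ofReal_ne_top
  set C := 16 * ∫⁻ z, ‖g z‖ₑ ^ 2 ∂F.prod F with hCdef
  -- the contribution of the square integrable approximation
  have hlim : Tendsto (fun n : ℕ => (C * (n : ℝ≥0∞)⁻¹) ^ (1 / 2 : ℝ)) atTop (𝓝 0) := by
    have h1 : Tendsto (fun n : ℕ => C * (n : ℝ≥0∞)⁻¹) atTop (𝓝 0) := by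
      simpa using ENNReal.Tendsto.const_mul ENNReal.tendsto_inv_nat_nhds_zero (Or.inr hC)
    have h2 := (ENNReal.continuous_rpow_const (y := (1 / 2 : ℝ))).tendsto 0
    rw [ENNReal.zero_rpow_of_pos (by norm_num)] at h2
    exact h2.comp h1
  filter_upwards [ENNReal.tendsto_nhds_zero.1 hlim (ε / 3) (pos_iff_ne_zero.2 hε3),
    eventually_ge_atTop 2] with n hn1 hn
  have hY : ∀ i : Fin n, Measurable (W i) := fun i => hW i
  have hindn : iIndepFun (fun i : Fin n => W i) μ := hind.precomp Fin.val_injective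
  have hp : ∀ p ∈ indexPairs n,
      MeasurePreserving (fun ω => (W p.1 ω, W p.2 ω)) μ (F.prod F) := fun p hp =>
    measurePreserving_pair (Y := fun i : Fin n => W i) hY (fun i => hlaw i) hindn
      (mem_indexPairs.1 hp).ne
  have hc := choose_two_pos hn
  have hn0 : (n : ℝ≥0∞) ≠ 0 := by simp; omega
  set A : Ω → H := fun ω => (n.choose 2 : ℝ)⁻¹ •
    ∑ p ∈ indexPairs n, (f (W p.1 ω, W p.2 ω) - g (W p.1 ω, W p.2 ω)) with hA
  set D : Ω → H := fun ω => (n.choose 2 : ℝ)⁻¹ •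
    ∑ p ∈ indexPairs n, (g (W p.1 ω, W p.2 ω) - ∫ z, g z ∂F.prod F) with hD
  have hDm : Measurable D := by
    refine Measurable.const_smul (Finset.measurable_fun_sum _ fun p _ => ?_) _
    exact (hgm.measurable.comp ((hW _).prodMk (hW _))).sub_const _
  have hAm : Measurable A := by
    refine Measurable.const_smul (Finset.measurable_fun_sum _ fun p _ => ?_) _
    exact (hf.measurable.comp ((hW _).prodMk (hW _))).sub
      (hgm.measurable.comp ((hW _).prodMk (hW _)))
  have hsplit : ∀ ω, (n.choose 2 : ℝ)⁻¹ • ∑ p ∈ indexPairs n, f (W p.1 ω, W p.2 ω)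
      - ∫ z, f z ∂F.prod F = A ω + D ω + ∫ z, (g z - f z) ∂F.prod F := by
    intro ω
    rw [integral_sub hgi hfi]
    simp only [hA, hD, Finset.sum_sub_distrib, Finset.sum_const, card_indexPairs, smul_sub]
    rw [← Nat.cast_smul_eq_nsmul ℝ, smul_smul, inv_mul_cancel₀ hc.ne', one_smul]
    abel
  have hAle : ∫⁻ ω, ‖A ω‖ₑ ∂μ ≤ ε / 3 := by
    have h1 : ∀ ω, ‖A ω‖ₑ ≤ ‖(n.choose 2 : ℝ)⁻¹‖ₑ *
        ∑ p ∈ indexPairs n, ‖f (W p.1 ω, W p.2 ω) - g (W p.1 ω, W p.2 ω)‖ₑ := fun ω => by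
      rw [hA, enorm_smul]
      gcongr
      exact enorm_sum_le _ _
    refine (lintegral_mono h1).trans ?_
    have hmeas : ∀ p : Fin n × Fin n, Measurable fun ω =>
        ‖f (W p.1 ω, W p.2 ω) - g (W p.1 ω, W p.2 ω)‖ₑ := fun p =>
      ((hf.measurable.comp ((hW _).prodMk (hW _))).sub
        (hgm.measurable.comp ((hW _).prodMk (hW _)))).enorm
    rw [lintegral_const_mul _ (Finset.measurable_fun_sum _ fun p _ => hmeas p),
      lintegral_finsetSum _ fun p _ => hmeas p,
      Finset.sum_congr rfl (g := fun _ => ∫⁻ z, ‖(f - ⇑g) z‖ₑ ∂F.prod F) fun p hpS => ?_]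
    · rw [Finset.sum_const, card_indexPairs, nsmul_eq_mul, ← mul_assoc, enorm_inv hc.ne',
        Real.enorm_natCast, ENNReal.inv_mul_cancel, one_mul]
      · exact hg.le
      · exact_mod_cast hc.ne'
      · simp
    · rw [← (hp p hpS).lintegral_comp ((hf.measurable.sub hgm.measurable).enorm)]
      rfl
  have hDle : ∫⁻ ω, ‖D ω‖ₑ ∂μ ≤ ε / 3 := by
    have h1 := lintegral_enorm_sq_centered_sum_le hn (Y := fun i : Fin n => W i) hY
      (fun i => hlaw i) hindn hgm (subset_refl (indexPairs n))
    have h2 : ∀ ω, ‖(Real.sqrt n * (n.choose 2 : ℝ)⁻¹) • ∑ p ∈ indexPairs n,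
        (g (W p.1 ω, W p.2 ω) - ∫ z, g z ∂F.prod F)‖ₑ ^ 2 = n * ‖D ω‖ₑ ^ 2 := fun ω => by
      rw [mul_smul, enorm_sq_sqrt_mul]
    simp_rw [h2] at h1
    rw [lintegral_const_mul _ (hDm.enorm.pow_const 2), ← hCdef, mul_comm,
      ← ENNReal.le_div_iff_mul_le (Or.inl hn0) (Or.inl (by simp))] at h1
    refine le_trans ?_ hn1
    have h3 := (sq_lintegral_le hDm.enorm.aemeasurable).trans h1
    rw [div_eq_mul_inv] at h3
    have h4 := ENNReal.rpow_le_rpow h3 (z := (1 / 2 : ℝ)) (by norm_num)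
    rwa [← ENNReal.rpow_natCast, ← ENNReal.rpow_mul, show ((2 : ℕ) : ℝ) * (1 / 2) = 1 by norm_num,
      ENNReal.rpow_one] at h4
  have hEle : ‖∫ z, (g z - f z) ∂F.prod F‖ₑ ≤ ε / 3 := by
    refine (enorm_integral_le_lintegral_enorm _).trans (le_trans (le_of_eq ?_) hg.le)
    exact lintegral_congr fun z => by rw [Pi.sub_apply, ← enorm_neg, neg_sub]
  calc _ ≤ ∫⁻ ω, (‖A ω‖ₑ + ‖D ω‖ₑ + ‖∫ z, (g z - f z) ∂F.prod F‖ₑ) ∂μ := by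
        refine lintegral_mono fun ω => ?_
        simp only [hsplit ω]
        exact (enorm_add_le _ _).trans (add_le_add_left (enorm_add_le _ _) _)
    _ = ∫⁻ ω, ‖A ω‖ₑ ∂μ + ∫⁻ ω, ‖D ω‖ₑ ∂μ + ‖∫ z, (g z - f z) ∂F.prod F‖ₑ := by
        rw [lintegral_add_right _ measurable_const, lintegral_add_right _ hDm.enorm]
        simp
    _ ≤ ε / 3 + ε / 3 + ε / 3 := by gcongr
    _ = ε := ENNReal.add_thirds ε

/-- The weak law of large numbers for U-statistics of order two with an integrable kernel. -/
lemma tendsto_pairAverage [CompleteSpace H] [MeasurableSpace H] [BorelSpace H]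
    [SecondCountableTopology H] (hW : ∀ i, Measurable (W i)) (hlaw : ∀ i, μ.map (W i) = F)
    (hind : iIndepFun W μ) {f : Z × Z → H} (hf : StronglyMeasurable f)
    (hfi : Integrable f (F.prod F)) :
    Tendsto (fun q : ℕ × Ω => (q.1.choose 2 : ℝ)⁻¹ •
      ∑ p ∈ indexPairs q.1, f (W p.1 q.2, W p.2 q.2)) (probFilter μ) (𝓝 (∫ z, f z ∂F.prod F)) := by
  rw [← tendsto_sub_nhds_zero_iff, tendsto_zero_iff_enorm_tendsto_zero]
  refine tendsto_probFilter_of_lintegral (X := fun n ω => ‖(n.choose 2 : ℝ)⁻¹ •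
      ∑ p ∈ indexPairs n, f (W p.1 ω, W p.2 ω) - ∫ z, f z ∂F.prod F‖ₑ) (fun n => ?_)
    (tendsto_lintegral_pairAverage hW hlaw hind hf hfi)
  refine Measurable.aemeasurable (Measurable.enorm (Measurable.sub_const
    (Measurable.const_smul (Finset.measurable_fun_sum _ fun p _ => ?_) _) _))
  exact hf.measurable.comp ((hW _).prodMk (hW _))

end UStatistics

/-! ### The Hoeffding projection -/

section Projection

variable {Ω Z H : Type*} [MeasurableSpace Ω] [MeasurableSpace Z] {μ : Measure Ω}
  [IsProbabilityMeasure μ] {F : Measure Z} [IsProbabilityMeasure F]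
  [NormedAddCommGroup H] [InnerProductSpace ℝ H]

/-- The first projection `w ↦ E[f(w, W')]` of a kernel. -/
noncomputable def kernelProj (F : Measure Z) (f : Z × Z → H) (w : Z) : H := ∫ w', f (w, w') ∂F

lemma stronglyMeasurable_kernelProj {f : Z × Z → H} (hf : StronglyMeasurable f) :
    StronglyMeasurable (kernelProj F f) :=
  StronglyMeasurable.integral_prod_right (f := fun w w' => f (w, w')) hf

lemma integral_kernelProj {f : Z × Z → H} (hf : Integrable f (F.prod F)) :
    ∫ w, kernelProj F f w ∂F = ∫ z, f z ∂F.prod F := (integral_prod _ hf).symm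

lemma memLp_kernelProj {f : Z × Z → H} (hf : StronglyMeasurable f) (hf2 : MemLp f 2 (F.prod F)) :
    MemLp (kernelProj F f) 2 F := by
  refine memLp_two_of_lintegral (stronglyMeasurable_kernelProj hf).aestronglyMeasurable ?_
  have hm : Measurable fun z : Z × Z => ‖f z‖ₑ ^ 2 := hf.enorm.pow_const 2
  calc ∫⁻ w, ‖kernelProj F f w‖ₑ ^ 2 ∂F ≤ ∫⁻ w, ∫⁻ w', ‖f (w, w')‖ₑ ^ 2 ∂F ∂F := by
        refine lintegral_mono fun w => ?_
        refine (pow_le_pow_left' (enorm_integral_le_lintegral_enorm _) 2).trans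
          (sq_lintegral_le ?_)
        exact (hf.enorm.comp measurable_prodMk_left).aemeasurable
    _ = ∫⁻ z, ‖f z‖ₑ ^ 2 ∂F.prod F := (lintegral_prod _ hm.aemeasurable).symm
    _ < ∞ := by rw [lintegral_enorm_sq_eq hf2]; exact ENNReal.ofReal_lt_top

variable [CompleteSpace H]

/-- Subtracting the projection leaves a kernel with conditional mean zero given the first
observation. -/
lemma ae_integral_sub_kernelProj {f : Z × Z → H} (hf : Integrable f (F.prod F)) :
    ∀ᵐ w ∂F, ∫ w', (f (w, w') - kernelProj F f w) ∂F = 0 := by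
  filter_upwards [hf.prod_right_ae] with w hw
  rw [integral_sub hw (integrable_const _)]
  simp [kernelProj]

lemma sum_indexPairs_add {E : Type*} [AddCommGroup E] [Module ℝ E] (n : ℕ) (a : Fin n → E) :
    ∑ p ∈ indexPairs n, (a p.1 + a p.2) = ((n : ℝ) - 1) • ∑ i, a i := by
  have h1 : ∑ p ∈ indexPairs n, a p.1 = ∑ i : Fin n, (n - 1 - (i : ℕ)) • a i := by
    rw [indexPairs, Finset.sum_filter, Fintype.sum_prod_type]
    refine Finset.sum_congr rfl fun i _ => ?_
    simp only
    rw [← Finset.sum_filter, Finset.sum_const]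
    simp [Finset.filter_lt_eq_Ioi]
  have h2 : ∑ p ∈ indexPairs n, a p.2 = ∑ i : Fin n, (i : ℕ) • a i := by
    rw [indexPairs, Finset.sum_filter, Fintype.sum_prod_type_right]
    refine Finset.sum_congr rfl fun i _ => ?_
    simp only
    rw [← Finset.sum_filter, Finset.sum_const]
    simp [Finset.filter_gt_eq_Iio]
  rw [Finset.sum_add_distrib, h1, h2, ← Finset.sum_add_distrib, Finset.smul_sum]
  refine Finset.sum_congr rfl fun i _ => ?_
  have hi : n - 1 - (i : ℕ) + i = n - 1 := by omega
  rw [← add_smul, hi, ← Nat.cast_smul_eq_nsmul ℝ, Nat.cast_sub i.pos, Nat.cast_one]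

variable {W : ℕ → Ω → Z}

/-- A centered U-statistic of order two is asymptotically equivalent to the sum of its
projections: the difference is a degenerate U-statistic. -/
lemma tendsto_pairAverage_sub_projection [MeasurableSpace H] [BorelSpace H]
    [SecondCountableTopology H] (hW : ∀ i, Measurable (W i)) (hlaw : ∀ i, μ.map (W i) = F)
    (hind : iIndepFun W μ) {f : Z × Z → H} (hf : StronglyMeasurable f)
    (hf2 : MemLp f 2 (F.prod F)) (hf0 : ∫ z, f z ∂F.prod F = 0)
    (hsymm : ∀ w w', f (w, w') = f (w', w)) :
    Tendsto (fun q : ℕ × Ω => (Real.sqrt q.1 * (q.1.choose 2 : ℝ)⁻¹) •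
        ∑ p ∈ indexPairs q.1, f (W p.1 q.2, W p.2 q.2)
      - (Real.sqrt q.1)⁻¹ • ∑ i : Fin q.1, (2 : ℝ) • kernelProj F f (W i q.2))
      (probFilter μ) (𝓝 0) := by
  have hfi : Integrable f (F.prod F) := hf2.integrable one_le_two
  have hpm := stronglyMeasurable_kernelProj (F := F) hf
  have hp2 := memLp_kernelProj hf hf2
  set h : Z × Z → H := fun z => f z - kernelProj F f z.1 - kernelProj F f z.2 with hh
  have hm : StronglyMeasurable h :=
    (hf.sub (hpm.comp_measurable measurable_fst)).sub (hpm.comp_measurable measurable_snd)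
  have h2 : MemLp h 2 (F.prod F) :=
    (hf2.sub (hp2.comp_measurePreserving measurePreserving_fst)).sub
      (hp2.comp_measurePreserving measurePreserving_snd)
  have h0 : ∀ᵐ w ∂F, ∫ w', h (w, w') ∂F = 0 := by
    filter_upwards [ae_integral_sub_kernelProj hfi, hfi.prod_right_ae] with w hw hwi
    simp only [hh]
    rw [integral_sub (f := fun w' => f (w, w') - kernelProj F f w)
      (hwi.sub (integrable_const _)) (hp2.integrable one_le_two)]
    rw [hw, integral_kernelProj hfi, hf0, sub_zero]
  have hs : ∀ w w', h (w, w') = h (w', w) := fun w w' => by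
    simp only [hh, hsymm w w']; abel
  set D : ℕ → Ω → H := fun n ω => (Real.sqrt n * (n.choose 2 : ℝ)⁻¹) •
    ∑ p ∈ indexPairs n, h (W p.1 ω, W p.2 ω) with hD
  have hDm : ∀ n, StronglyMeasurable (D n) := fun n =>
    (Finset.stronglyMeasurable_fun_sum _ fun p _ =>
      hm.comp_measurable ((hW _).prodMk (hW _))).const_smul _
  have hDt : Tendsto (fun q : ℕ × Ω => ‖D q.1 q.2‖ₑ ^ 2) (probFilter μ) (𝓝 0) := by
    refine tendsto_probFilter_of_lintegral (X := fun n ω => ‖D n ω‖ₑ ^ 2)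
      (fun n => ((hDm n).enorm.pow_const 2).aemeasurable) ?_
    set I := ∫ z, ‖h z‖ ^ 2 ∂F.prod F with hI
    have hlim : Tendsto (fun n : ℕ => ENNReal.ofReal (4 * I * (n : ℝ)⁻¹)) atTop (𝓝 0) := by
      have := (tendsto_inv_atTop_nhds_zero_nat (𝕜 := ℝ)).const_mul (4 * I)
      rw [mul_zero] at this
      simpa using ENNReal.tendsto_ofReal this
    refine tendsto_of_tendsto_of_tendsto_of_le_of_le' tendsto_const_nhds hlim
      (Eventually.of_forall fun _ => zero_le) ?_
    filter_upwards [eventually_ge_atTop 2] with n hn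
    have hY : ∀ i : Fin n, Measurable (W i) := fun i => hW i
    have hindn : iIndepFun (fun i : Fin n => W i) μ := hind.precomp Fin.val_injective
    have hp : ∀ p ∈ indexPairs n,
        MeasurePreserving (fun ω => (W p.1 ω, W p.2 ω)) μ (F.prod F) := fun p hp =>
      measurePreserving_pair (Y := fun i : Fin n => W i) hY (fun i => hlaw i) hindn
        (mem_indexPairs.1 hp).ne
    have hX : MemLp (D n) 2 μ :=
      (memLp_finsetSum _ fun p hpS => h2.comp_measurePreserving (hp p hpS)).const_smul _
    rw [lintegral_enorm_sq_eq hX]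
    refine ENNReal.ofReal_le_ofReal ?_
    have h1 := integral_norm_sq_sum_degenerate_le (Y := fun i : Fin n => W i) hY
      (fun i => hlaw i) hindn hm h2 h0 hs
    have hc := choose_two_pos hn
    have hc4 := sq_div_four_le_choose_two hn
    have hn' : (0 : ℝ) < n := by positivity
    simp only [hD, norm_smul, mul_pow]
    rw [integral_const_mul]
    have h4 : ‖Real.sqrt n‖ ^ 2 * ‖(n.choose 2 : ℝ)⁻¹‖ ^ 2 = n / (n.choose 2 : ℝ) ^ 2 := by
      rw [Real.norm_eq_abs, sq_abs, Real.sq_sqrt hn'.le, Real.norm_eq_abs, sq_abs, inv_pow,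
        div_eq_mul_inv]
    have hI0 : 0 ≤ I := integral_nonneg fun _ => by positivity
    rw [norm_mul, mul_pow, h4]
    calc _ ≤ (n : ℝ) / (n.choose 2 : ℝ) ^ 2 * ((n.choose 2 : ℝ) * I) :=
          mul_le_mul_of_nonneg_left h1 (by positivity)
      _ = n / (n.choose 2 : ℝ) * I := by field_simp
      _ ≤ 4 * (n : ℝ)⁻¹ * I := by
          refine mul_le_mul_of_nonneg_right ?_ hI0
          rw [div_le_iff₀ hc]
          calc (n : ℝ) = 4 * (n : ℝ)⁻¹ * ((n : ℝ) ^ 2 / 4) := by field_simp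
            _ ≤ _ := by gcongr
      _ = _ := by ring
  refine (tendsto_zero_of_enorm_sq (X := fun q : ℕ × Ω => D q.1 q.2) hDt).congr' ?_
  filter_upwards [tendsto_fst_probFilter.eventually (eventually_ge_atTop 2)] with q hn
  obtain ⟨n, ω⟩ := q
  simp only at hn ⊢
  have hc := choose_two_pos hn
  have hn' : (0 : ℝ) < n := by positivity
  have hsum : ∑ p ∈ indexPairs n, h (W p.1 ω, W p.2 ω)
      = ∑ p ∈ indexPairs n, f (W p.1 ω, W p.2 ω)
        - ((n : ℝ) - 1) • ∑ i : Fin n, kernelProj F f (W i ω) := by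
    rw [← sum_indexPairs_add n fun i => kernelProj F f (W i ω), ← Finset.sum_sub_distrib]
    refine Finset.sum_congr rfl fun p _ => ?_
    simp only [hh]; abel
  have hcoef : Real.sqrt n * (n.choose 2 : ℝ)⁻¹ * ((n : ℝ) - 1) = (Real.sqrt n)⁻¹ * 2 := by
    have hs : 0 < Real.sqrt n := Real.sqrt_pos.2 hn'
    have h2 : (2 : ℝ) ≤ n := by exact_mod_cast hn
    have h3 : (n : ℝ) - 1 ≠ 0 := by linarith
    rw [Nat.cast_choose_two]
    field_simp
    rw [Real.sq_sqrt hn'.le]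
  rw [hD]
  simp only
  rw [hsum, smul_sub, smul_smul, hcoef, ← Finset.smul_sum, smul_smul]

/-- Leave-one-out averages of a kernel are close to its projections, on average over the left-out
observation. -/
lemma tendsto_leaveOneOut_sub_projection [MeasurableSpace H] [BorelSpace H]
    [SecondCountableTopology H] (hW : ∀ i, Measurable (W i)) (hlaw : ∀ i, μ.map (W i) = F)
    (hind : iIndepFun W μ) {f : Z × Z → H} (hf : StronglyMeasurable f)
    (hf2 : MemLp f 2 (F.prod F)) :
    Tendsto (fun q : ℕ × Ω => (q.1 : ℝ)⁻¹ * ∑ i : Fin q.1,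
        ‖((q.1 : ℝ) - 1)⁻¹ • ∑ j ∈ Finset.univ.erase i, f (W i q.2, W j q.2)
          - kernelProj F f (W i q.2)‖ ^ 2) (probFilter μ) (𝓝 0) := by
  have hfi : Integrable f (F.prod F) := hf2.integrable one_le_two
  have hpm := stronglyMeasurable_kernelProj (F := F) hf
  have hp2 := memLp_kernelProj hf hf2
  set h : Z × Z → H := fun z => f z - kernelProj F f z.1 with hh
  have hm : StronglyMeasurable h := hf.sub (hpm.comp_measurable measurable_fst)
  have h2 : MemLp h 2 (F.prod F) :=
    hf2.sub (hp2.comp_measurePreserving measurePreserving_fst)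
  have h0 : ∀ᵐ w ∂F, ∫ w', h (w, w') ∂F = 0 := ae_integral_sub_kernelProj hfi
  set I := ∫ z, ‖h z‖ ^ 2 ∂F.prod F with hI
  set X : ℕ → Ω → ℝ := fun n ω => (n : ℝ)⁻¹ * ∑ i : Fin n,
        ‖((n : ℝ) - 1)⁻¹ • ∑ j ∈ Finset.univ.erase i, h (W i ω, W j ω)‖ ^ 2 with hX
  have hXt : Tendsto (fun q : ℕ × Ω => X q.1 q.2) (probFilter μ) (𝓝 0) := by
    rw [tendsto_zero_iff_enorm_tendsto_zero]
    refine tendsto_probFilter_of_lintegral (X := fun n ω => ‖X n ω‖ₑ) (fun n => ?_) ?_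
    · refine Measurable.aemeasurable (Measurable.enorm (Measurable.const_mul
        (Finset.measurable_fun_sum _ fun i _ => ?_) _))
      refine Measurable.pow_const (Measurable.norm (Measurable.const_smul
        (Finset.measurable_fun_sum _ fun j _ => ?_) _)) 2
      exact hm.measurable.comp ((hW _).prodMk (hW _))
    have hlim : Tendsto (fun n : ℕ => ENNReal.ofReal (((n : ℝ) - 1)⁻¹ * I)) atTop (𝓝 0) := by
      have h1 : Tendsto (fun n : ℕ => ((n : ℝ) - 1)⁻¹) atTop (𝓝 0) :=
        tendsto_inv_atTop_zero.comp
          (tendsto_atTop_add_const_right _ _ tendsto_natCast_atTop_atTop)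
      have := h1.mul_const I
      rw [zero_mul] at this
      simpa using ENNReal.tendsto_ofReal this
    refine tendsto_of_tendsto_of_tendsto_of_le_of_le' tendsto_const_nhds hlim
      (Eventually.of_forall fun _ => zero_le) ?_
    filter_upwards [eventually_ge_atTop 2] with n hn
    have hY : ∀ i : Fin n, Measurable (W i) := fun i => hW i
    have hindn : iIndepFun (fun i : Fin n => W i) μ := hind.precomp Fin.val_injective
    have hn2 : (2 : ℝ) ≤ n := by exact_mod_cast hn
    have hn1 : (0 : ℝ) < n - 1 := by linarith
    have hL : ∀ i : Fin n, MemLp (fun ω => ((n : ℝ) - 1)⁻¹ •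
        ∑ j ∈ Finset.univ.erase i, h (W i ω, W j ω)) 2 μ := fun i =>
      (memLp_finsetSum _ fun j hj => h2.comp_measurePreserving
        (measurePreserving_pair (Y := fun i : Fin n => W i) hY (fun i => hlaw i) hindn
          (Finset.ne_of_mem_erase hj).symm)).const_smul _
    have hXi : Integrable (X n) μ :=
      (integrable_finsetSum _ fun i _ => integrable_norm_sq_of_memLp (hL i)).const_mul _
    have hX0 : ∀ ω, 0 ≤ X n ω := fun ω => by simp only [hX]; positivity
    simp_rw [Real.enorm_of_nonneg (hX0 _)]
    rw [← ofReal_integral_eq_lintegral_ofReal hXi (ae_of_all _ hX0)]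
    refine ENNReal.ofReal_le_ofReal ?_
    simp only [hX]
    rw [integral_const_mul, integral_finsetSum _ fun i _ => integrable_norm_sq_of_memLp (hL i)]
    have hb : ∀ i ∈ (Finset.univ : Finset (Fin n)), ∫ ω, ‖((n : ℝ) - 1)⁻¹ •
        ∑ j ∈ Finset.univ.erase i, h (W i ω, W j ω)‖ ^ 2 ∂μ ≤ ((n : ℝ) - 1)⁻¹ * I := by
      intro i _
      have h1 := integral_norm_sq_sum_erase_le (Y := fun i : Fin n => W i) hY
        (fun i => hlaw i) hindn hm h2 h0 i
      simp_rw [norm_smul, mul_pow]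
      rw [integral_const_mul, Real.norm_of_nonneg (by positivity)]
      calc _ ≤ (((n : ℝ) - 1)⁻¹) ^ 2 * ((n - 1) * I) :=
            mul_le_mul_of_nonneg_left h1 (by positivity)
        _ = _ := by field_simp
    have h3 := Finset.sum_le_card_nsmul _ _ _ hb
    rw [Finset.card_univ, Fintype.card_fin, nsmul_eq_mul] at h3
    calc _ ≤ (n : ℝ)⁻¹ * (n * (((n : ℝ) - 1)⁻¹ * I)) :=
          mul_le_mul_of_nonneg_left h3 (by positivity)
      _ = _ := by field_simp
  refine hXt.congr' ?_
  filter_upwards [tendsto_fst_probFilter.eventually (eventually_ge_atTop 2)] with q hn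
  obtain ⟨n, ω⟩ := q
  simp only at hn ⊢
  have hn2 : (2 : ℝ) ≤ n := by exact_mod_cast hn
  have hn1 : (n : ℝ) - 1 ≠ 0 := by linarith
  simp only [hX]
  congr 1
  refine Finset.sum_congr rfl fun i _ => ?_
  simp only [hh]
  rw [Finset.sum_sub_distrib, Finset.sum_const, Finset.card_erase_of_mem (Finset.mem_univ i),
    Finset.card_univ, Fintype.card_fin, smul_sub, ← Nat.cast_smul_eq_nsmul ℝ,
    Nat.cast_sub (by omega), Nat.cast_one, smul_smul, inv_mul_cancel₀ hn1, one_smul]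

end Projection

/-! ### Cross-fitting: conditioning on the observations outside a block -/

section CrossFit

variable {Ω Z : Type*} [MeasurableSpace Ω] [MeasurableSpace Z] {P : Measure Ω} {F : Measure Z}
  {W : ℕ → Ω → Z}

lemma measurePreserving_sample [IsProbabilityMeasure P] (hW : ∀ i, Measurable (W i))
    (hlaw : ∀ i, P.map (W i) = F) (hind : iIndepFun W P) (n : ℕ) :
    MeasurePreserving (fun ω (i : Fin n) => W i ω) P (Measure.pi fun _ => F) := by
  refine ⟨measurable_pi_lambda _ fun i => hW i, ?_⟩
  have h := (iIndepFun_iff_map_fun_eq_pi_map (f := fun i : Fin n => W i)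
    fun i => (hW i).aemeasurable).1 (hind.precomp Fin.val_injective)
  rw [h]
  simp_rw [hlaw]

open Classical in
/-- Replacing the coordinates outside `O` by those of an independent copy does not change the law
of an i.i.d. sample. -/
lemma measurePreserving_piecewise [IsProbabilityMeasure F] {n : ℕ} (O : Set (Fin n)) :
    MeasurePreserving (fun (q : (Fin n → Z) × (Fin n → Z)) i => if i ∈ O then q.1 i else q.2 i)
      ((Measure.pi fun _ => F).prod (Measure.pi fun _ => F)) (Measure.pi fun _ => F) := by
  have hm : Measurable fun (q : (Fin n → Z) × (Fin n → Z)) (i : Fin n) =>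
      if i ∈ O then q.1 i else q.2 i := by
    refine measurable_pi_lambda _ fun i => ?_
    by_cases h : i ∈ O
    · simp only [h, if_true]; fun_prop
    · simp only [h, if_false]; fun_prop
  refine ⟨hm, (Measure.pi_eq fun s hs => ?_).symm⟩
  rw [Measure.map_apply hm (MeasurableSet.univ_pi hs)]
  have hpre : (fun (q : (Fin n → Z) × (Fin n → Z)) (i : Fin n) =>
      if i ∈ O then q.1 i else q.2 i) ⁻¹' Set.univ.pi s
      = (Set.univ.pi fun i => if i ∈ O then s i else Set.univ) ×ˢ
        (Set.univ.pi fun i => if i ∈ O then Set.univ else s i) := by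
    ext q
    simp only [Set.mem_preimage, Set.mem_pi, Set.mem_univ, true_imp_iff, Set.mem_prod,
      ← forall_and]
    refine forall_congr' fun i => ?_
    by_cases h : i ∈ O <;> simp [h]
  rw [hpre, Measure.prod_prod, Measure.pi_pi, Measure.pi_pi, ← Finset.prod_mul_distrib]
  refine Finset.prod_congr rfl fun i _ => ?_
  by_cases h : i ∈ O <;> simp [h]

/-- If `Φ x y` depends on `x` through the coordinates in `O` and on `y` through the others, then
the two arguments may be decoupled. -/
lemma lintegral_diag_eq [IsProbabilityMeasure F] {n : ℕ} {O : Set (Fin n)}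
    {Φ : (Fin n → Z) → (Fin n → Z) → ℝ≥0∞} (hΦ : Measurable (Function.uncurry Φ))
    (h1 : DependsOn Φ O) (h2 : ∀ x, DependsOn (Φ x) Oᶜ) :
    ∫⁻ x, Φ x x ∂(Measure.pi fun _ => F)
      = ∫⁻ x, ∫⁻ y, Φ x y ∂(Measure.pi fun _ => F) ∂(Measure.pi fun _ => F) := by
  classical
  have hc := measurePreserving_piecewise (F := F) O
  have hd : Measurable fun x => Φ x x := hΦ.comp (measurable_id.prodMk measurable_id)
  have hprod := lintegral_prod (μ := Measure.pi fun _ : Fin n => F)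
    (ν := Measure.pi fun _ : Fin n => F) (Function.uncurry Φ) hΦ.aemeasurable
  simp only [Function.uncurry_apply_pair] at hprod
  rw [← hc.lintegral_comp hd, ← hprod]
  refine lintegral_congr fun q => ?_
  have e1 : Φ (fun i => if i ∈ O then q.1 i else q.2 i) = Φ q.1 :=
    h1 fun i hi => by simp [hi]
  rw [e1]
  exact h2 q.1 fun i hi => by
    have : i ∉ O := hi
    simp [this]

/-- Conditional Markov inequality for a cross-fitted statistic, whose conditional mean given the
coordinates in `O` is an integral over an independent sample. -/
lemma meas_ge_crossfit_le [IsProbabilityMeasure F] {n : ℕ} {O : Set (Fin n)}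
    {s : Ω → Fin n → Z} (hs : MeasurePreserving s P (Measure.pi fun _ => F))
    {Φ : (Fin n → Z) → (Fin n → Z) → ℝ≥0∞} (hΦ : Measurable (Function.uncurry Φ))
    (h1 : DependsOn Φ O) (h2 : ∀ x, DependsOn (Φ x) Oᶜ) (δ : ℝ≥0∞) {ε : ℝ≥0∞} (hε : ε ≠ 0)
    (hε' : ε ≠ ∞) :
    P {ω | ε ≤ Φ (s ω) (s ω)}
      ≤ P {ω | δ < ∫⁻ y, Φ (s ω) y ∂(Measure.pi fun _ => F)} + δ / ε := by
  set I : (Fin n → Z) → ℝ≥0∞ := fun x => ∫⁻ y, Φ x y ∂(Measure.pi fun _ => F) with hI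
  have hIm : Measurable I := hΦ.lintegral_prod_right'
  have hG : MeasurableSet {x | I x ≤ δ} := measurableSet_le hIm measurable_const
  -- truncation to the event that the conditional mean is at most `δ`, which depends on `O` only
  set Φ' : (Fin n → Z) → (Fin n → Z) → ℝ≥0∞ := fun x y =>
    {x | I x ≤ δ}.indicator (fun x => Φ x y) x with hΦ'
  have hΦm : Measurable (Function.uncurry Φ') := by
    have : Function.uncurry Φ' =
        (Prod.fst ⁻¹' {x | I x ≤ δ}).indicator (Function.uncurry Φ) := by
      ext ⟨x, y⟩
      simp [hΦ', Function.uncurry, Set.indicator]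
    rw [this]
    exact hΦ.indicator (measurable_fst hG)
  have hI1 : DependsOn I O := fun x x' hx => by simp only [hI, h1 hx]
  have h1' : DependsOn Φ' O := fun x x' hx => by
    ext y
    simp only [hΦ', Set.indicator, Set.mem_ofPred_eq, hI1 hx, h1 hx]
  have h2' : ∀ x, DependsOn (Φ' x) Oᶜ := fun x y y' hy => by
    simp only [hΦ', Set.indicator, h2 x hy]
  have hint : ∫⁻ ω, Φ' (s ω) (s ω) ∂P ≤ δ := by
    have hd : Measurable fun x => Φ' x x := hΦm.comp (measurable_id.prodMk measurable_id)
    rw [hs.lintegral_comp hd, lintegral_diag_eq hΦm h1' h2']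
    calc _ ≤ ∫⁻ _, δ ∂(Measure.pi fun _ : Fin n => F) := by
          refine lintegral_mono fun x => ?_
          by_cases hx : I x ≤ δ
          · simp only [hΦ', Set.indicator, Set.mem_ofPred_eq, hx, if_true]
            exact hx
          · simp [hΦ', Set.indicator, hx]
      _ = δ := by simp
  have hm : AEMeasurable (fun ω => Φ' (s ω) (s ω)) P :=
    (hΦm.comp (hs.measurable.prodMk hs.measurable)).aemeasurable
  refine (measure_mono (t := {ω | δ < I (s ω)} ∪ {ω | ε ≤ Φ' (s ω) (s ω)}) fun ω hω => ?_).trans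
    ((measure_union_le _ _).trans (add_le_add le_rfl
      ((meas_ge_le_lintegral_div hm hε hε').trans (ENNReal.div_le_div_right hint _))))
  by_cases hx : I (s ω) ≤ δ
  · right
    have : Φ' (s ω) (s ω) = Φ (s ω) (s ω) := by simp [hΦ', Set.indicator, hx]
    rw [Set.mem_ofPred_eq, this]
    exact hω
  · exact Or.inl (not_le.1 hx)

/-- A cross-fitted statistic is `o_p(1)` if its conditional mean is. -/
lemma tendsto_crossfit [IsProbabilityMeasure F] {O : ∀ n, Set (Fin n)}
    {s : ∀ n, Ω → Fin n → Z} (hs : ∀ n, MeasurePreserving (s n) P (Measure.pi fun _ => F))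
    {Φ : ∀ n, (Fin n → Z) → (Fin n → Z) → ℝ≥0∞} (hΦ : ∀ n, Measurable (Function.uncurry (Φ n)))
    (h1 : ∀ n, DependsOn (Φ n) (O n)) (h2 : ∀ n x, DependsOn (Φ n x) (O n)ᶜ)
    (h : Tendsto (fun q : ℕ × Ω => ∫⁻ y, Φ q.1 (s q.1 q.2) y ∂(Measure.pi fun _ => F))
      (probFilter P) (𝓝 0)) :
    Tendsto (fun q : ℕ × Ω => Φ q.1 (s q.1 q.2) (s q.1 q.2)) (probFilter P) (𝓝 0) := by
  have key : ∀ ε : ℝ≥0∞, 0 < ε → ε ≠ ∞ →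
      Tendsto (fun n => P {ω | ε ≤ Φ n (s n ω) (s n ω)}) atTop (𝓝 0) := by
    intro ε hε hε'
    rw [ENNReal.tendsto_nhds_zero]
    intro η hη
    rcases eq_or_ne η ∞ with rfl | hη'
    · simp
    have hη2 := ENNReal.half_pos hη.ne'
    have hδ : 0 < η / 2 * ε := ENNReal.mul_pos hη2.ne' hε.ne'
    have h3 := ENNReal.tendsto_nhds_zero.1 h _ hδ
    rw [eventually_probFilter, ENNReal.tendsto_nhds_zero] at h3
    filter_upwards [h3 _ hη2] with n hn
    refine (meas_ge_crossfit_le (hs n) (hΦ n) (h1 n) (h2 n) (η / 2 * ε) hε.ne' hε').trans ?_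
    rw [ENNReal.mul_div_cancel_right hε.ne' hε']
    simp only [not_le] at hn
    exact (add_le_add hn le_rfl).trans (ENNReal.add_halves η).le
  refine ToZeroInProb.tendsto (X := fun n ω => Φ n (s n ω) (s n ω)) fun ε hε => ?_
  rcases eq_or_ne ε ∞ with rfl | hε'
  · refine tendsto_of_tendsto_of_tendsto_of_le_of_le tendsto_const_nhds
      (key 1 one_pos ENNReal.one_ne_top) (fun _ => zero_le) fun n => measure_mono fun ω hω => ?_
    exact le_trans (le_top (a := (1 : ℝ≥0∞))) hω
  · exact key ε hε hε'

/-- A cross-fitted statistic is `O_p(1)` if its conditional mean is bounded. -/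
lemma bddInProb_crossfit [IsProbabilityMeasure F] {O : ∀ n, Set (Fin n)}
    {s : ∀ n, Ω → Fin n → Z} (hs : ∀ n, MeasurePreserving (s n) P (Measure.pi fun _ => F))
    {Φ : ∀ n, (Fin n → Z) → (Fin n → Z) → ℝ≥0∞} (hΦ : ∀ n, Measurable (Function.uncurry (Φ n)))
    (h1 : ∀ n, DependsOn (Φ n) (O n)) (h2 : ∀ n x, DependsOn (Φ n x) (O n)ᶜ) {C : ℝ≥0∞}
    (hC : C ≠ ∞) (h : ∀ᶠ q in probFilter P,
      ∫⁻ y, Φ q.1 (s q.1 q.2) y ∂(Measure.pi fun _ => F) ≤ C) :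
    BddInProb P fun q => Φ q.1 (s q.1 q.2) (s q.1 q.2) := by
  intro η hη
  rcases eq_or_ne η ∞ with rfl | hη'
  · exact ⟨0, by simp, by simp⟩
  have hη2 := ENNReal.half_pos hη.ne'
  have hη2' : η / 2 ≠ ∞ := ENNReal.div_ne_top hη' (by simp)
  have hM : (C + 1) / (η / 2) ≠ ∞ := ENNReal.div_ne_top (by simp [hC]) hη2.ne'
  have hM0 : (C + 1) / (η / 2) ≠ 0 := (ENNReal.div_pos (by simp) hη2').ne'
  refine ⟨(C + 1) / (η / 2), hM, ?_⟩
  rw [eventually_probFilter, ENNReal.tendsto_nhds_zero] at h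
  filter_upwards [h _ hη2] with n hn
  simp only [not_le] at hn
  refine (measure_mono (t := {ω | (C + 1) / (η / 2) ≤ Φ n (s n ω) (s n ω)})
    fun ω hω => le_of_lt (Set.mem_ofPred_eq ▸ hω)).trans
    ((meas_ge_crossfit_le (hs n) (hΦ n) (h1 n) (h2 n) C hM0 hM).trans ?_)
  refine (add_le_add hn (ENNReal.div_le_of_le_mul ?_)).trans (ENNReal.add_halves η).le
  rw [ENNReal.mul_div_cancel hη2.ne' hη2']
  exact le_self_add

end CrossFit

/-! ### The multivariate central limit theorem -/

section CLT

open scoped RealInnerProductSpace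

variable {Ω : Type*} [MeasurableSpace Ω] {P : Measure Ω} {k : ℕ}

lemma integral_inner_sq_eq {X : Ω → Vec k} (hX : MemLp X 2 P) {S : Matrix (Fin k) (Fin k) ℝ}
    (hS : ∀ a b, S a b = ∫ ω, X ω a * X ω b ∂P) (t : Vec k) :
    ∫ ω, ⟪X ω, t⟫ ^ 2 ∂P = t ⬝ᵥ S.mulVec t := by
  have hc : ∀ a, MemLp (fun ω => X ω a) 2 P := fun a =>
    (EuclideanSpace.proj (𝕜 := ℝ) a).comp_memLp' hX
  have hint : ∀ a b, Integrable (fun ω => X ω a * X ω b) P := fun a b =>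
    (hc a).integrable_mul (hc b)
  have h1 : ∀ ω, ⟪X ω, t⟫ ^ 2 = ∑ a, ∑ b, t a * t b * (X ω a * X ω b) := by
    intro ω
    rw [PiLp.inner_apply, sq, Finset.sum_mul_sum]
    refine Finset.sum_congr rfl fun a _ => Finset.sum_congr rfl fun b _ => ?_
    simp
    ring
  simp_rw [h1]
  rw [integral_finsetSum _ fun a _ => integrable_finsetSum _ fun b _ => (hint a b).const_mul _]
  simp only [dotProduct, Matrix.mulVec, Finset.mul_sum]
  refine Finset.sum_congr rfl fun a _ => ?_
  rw [integral_finsetSum _ fun b _ => (hint a b).const_mul _]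
  refine Finset.sum_congr rfl fun b _ => ?_
  rw [integral_const_mul, hS]
  ring

lemma posSemidef_of_second_moments {X : Ω → Vec k} (hX : MemLp X 2 P)
    {S : Matrix (Fin k) (Fin k) ℝ} (hS : ∀ a b, S a b = ∫ ω, X ω a * X ω b ∂P) :
    S.PosSemidef := by
  refine Matrix.PosSemidef.of_dotProduct_mulVec_nonneg ?_ fun t => ?_
  · ext a b
    simp [hS, mul_comm]
  · have := integral_inner_sq_eq hX hS (WithLp.toLp 2 t)
    simp only [star_trivial]
    rw [← this]
    exact integral_nonneg fun _ => by positivity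

variable [IsProbabilityMeasure P]

/-- The central limit theorem for i.i.d. centered square integrable vectors, by the Cramér–Wold
device on characteristic functions. -/
lemma tendstoInDistribution_inv_sqrt_smul_sum {X : ℕ → Ω → Vec k} (hXm : ∀ i, Measurable (X i))
    (hind : iIndepFun X P) (hident : ∀ i, IdentDistrib (X i) (X 0) P P) (hX : MemLp (X 0) 2 P)
    (h0 : ∫ ω, X 0 ω ∂P = 0) {S : Matrix (Fin k) (Fin k) ℝ}
    (hS : ∀ a b, S a b = ∫ ω, X 0 ω a * X 0 ω b ∂P) :
    TendstoInDistribution (fun (n : ℕ) ω => (Real.sqrt n)⁻¹ • ∑ i ∈ Finset.range n, X i ω) atTop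
      (id : Vec k → Vec k) (fun _ => P) (multivariateGaussian 0 S) where
  forall_aemeasurable n := by fun_prop
  tendsto := by
    refine ProbabilityMeasure.tendsto_iff_tendsto_charFun.2 fun t => ?_
    have hm : Measurable fun x : Vec k => ⟪x, t⟫ := by fun_prop
    have hY2 : MemLp (fun ω => ⟪X 0 ω, t⟫) 2 P := hX.inner_const t
    have hY0 : ∫ ω, ⟪X 0 ω, t⟫ ∂P = 0 := by
      simp_rw [real_inner_comm t]
      rw [integral_inner (hX.integrable one_le_two), h0, inner_zero_right]
    have hvar : Var[fun ω => ⟪X 0 ω, t⟫; P] = t ⬝ᵥ S.mulVec t := by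
      rw [variance_of_integral_eq_zero (X := fun ω => ⟪X 0 ω, t⟫)
          (hm.comp (hXm 0)).aemeasurable hY0,
        ← integral_inner_sq_eq hX hS]
    have hclt := tendstoInDistribution_inv_sqrt_mul_sum_sub (P := P)
      (X := fun i ω => ⟪X i ω, t⟫) (Y := id)
      (P' := gaussianReal 0 (Var[fun ω => ⟪X 0 ω, t⟫; P]).toNNReal)
      HasLaw.id hY2 (hind.comp (fun _ x => ⟪x, t⟫) fun _ => hm)
      (fun i => (hident i).comp hm)
    have h1 := ProbabilityMeasure.tendsto_iff_tendsto_charFun.1 hclt.tendsto 1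
    simp only [ProbabilityMeasure.coe_mk, Measure.map_id, hvar, hY0] at h1 ⊢
    rw [charFun_multivariateGaussian (posSemidef_of_second_moments hX hS)]
    have hnn : 0 ≤ t ⬝ᵥ S.mulVec t := by
      rw [← hvar]; exact variance_nonneg _ _
    rw [charFun_gaussianReal] at h1
    refine (h1.congr fun n => ?_).trans (le_of_eq ?_)
    · rw [charFun_apply, charFun_apply, integral_map, integral_map]
      · refine integral_congr_ae (ae_of_all _ fun ω => ?_)
        simp [inner_smul_left, sum_inner]
      · fun_prop
      · fun_prop
      · fun_prop
      · fun_prop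
    · congr 2
      simp [Real.coe_toNNReal _ hnn]

end CLT

/-! ### The cross-fitted moment at the true parameter -/

namespace UModel

variable {Ω Z G A : Type*} [MeasurableSpace Z] {k K : ℕ} {M : UModel Ω Z G A k K}

lemma block_subset (n : ℕ) (l : Sym2 (Fin K)) : M.block n l ⊆ indexPairs n :=
  Finset.filter_subset _ _

lemma sum_block {E : Type*} [AddCommMonoid E] (n : ℕ) (u : Fin n × Fin n → E) :
    ∑ l : Sym2 (Fin K), ∑ p ∈ M.block n l, u p = ∑ p ∈ indexPairs n, u p :=
  Finset.sum_fiberwise _ _ _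

lemma card_block_le (n : ℕ) (l : Sym2 (Fin K)) : (M.block n l).card ≤ n.choose 2 :=
  (Finset.card_le_card (block_subset n l)).trans (card_indexPairs n).le

lemma fst_mem_compl_outside {n : ℕ} {l : Sym2 (Fin K)} {p : Fin n × Fin n}
    (hp : p ∈ M.block n l) : p.1 ∈ (M.outside n l)ᶜ := fun h => (h p hp).1 rfl

lemma snd_mem_compl_outside {n : ℕ} {l : Sym2 (Fin K)} {p : Fin n × Fin n}
    (hp : p ∈ M.block n l) : p.2 ∈ (M.outside n l)ᶜ := fun h => (h p hp).2 rfl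

variable [MeasurableSpace Ω] [NormedAddCommGroup G] [NormedAddCommGroup A] {P : Measure Ω}

/-- The orthogonal moment function at the truth, as a kernel. -/
def ψ₀ (M : UModel Ω Z G A k K) (z : Z × Z) : Vec k := M.ψ z.1 z.2 M.γ₀ M.α₀ M.θ₀

lemma Standing.measurable_ψ₀ (hM : M.Standing P) : Measurable M.ψ₀ :=
  hM.measurable_g₀.add hM.measurable_φ₀

lemma Standing.integral_ψ₀ (hM : M.Standing P) : ∫ z, M.ψ₀ z ∂(M.F₀.prod M.F₀) = 0 := by
  simp only [ψ₀, ψ]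
  rw [integral_add hM.g_mean.1 hM.φ_mean.1, hM.g_mean.2, hM.φ_mean.2, add_zero]

lemma Standing.ψ₀_symm (hM : M.Standing P) (w w' : Z) : M.ψ₀ (w, w') = M.ψ₀ (w', w) := by
  simp only [ψ₀, ψ]
  rw [hM.g_symm _ hM.γ₀_mem _ hM.θ₀_mem, hM.φ_symm _ hM.γ₀_mem _ hM.α₀_mem _ hM.θ₀_mem]

section Basic

variable [IsProbabilityMeasure P] (hM : M.Standing P)

include hM

lemma Standing.isProbabilityMeasure : IsProbabilityMeasure M.F₀ := by
  rw [← hM.law 0]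
  exact Measure.isProbabilityMeasure_map (hM.measurable_W 0).aemeasurable

lemma Standing.measurePreserving_sample (n : ℕ) :
    MeasurePreserving (M.sample n) P (Measure.pi fun _ => M.F₀) :=
  _root_.measurePreserving_sample hM.measurable_W hM.law hM.indep n

/-- Under the product measure the coordinates of a sample are i.i.d., whence the law of a pair. -/
lemma Standing.measurePreserving_eval_pair {n : ℕ} {p : Fin n × Fin n} (hp : p ∈ indexPairs n) :
    MeasurePreserving (fun y : Fin n → Z => (y p.1, y p.2)) (Measure.pi fun _ => M.F₀)
      (M.F₀.prod M.F₀) := by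
  have := hM.isProbabilityMeasure
  exact measurePreserving_pair (Y := fun (i : Fin n) (y : Fin n → Z) => y i)
    (fun i => measurable_pi_apply i) (fun i => (measurePreserving_eval _ i).map_eq)
    (iIndepFun_pi (X := fun _ => id) fun _ => aemeasurable_id) (mem_indexPairs.1 hp).ne

/-- A cross-fitted sum over a block is negligible if, for the estimated kernel, the second moment
is `o_p(1)` and the mean is `o_p(n^{-1/2})`: given the observations outside the block, its
centered version has second moment at most a multiple of that of the kernel. -/
lemma Standing.tendsto_block_sum {l : Sym2 (Fin K)} {h : ∀ n, (Fin n → Z) → Z × Z → Vec k}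
    (hm : ∀ n, Measurable fun q : (Fin n → Z) × (Z × Z) => h n q.1 q.2)
    (hdep : ∀ n, DependsOn (h n) (M.outside n l))
    (h2 : Tendsto (fun q : ℕ × Ω => ∫⁻ z, ‖h q.1 (M.sample q.1 q.2) z‖ₑ ^ 2 ∂(M.F₀.prod M.F₀))
      (probFilter P) (𝓝 0))
    (hmean : Tendsto (fun q : ℕ × Ω => Real.sqrt q.1 •
      ∫ z, h q.1 (M.sample q.1 q.2) z ∂(M.F₀.prod M.F₀)) (probFilter P) (𝓝 0)) :
    Tendsto (fun q : ℕ × Ω => (Real.sqrt q.1 * (q.1.choose 2 : ℝ)⁻¹) • ∑ p ∈ M.block q.1 l,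
      h q.1 (M.sample q.1 q.2) (M.W p.1 q.2, M.W p.2 q.2)) (probFilter P) (𝓝 0) := by
  have := hM.isProbabilityMeasure
  set Φ : ∀ n, (Fin n → Z) → (Fin n → Z) → ℝ≥0∞ := fun n x y =>
    ‖(Real.sqrt n * (n.choose 2 : ℝ)⁻¹) • ∑ p ∈ M.block n l,
      (h n x (y p.1, y p.2) - ∫ z, h n x z ∂(M.F₀.prod M.F₀))‖ₑ ^ 2 with hΦ
  have hΦm : ∀ n, Measurable (Function.uncurry (Φ n)) := by
    intro n
    have hint : Measurable fun x : Fin n → Z => ∫ z, h n x z ∂(M.F₀.prod M.F₀) :=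
      (StronglyMeasurable.integral_prod_right (f := h n) (hm n).stronglyMeasurable).measurable
    have hpair : ∀ p : Fin n × Fin n, Measurable fun q : (Fin n → Z) × (Fin n → Z) =>
        h n q.1 (q.2 p.1, q.2 p.2) - ∫ z, h n q.1 z ∂(M.F₀.prod M.F₀) := fun p =>
      ((hm n).comp (measurable_fst.prodMk (by fun_prop :
        Measurable fun q : (Fin n → Z) × (Fin n → Z) => (q.2 p.1, q.2 p.2)))).sub
        (hint.comp measurable_fst)
    exact ((Finset.measurable_fun_sum (M.block n l) fun p _ => hpair p).const_smul
      (Real.sqrt n * (n.choose 2 : ℝ)⁻¹)).enorm.pow_const 2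
  have hΦ1 : ∀ n, DependsOn (Φ n) (M.outside n l) := fun n x x' hx => by
    simp only [hΦ, hdep n hx]
  have hΦ2 : ∀ n x, DependsOn (Φ n x) (M.outside n l)ᶜ := fun n x y y' hy => by
    simp only [hΦ]
    congr 3
    refine Finset.sum_congr rfl fun p hp => ?_
    rw [hy _ (fst_mem_compl_outside hp), hy _ (snd_mem_compl_outside hp)]
  have hbound : Tendsto (fun q : ℕ × Ω => ∫⁻ y, Φ q.1 (M.sample q.1 q.2) y
      ∂(Measure.pi fun _ => M.F₀)) (probFilter P) (𝓝 0) := by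
    have hlim : Tendsto (fun q : ℕ × Ω => 16 *
        ∫⁻ z, ‖h q.1 (M.sample q.1 q.2) z‖ₑ ^ 2 ∂(M.F₀.prod M.F₀)) (probFilter P) (𝓝 0) := by
      simpa using ENNReal.Tendsto.const_mul h2 (Or.inr (by simp : (16 : ℝ≥0∞) ≠ ∞))
    refine tendsto_of_tendsto_of_tendsto_of_le_of_le' tendsto_const_nhds hlim
      (Eventually.of_forall fun _ => zero_le) ?_
    filter_upwards [tendsto_fst_probFilter.eventually (eventually_ge_atTop 2)] with q hn
    exact lintegral_enorm_sq_centered_sum_le hn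
      (Y := fun (i : Fin q.1) (y : Fin q.1 → Z) => y i)
      (fun i => measurable_pi_apply i) (fun i => (measurePreserving_eval _ i).map_eq)
      (iIndepFun_pi (X := fun _ => id) fun _ => aemeasurable_id)
      ((hm q.1).comp measurable_prodMk_left).stronglyMeasurable (block_subset q.1 l)
  have hc := tendsto_zero_of_enorm_sq (X := fun q : ℕ × Ω =>
      (Real.sqrt q.1 * (q.1.choose 2 : ℝ)⁻¹) • ∑ p ∈ M.block q.1 l,
      (h q.1 (M.sample q.1 q.2) (M.W p.1 q.2, M.W p.2 q.2)
        - ∫ z, h q.1 (M.sample q.1 q.2) z ∂(M.F₀.prod M.F₀)))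
    (tendsto_crossfit hM.measurePreserving_sample hΦm hΦ1 hΦ2 hbound)
  have hc2 : Tendsto (fun q : ℕ × Ω => ((q.1.choose 2 : ℝ)⁻¹ * (M.block q.1 l).card) •
      (Real.sqrt q.1 • ∫ z, h q.1 (M.sample q.1 q.2) z ∂(M.F₀.prod M.F₀)))
      (probFilter P) (𝓝 0) := by
    refine squeeze_zero_norm (fun q => ?_) (tendsto_zero_iff_norm_tendsto_zero.1 hmean)
    rw [norm_smul]
    refine mul_le_of_le_one_left (norm_nonneg _) ?_
    rw [Real.norm_of_nonneg (by positivity), inv_mul_eq_div]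
    exact div_le_one_of_le₀ (by exact_mod_cast card_block_le q.1 l) (by positivity)
  have hsum := hc.add hc2
  rw [add_zero] at hsum
  refine hsum.congr fun q => ?_
  rw [Finset.sum_sub_distrib, Finset.sum_const, smul_sub, ← Nat.cast_smul_eq_nsmul ℝ, smul_smul,
    smul_smul]
  rw [sub_add_eq_add_sub, sub_eq_iff_eq_add]
  congr 2
  ring

end Basic

lemma add_sq_le_four_mul (x y : ℝ≥0∞) : (x + y) ^ 2 ≤ 4 * (x ^ 2 + y ^ 2) := by
  have key : ∀ a b : ℝ≥0∞, a ≤ b → (a + b) ^ 2 ≤ 4 * (a ^ 2 + b ^ 2) := fun a b h => by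
    calc (a + b) ^ 2 ≤ (b + b) ^ 2 := by gcongr
      _ = 4 * b ^ 2 := by ring
      _ ≤ _ := by gcongr; exact le_add_self
  rcases le_total x y with h | h
  · exact key x y h
  · rw [add_comm x, add_comm (x ^ 2)]; exact key y x h

section Expansion

/-- The bias `√n ψ̄(γ̂_l, α₀, θ₀)` is negligible; in the case of a quadratic bound it is of the
order of the square of `n^{1/4} ‖γ̂_l - γ₀‖`. -/
lemma SmallBias.tendsto_bias (hB : M.SmallBias P) (hM : M.Standing P) (hJ : M.JacobianRegular P)
    (l : Sym2 (Fin K)) :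
    Tendsto (fun q : ℕ × Ω => Real.sqrt q.1 • M.ψbar (M.γcf q.1 l (M.sample q.1 q.2)) M.α₀ M.θ₀)
      (probFilter P) (𝓝 0) := by
  rcases hB.bias l with ⟨hrate, C, hC, ε, hε, hquad⟩ | h
  · rw [tendsto_zero_iff_enorm_tendsto_zero]
    have h1 := hrate.tendsto
    have h2 : Tendsto (fun q : ℕ × Ω => (C : ℝ≥0∞) * (ENNReal.ofReal ((q.1 : ℝ) ^ (1 / 4 : ℝ)) *
        M.γdist (M.γcf q.1 l (M.sample q.1 q.2))) ^ 2) (probFilter P) (𝓝 0) := by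
      have h3 := ENNReal.Tendsto.const_mul ((ENNReal.continuous_pow 2).tendsto 0 |>.comp h1)
        (Or.inr (ENNReal.coe_ne_top (r := C)))
      simpa using h3
    refine tendsto_of_tendsto_of_tendsto_of_le_of_le' tendsto_const_nhds h2
      (Eventually.of_forall fun _ => zero_le) ?_
    filter_upwards [(hJ.γcf_consistent l).tendsto.eventually_lt_const hε] with q hq
    rw [enorm_smul, mul_pow, Real.enorm_of_nonneg (Real.sqrt_nonneg _),
      ← ENNReal.ofReal_pow (by positivity), ← Real.rpow_natCast, ← Real.rpow_mul (by positivity),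
      Real.sqrt_eq_rpow, mul_left_comm]
    norm_num
    gcongr
    exact hquad _ (hM.γcf_mem _ _ _) hq
  · rw [tendsto_zero_iff_enorm_tendsto_zero]
    exact h.tendsto

variable [IsProbabilityMeasure P] (hM : M.Standing P) (hMS : M.MeanSquare P)

include hM hMS

/-- Replacing `γ₀` by its cross-fitted estimator in `g + φ`, at `α₀`, is negligible. -/
lemma tendsto_block_sum_γ (hB : M.SmallBias P) (hJ : M.JacobianRegular P) (l : Sym2 (Fin K)) :
    Tendsto (fun q : ℕ × Ω => (Real.sqrt q.1 * (q.1.choose 2 : ℝ)⁻¹) • ∑ p ∈ M.block q.1 l,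
      (M.ψ (M.W p.1 q.2) (M.W p.2 q.2) (M.γcf q.1 l (M.sample q.1 q.2)) M.α₀ M.θ₀
        - M.ψ (M.W p.1 q.2) (M.W p.2 q.2) M.γ₀ M.α₀ M.θ₀)) (probFilter P) (𝓝 0) := by
  have := hM.isProbabilityMeasure
  obtain ⟨h, hh⟩ : ∃ h : ∀ n, (Fin n → Z) → Z × Z → Vec k, h = fun n x z =>
    M.ψ z.1 z.2 (M.γcf n l x) M.α₀ M.θ₀ - M.ψ z.1 z.2 M.γ₀ M.α₀ M.θ₀ := ⟨_, rfl⟩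
  have hm0 : Measurable fun z : Z × Z => M.ψ z.1 z.2 M.γ₀ M.α₀ M.θ₀ := hM.measurable_ψ₀
  have hm : ∀ n, Measurable fun q : (Fin n → Z) × (Z × Z) => h n q.1 q.2 := fun n => by
    subst hh
    exact ((hM.measurable_gcf n l).add (hM.measurable_φcf_γ n l)).sub (hm0.comp measurable_snd)
  have h2 : Tendsto (fun q : ℕ × Ω => ∫⁻ z, ‖h q.1 (M.sample q.1 q.2) z‖ₑ ^ 2
      ∂(M.F₀.prod M.F₀)) (probFilter P) (𝓝 0) := by
    have hlim := ENNReal.Tendsto.const_mul ((hMS.g_γ l).tendsto.add (hMS.φ_γ l).tendsto)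
      (Or.inr (by simp : (4 : ℝ≥0∞) ≠ ∞))
    rw [add_zero, mul_zero] at hlim
    refine tendsto_of_tendsto_of_tendsto_of_le_of_le tendsto_const_nhds hlim
      (fun _ => zero_le) fun q => ?_
    have hgm : Measurable fun z : Z × Z =>
        M.g z.1 z.2 (M.γcf q.1 l (M.sample q.1 q.2)) M.θ₀ - M.g z.1 z.2 M.γ₀ M.θ₀ :=
      ((hM.measurable_gcf q.1 l).comp measurable_prodMk_left).sub hM.measurable_g₀
    simp only
    rw [← lintegral_add_left (hgm.enorm.pow_const 2), ← lintegral_const_mul' _ _ (by simp)]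
    refine lintegral_mono fun z => le_trans (pow_le_pow_left' ?_ 2) (add_sq_le_four_mul _ _)
    refine le_trans (le_of_eq ?_) (enorm_add_le _ _)
    simp only [hh, ψ]
    congr 1
    abel
  have hmean : Tendsto (fun q : ℕ × Ω => Real.sqrt q.1 •
      ∫ z, h q.1 (M.sample q.1 q.2) z ∂(M.F₀.prod M.F₀)) (probFilter P) (𝓝 0) := by
    refine (hB.tendsto_bias hM hJ l).congr' ?_
    filter_upwards [h2.eventually_lt_const one_pos] with q hq
    have hL : MemLp (h q.1 (M.sample q.1 q.2)) 2 (M.F₀.prod M.F₀) :=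
      memLp_two_of_lintegral ((hm q.1).comp measurable_prodMk_left).aestronglyMeasurable
        (hq.trans ENNReal.one_lt_top)
    have hψ0i : Integrable (fun z : Z × Z => M.ψ z.1 z.2 M.γ₀ M.α₀ M.θ₀) (M.F₀.prod M.F₀) :=
      hM.g_mean.1.add hM.φ_mean.1
    have hψ0 : ∫ z, M.ψ z.1 z.2 M.γ₀ M.α₀ M.θ₀ ∂(M.F₀.prod M.F₀) = 0 := hM.integral_ψ₀
    have hadd := integral_add (hL.integrable one_le_two) hψ0i
    rw [hψ0, add_zero] at hadd
    rw [← hadd, ψbar]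
    simp only [hh, sub_add_cancel]
  have key := hM.tendsto_block_sum (l := l) hm
    (fun n x x' hx => by simp only [hh, hM.γcf_dependsOn n l hx]) h2 hmean
  simpa only [hh] using key

/-- Replacing `α₀` by its cross-fitted estimator in `φ`, at `γ₀`, is negligible. -/
lemma tendsto_block_sum_α (hB : M.SmallBias P) (l : Sym2 (Fin K)) :
    Tendsto (fun q : ℕ × Ω => (Real.sqrt q.1 * (q.1.choose 2 : ℝ)⁻¹) • ∑ p ∈ M.block q.1 l,
      (M.φ (M.W p.1 q.2) (M.W p.2 q.2) M.γ₀ (M.αcf q.1 l (M.sample q.1 q.2)) M.θ₀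
        - M.φ (M.W p.1 q.2) (M.W p.2 q.2) M.γ₀ M.α₀ M.θ₀)) (probFilter P) (𝓝 0) := by
  obtain ⟨h, hh⟩ : ∃ h : ∀ n, (Fin n → Z) → Z × Z → Vec k, h = fun n x z =>
    M.φ z.1 z.2 M.γ₀ (M.αcf n l x) M.θ₀ - M.φ z.1 z.2 M.γ₀ M.α₀ M.θ₀ := ⟨_, rfl⟩
  have hm : ∀ n, Measurable fun q : (Fin n → Z) × (Z × Z) => h n q.1 q.2 := fun n => by
    subst hh
    exact (hM.measurable_φcf_α n l).sub (hM.measurable_φ₀.comp measurable_snd)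
  have hmean : Tendsto (fun q : ℕ × Ω => Real.sqrt q.1 •
      ∫ z, h q.1 (M.sample q.1 q.2) z ∂(M.F₀.prod M.F₀)) (probFilter P) (𝓝 0) := by
    refine tendsto_const_nhds.congr' ?_
    filter_upwards [(hB.robust l M.θ₀ hM.θ₀_mem).eventually] with q hq
    simp only [hh]
    rw [integral_sub hq.1 hM.φ_mean.1, hq.2, hM.φ_mean.2, sub_zero, smul_zero]
  have h2 := (hMS.φ_α l).tendsto
  have key := hM.tendsto_block_sum (l := l) hm
    (fun n x x' hx => by simp only [hh, hM.αcf_dependsOn n l hx]) (by simpa only [hh] using h2)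
    hmean
  simpa only [hh] using key

omit hMS in
/-- The interaction of the two first step errors is negligible. -/
lemma tendsto_block_sum_ξ (hI : M.InteractionRate P) (l : Sym2 (Fin K)) :
    Tendsto (fun q : ℕ × Ω => (Real.sqrt q.1 * (q.1.choose 2 : ℝ)⁻¹) • ∑ p ∈ M.block q.1 l,
      M.ξhat q.1 l (M.sample q.1 q.2) (M.W p.1 q.2) (M.W p.2 q.2)) (probFilter P) (𝓝 0) := by
  rcases hI l with ⟨h1, h2⟩ | h | h
  · refine hM.tendsto_block_sum (h := fun n x z => M.ξhat n l x z.1 z.2) (fun n => ?_)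
      (fun n x x' hx => ?_) h2.tendsto ?_
    · exact (((hM.measurable_φcf n l).sub (hM.measurable_φcf_α n l)).sub
        (hM.measurable_φcf_γ n l)).add (hM.measurable_φ₀.comp measurable_snd)
    · simp only [ξhat, hM.αcf_dependsOn n l hx, hM.γcf_dependsOn n l hx]
    · rw [tendsto_zero_iff_enorm_tendsto_zero]
      exact h1.tendsto
  · have h1 := tendsto_zero_iff_norm_tendsto_zero.1
      (tendsto_zero_iff_enorm_tendsto_zero.2 h.tendsto)
    refine squeeze_zero_norm (fun q => ?_) h1
    rw [norm_smul, norm_mul _ (∑ p ∈ M.block q.1 l, _)]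
    gcongr
    exact (norm_sum_le _ _).trans (le_abs_self _)
  · rw [tendsto_zero_iff_enorm_tendsto_zero]
    exact h.tendsto

/-- The cross-fitted moment at the truth is asymptotically equivalent to the U-statistic with the
true first steps. -/
lemma tendsto_sqrt_smul_ψhat_sub (hI : M.InteractionRate P) (hB : M.SmallBias P)
    (hJ : M.JacobianRegular P) :
    Tendsto (fun q : ℕ × Ω => Real.sqrt q.1 • M.ψhat q.1 (M.sample q.1 q.2) M.θ₀
      - (Real.sqrt q.1 * (q.1.choose 2 : ℝ)⁻¹) • ∑ p ∈ indexPairs q.1,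
        M.ψ (M.W p.1 q.2) (M.W p.2 q.2) M.γ₀ M.α₀ M.θ₀) (probFilter P) (𝓝 0) := by
  have h := tendsto_finsetSum (Finset.univ : Finset (Sym2 (Fin K))) fun l _ =>
    ((tendsto_block_sum_γ hM hMS hB hJ l).add (tendsto_block_sum_α hM hMS hB l)).add
      (tendsto_block_sum_ξ hM hI l)
  simp only [add_zero, Finset.sum_const_zero] at h
  refine h.congr fun q => ?_
  rw [ψhat, smul_smul, ← sum_block (M := M), ← smul_sub, ← Finset.sum_sub_distrib,
    Finset.smul_sum]
  refine Finset.sum_congr rfl fun l _ => ?_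
  rw [← smul_add, ← smul_add, ← Finset.sum_add_distrib, ← Finset.sum_add_distrib,
    ← Finset.sum_sub_distrib]
  congr 1
  refine Finset.sum_congr rfl fun p _ => ?_
  simp only [ψ, ξhat, sample]
  abel

end Expansion

end UModel

/-! ### The Jacobian -/

namespace UModel

variable {Ω Z G A : Type*} [MeasurableSpace Z] {k K : ℕ} {M : UModel Ω Z G A k K}

/-- The remainder of the first order Taylor expansion, from the Hölder bound on the Jacobian and the
mean value inequality. -/
lemma SmoothOn.norm_taylor_le {N : Set (Vec k)} {r : ℝ} (hN : Metric.ball M.θ₀ r ⊆ N)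
    {C δ : ℝ≥0} {γ : Z → G} {α : Z × Z → A} {w w' : Z} (h : M.SmoothOn N C δ γ α w w')
    {θ : Vec k} (hθ : ‖θ - M.θ₀‖ < r) :
    ‖M.ψ w w' γ α θ - M.ψ w w' γ α M.θ₀ - M.Dψ w w' γ α M.θ₀ (θ - M.θ₀)‖
      ≤ δ * ‖θ - M.θ₀‖ ^ (1 / (C : ℝ)) * ‖θ - M.θ₀‖ := by
  have hsub : Metric.closedBall M.θ₀ ‖θ - M.θ₀‖ ⊆ N := fun t ht =>
    hN (lt_of_le_of_lt (Metric.mem_closedBall.1 ht) hθ)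
  refine (convex_closedBall M.θ₀ ‖θ - M.θ₀‖).norm_image_sub_le_of_norm_hasFDerivWithin_le'
    (f' := fun t => M.Dψ w w' γ α t)
    (fun t ht => (h t (hsub ht)).1.hasFDerivAt.hasFDerivWithinAt) (fun t ht => ?_)
    (Metric.mem_closedBall_self (norm_nonneg _)) (by simp [dist_eq_norm])
  refine (h t (hsub ht)).2.trans ?_
  gcongr
  rwa [Metric.mem_closedBall, dist_eq_norm] at ht

lemma tendsto_clm_of_tendsto_single {α : Type*} {l : Filter α} {J : α → Vec k →L[ℝ] Vec k}
    {L : Vec k →L[ℝ] Vec k} (h : ∀ b, Tendsto (fun a => J a (EuclideanSpace.single b 1)) l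
      (𝓝 (L (EuclideanSpace.single b 1)))) : Tendsto J l (𝓝 L) := by
  rw [tendsto_iff_norm_sub_tendsto_zero]
  have h1 : Tendsto (fun a => ∑ b, ‖J a (EuclideanSpace.single b 1)
      - L (EuclideanSpace.single b 1)‖) l (𝓝 0) := by
    have := tendsto_finsetSum (Finset.univ : Finset (Fin k)) fun b _ =>
      tendsto_iff_norm_sub_tendsto_zero.1 (h b)
    simpa using this
  refine squeeze_zero (fun _ => norm_nonneg _) (fun a => ?_) h1
  refine ContinuousLinearMap.opNorm_le_bound _ (Finset.sum_nonneg fun _ _ => norm_nonneg _)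
    fun x => ?_
  have hx : x = ∑ b, x b • EuclideanSpace.single b (1 : ℝ) := by
    simpa using ((EuclideanSpace.basisFun (Fin k) ℝ).sum_repr x).symm
  conv_lhs => rw [hx]
  rw [map_sum, Finset.sum_mul]
  refine (norm_sum_le _ _).trans (Finset.sum_le_sum fun b _ => ?_)
  rw [map_smul, norm_smul, mul_comm, sub_apply]
  gcongr
  exact PiLp.norm_apply_le x b

/-- An inequality only, since at `n = 0` the real inverse is `0` and the one in `ℝ≥0∞` is `∞`. -/
lemma enorm_inv_natCast_le (n : ℕ) : ‖((n : ℝ))⁻¹‖ₑ ≤ (n : ℝ≥0∞)⁻¹ := by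
  rcases Nat.eq_zero_or_pos n with rfl | hn
  · simp
  · rw [enorm_inv (by positivity), Real.enorm_natCast]

lemma enorm_inv_natCast_smul_sum_le {ι E : Type*} [NormedAddCommGroup E] [NormedSpace ℝ E]
    (n : ℕ) (s : Finset ι) (u : ι → E) :
    ‖(n : ℝ)⁻¹ • ∑ i ∈ s, u i‖ₑ ≤ (n : ℝ≥0∞)⁻¹ * ∑ i ∈ s, ‖u i‖ₑ := by
  rw [enorm_smul]
  gcongr
  · exact enorm_inv_natCast_le n
  · exact enorm_sum_le _ _

lemma measurable_block_average {l : Sym2 (Fin K)} {u : ∀ n, (Fin n → Z) → Z × Z → ℝ≥0∞}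
    (hu : ∀ n, Measurable fun q : (Fin n → Z) × (Z × Z) => u n q.1 q.2) (n : ℕ) :
    Measurable (Function.uncurry fun (x y : Fin n → Z) =>
      (n.choose 2 : ℝ≥0∞)⁻¹ * ∑ p ∈ M.block n l, u n x (y p.1, y p.2)) := by
  refine Measurable.const_mul (Finset.measurable_fun_sum _ fun p _ => ?_) _
  exact (hu n).comp (measurable_fst.prodMk (by fun_prop :
        Measurable fun q : (Fin n → Z) × (Fin n → Z) => (q.2 p.1, q.2 p.2)))

lemma dependsOn_block_average {l : Sym2 (Fin K)} {u : ∀ n, (Fin n → Z) → Z × Z → ℝ≥0∞}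
    (hdep : ∀ n, DependsOn (u n) (M.outside n l)) :
    (∀ n, DependsOn (fun (x y : Fin n → Z) => (n.choose 2 : ℝ≥0∞)⁻¹ *
      ∑ p ∈ M.block n l, u n x (y p.1, y p.2)) (M.outside n l)) ∧
    (∀ n (x : Fin n → Z), DependsOn (fun y : Fin n → Z => (n.choose 2 : ℝ≥0∞)⁻¹ *
      ∑ p ∈ M.block n l, u n x (y p.1, y p.2)) (M.outside n l)ᶜ) := by
  refine ⟨fun n x x' hx => by simp only [hdep n hx], fun n x y y' hy => ?_⟩
  simp only
  congr 1
  refine Finset.sum_congr rfl fun p hp => ?_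
  rw [hy _ (fst_mem_compl_outside hp), hy _ (snd_mem_compl_outside hp)]

variable [MeasurableSpace Ω] [NormedAddCommGroup G] [NormedAddCommGroup A] {P : Measure Ω}

section Blocks

variable [IsProbabilityMeasure P] (hM : M.Standing P)

include hM

variable {l : Sym2 (Fin K)} {u : ∀ n, (Fin n → Z) → Z × Z → ℝ≥0∞}
    (hu : ∀ n, Measurable fun q : (Fin n → Z) × (Z × Z) => u n q.1 q.2)
    (hdep : ∀ n, DependsOn (u n) (M.outside n l))

include hu

lemma Standing.lintegral_block_average_le (n : ℕ) (x : Fin n → Z) :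
    ∫⁻ y, (n.choose 2 : ℝ≥0∞)⁻¹ * ∑ p ∈ M.block n l, u n x (y p.1, y p.2)
        ∂(Measure.pi fun _ => M.F₀)
      ≤ ∫⁻ z, u n x z ∂(M.F₀.prod M.F₀) := by
  have hm : Measurable (u n x) := (hu n).comp measurable_prodMk_left
  have hmp : ∀ p : Fin n × Fin n, Measurable fun y : Fin n → Z => u n x (y p.1, y p.2) :=
    fun p => hm.comp (by fun_prop)
  rw [lintegral_const_mul _ (Finset.measurable_fun_sum _ fun p _ => hmp p),
    lintegral_finsetSum _ fun p _ => hmp p]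
  have h1 : ∀ p ∈ M.block n l, ∫⁻ y, u n x (y p.1, y p.2) ∂(Measure.pi fun _ => M.F₀)
      ≤ ∫⁻ z, u n x z ∂(M.F₀.prod M.F₀) := fun p hp =>
    ((hM.measurePreserving_eval_pair (block_subset n l hp)).lintegral_comp hm).le
  refine (mul_le_mul_right (Finset.sum_le_card_nsmul _ _ _ h1) _).trans ?_
  rw [nsmul_eq_mul, ← mul_assoc]
  refine mul_le_of_le_one_left zero_le ?_
  refine (mul_le_mul_right (Nat.cast_le.2 (card_block_le n l)) _).trans ?_
  exact ENNReal.inv_mul_le_one _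

include hdep

/-- A cross-fitted block average of nonnegative functions is `o_p(1)` if their integrals are. -/
lemma Standing.tendsto_block_average
    (h : Tendsto (fun q : ℕ × Ω => ∫⁻ z, u q.1 (M.sample q.1 q.2) z ∂(M.F₀.prod M.F₀))
      (probFilter P) (𝓝 0)) :
    Tendsto (fun q : ℕ × Ω => (q.1.choose 2 : ℝ≥0∞)⁻¹ * ∑ p ∈ M.block q.1 l,
      u q.1 (M.sample q.1 q.2) (M.W p.1 q.2, M.W p.2 q.2)) (probFilter P) (𝓝 0) := by
  have := hM.isProbabilityMeasure
  have hd := dependsOn_block_average hdep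
  exact tendsto_crossfit (s := M.sample) (Φ := fun n x y => (n.choose 2 : ℝ≥0∞)⁻¹ *
      ∑ p ∈ M.block n l, u n x (y p.1, y p.2)) hM.measurePreserving_sample
    (measurable_block_average hu) hd.1 hd.2
    (tendsto_of_tendsto_of_tendsto_of_le_of_le tendsto_const_nhds h (fun _ => zero_le)
      fun q => hM.lintegral_block_average_le hu q.1 _)

/-- A cross-fitted block average of nonnegative functions is `O_p(1)` if their integrals are bounded
with probability approaching one. -/
lemma Standing.bddInProb_block_average {C : ℝ≥0∞} (hC : C ≠ ∞)
    (h : ∀ᶠ q in probFilter P,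
      ∫⁻ z, u q.1 (M.sample q.1 q.2) z ∂(M.F₀.prod M.F₀) ≤ C) :
    BddInProb P (fun q : ℕ × Ω => (q.1.choose 2 : ℝ≥0∞)⁻¹ * ∑ p ∈ M.block q.1 l,
      u q.1 (M.sample q.1 q.2) (M.W p.1 q.2, M.W p.2 q.2)) := by
  have := hM.isProbabilityMeasure
  have hd := dependsOn_block_average hdep
  exact bddInProb_crossfit (s := M.sample) (Φ := fun n x y => (n.choose 2 : ℝ≥0∞)⁻¹ *
      ∑ p ∈ M.block n l, u n x (y p.1, y p.2)) hM.measurePreserving_sample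
    (measurable_block_average hu) hd.1 hd.2 hC
    (h.mono fun q hq => (hM.lintegral_block_average_le hu q.1 _).trans hq)

end Blocks

section Derivative

/-- The derivative `∂E[ψ(W_i, W_j, γ₀, α₀, θ)]/∂θ` at `θ₀`, as a linear map. -/
noncomputable def meanDeriv (M : UModel Ω Z G A k K) : Vec k →L[ℝ] Vec k :=
  fderiv ℝ (fun t => M.ψbar M.γ₀ M.α₀ t) M.θ₀

/-- Differentiation under the integral sign at `θ₀`: the Hölder bound makes the difference
quotients converge in mean. -/
lemma JacobianRegular.integrable_pψ (hJ : M.JacobianRegular P) (hM : M.Standing P) (b : Fin k) :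
    Integrable (fun z : Z × Z => M.pψ b z.1 z.2 M.γ₀ M.α₀ M.θ₀) (M.F₀.prod M.F₀) ∧
      ∫ z, M.pψ b z.1 z.2 M.γ₀ M.α₀ M.θ₀ ∂(M.F₀.prod M.F₀)
        = M.meanDeriv (EuclideanSpace.single b 1) := by
  obtain ⟨N, hN, -, C, hC, ε, hε, d, hd1, -, -, hfix, -⟩ := hJ.smooth
  obtain ⟨hsm, hdC⟩ := hfix M.γ₀ hM.γ₀_mem M.α₀ hM.α₀_mem (by simpa [γdist] using hε)
    (by simpa [αdist] using hε)
  have hdm := hd1 M.γ₀ hM.γ₀_mem M.α₀ hM.α₀_mem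
  obtain ⟨r, hr, hrN⟩ := Metric.mem_nhds_iff.1 hN
  set v : Vec k := EuclideanSpace.single b 1 with hv
  have hvn : ‖v‖ = 1 := by simp [hv]
  set ν := M.F₀.prod M.F₀ with hν
  have hdi : Integrable (fun z : Z × Z => (d z.1 z.2 M.γ₀ M.α₀ : ℝ)) ν := by
    refine ⟨hdm.coe_nnreal_real.aestronglyMeasurable, ?_⟩
    rw [hasFiniteIntegral_iff_enorm]
    refine lt_of_le_of_lt (le_trans (le_of_eq (lintegral_congr fun z => ?_)) hdC)
      ENNReal.coe_lt_top
    simp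
  have hdI : ∫ z, (d z.1 z.2 M.γ₀ M.α₀ : ℝ) ∂ν ≤ C := by
    rw [integral_eq_lintegral_of_nonneg_ae (ae_of_all _ fun _ => NNReal.coe_nonneg _) hdi.1]
    simp only [ENNReal.ofReal_coe_nnreal]
    exact ENNReal.toReal_le_coe_of_le_coe hdC
  set Q : ℝ → Z × Z → Vec k := fun t z =>
    t⁻¹ • (M.ψ z.1 z.2 M.γ₀ M.α₀ (M.θ₀ + t • v) - M.ψ z.1 z.2 M.γ₀ M.α₀ M.θ₀) with hQ
  have hline : Tendsto (fun t : ℝ => M.θ₀ + t • v) (𝓝[>] 0) (𝓝 M.θ₀) := by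
    have : Continuous fun t : ℝ => M.θ₀ + t • v := by fun_prop
    have h0 := this.tendsto 0
    simp only [zero_smul, add_zero] at h0
    exact h0.mono_left nhdsWithin_le_nhds
  have hgood : ∀ᶠ t : ℝ in 𝓝[>] 0, 0 < t ∧ t < r ∧
      Integrable (fun z : Z × Z => M.ψ z.1 z.2 M.γ₀ M.α₀ (M.θ₀ + t • v)) ν := by
    filter_upwards [self_mem_nhdsWithin, nhdsWithin_le_nhds (Iio_mem_nhds hr),
      hline.eventually hJ.integrable] with t h1 h2 h3
    exact ⟨h1, h2, h3⟩
  have hi0 : Integrable (fun z : Z × Z => M.ψ z.1 z.2 M.γ₀ M.α₀ M.θ₀) ν :=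
    hM.g_mean.1.add hM.φ_mean.1
  have hbound : ∀ t : ℝ, 0 < t → t < r → ∀ᵐ z ∂ν, ‖Q t z - M.pψ b z.1 z.2 M.γ₀ M.α₀ M.θ₀‖
      ≤ d z.1 z.2 M.γ₀ M.α₀ * t ^ (1 / (C : ℝ)) := by
    intro t ht htr
    filter_upwards [hsm] with z hz
    have hn : ‖M.θ₀ + t • v - M.θ₀‖ = t := by
      rw [add_sub_cancel_left, norm_smul, hvn, mul_one, Real.norm_of_nonneg ht.le]
    have h1 := hz.norm_taylor_le hrN (θ := M.θ₀ + t • v) (by rw [hn]; exact htr)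
    rw [hn, add_sub_cancel_left, map_smul] at h1
    have h2 : Q t z - M.pψ b z.1 z.2 M.γ₀ M.α₀ M.θ₀ = t⁻¹ •
        (M.ψ z.1 z.2 M.γ₀ M.α₀ (M.θ₀ + t • v) - M.ψ z.1 z.2 M.γ₀ M.α₀ M.θ₀
          - t • M.Dψ z.1 z.2 M.γ₀ M.α₀ M.θ₀ v) := by
      simp only [hQ, pψ]
      rw [smul_sub _ _ (t • _), inv_smul_smul₀ ht.ne']
    rw [h2, norm_smul, norm_inv, Real.norm_of_nonneg ht.le, inv_mul_le_iff₀ ht, mul_comm t]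
    exact h1
  have hpm : AEStronglyMeasurable (fun z : Z × Z => M.pψ b z.1 z.2 M.γ₀ M.α₀ M.θ₀) ν :=
    (hM.measurable_p₀ b).aestronglyMeasurable
  have hQi : ∀ t : ℝ, Integrable (fun z : Z × Z => M.ψ z.1 z.2 M.γ₀ M.α₀ (M.θ₀ + t • v)) ν →
      Integrable (Q t) ν := fun t h => ((h.sub hi0).smul t⁻¹ :)
  have hdiff : ∀ t : ℝ, 0 < t → t < r →
      Integrable (fun z : Z × Z => M.ψ z.1 z.2 M.γ₀ M.α₀ (M.θ₀ + t • v)) ν →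
      Integrable (fun z => Q t z - M.pψ b z.1 z.2 M.γ₀ M.α₀ M.θ₀) ν := fun t h1 h2 h3 =>
    Integrable.mono' (hdi.mul_const _) ((hQi t h3).1.sub hpm) (hbound t h1 h2)
  have hpi : Integrable (fun z : Z × Z => M.pψ b z.1 z.2 M.γ₀ M.α₀ M.θ₀) ν := by
    obtain ⟨t, h1, h2, h3⟩ := hgood.exists
    have := (hQi t h3).sub (hdiff t h1 h2 h3)
    refine this.congr (ae_of_all _ fun z => ?_)
    simp
  refine ⟨hpi, ?_⟩
  have hlim1 : Tendsto (fun t : ℝ => ∫ z, Q t z ∂ν) (𝓝[>] 0) (𝓝 (M.meanDeriv v)) := by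
    have h1 := (hJ.differentiable.hasFDerivAt.hasLineDerivAt v).tendsto_slope_zero_right
    refine h1.congr' ?_
    filter_upwards [hgood] with t ht
    rw [hQ, integral_smul, integral_sub ht.2.2 hi0]
    rfl
  have hlim2 : Tendsto (fun t : ℝ => ∫ z, Q t z ∂ν) (𝓝[>] 0)
      (𝓝 (∫ z, M.pψ b z.1 z.2 M.γ₀ M.α₀ M.θ₀ ∂ν)) := by
    rw [tendsto_iff_norm_sub_tendsto_zero]
    have h0 : Tendsto (fun t : ℝ => (C : ℝ) * t ^ (1 / (C : ℝ))) (𝓝[>] 0) (𝓝 0) := by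
      have hC' : (0 : ℝ) < 1 / C := by positivity
      have h1 : Tendsto (fun t : ℝ => t ^ (1 / (C : ℝ))) (𝓝[>] 0) (𝓝 0) := by
        have := (Real.continuous_rpow_const hC'.le).tendsto 0
        rw [Real.zero_rpow hC'.ne'] at this
        exact this.mono_left nhdsWithin_le_nhds
      simpa using h1.const_mul (C : ℝ)
    refine tendsto_of_tendsto_of_tendsto_of_le_of_le' tendsto_const_nhds h0
      (Eventually.of_forall fun _ => norm_nonneg _) ?_
    filter_upwards [hgood] with t ht
    rw [← integral_sub (hQi t ht.2.2) hpi]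
    refine (norm_integral_le_of_norm_le (hdi.mul_const _) (hbound t ht.1 ht.2.1)).trans ?_
    rw [integral_mul_const]
    have := ht.1
    gcongr
  exact tendsto_nhds_unique hlim2 hlim1

end Derivative

end UModel

/-! ### Linearization of the estimator -/

namespace UModel

variable {Ω Z G A : Type*} [MeasurableSpace Z] {k K : ℕ} {M : UModel Ω Z G A k K}
  [MeasurableSpace Ω] [NormedAddCommGroup G] [NormedAddCommGroup A] {P : Measure Ω}
  [IsProbabilityMeasure P]

/-- The Jacobian of the cross-fitted sample moment at the true parameter. -/
noncomputable def jacHat (M : UModel Ω Z G A k K) (n : ℕ) (x : Fin n → Z) : Vec k →L[ℝ] Vec k :=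
  (n.choose 2 : ℝ)⁻¹ • ∑ l : Sym2 (Fin K), ∑ p ∈ M.block n l,
    M.Dψ (x p.1) (x p.2) (M.γcf n l x) (M.αcf n l x) M.θ₀

lemma JacobianRegular.tendsto_pairAverage_pψ (hJ : M.JacobianRegular P) (hM : M.Standing P)
    (b : Fin k) :
    Tendsto (fun q : ℕ × Ω => (q.1.choose 2 : ℝ)⁻¹ • ∑ p ∈ indexPairs q.1,
      M.pψ b (M.W p.1 q.2) (M.W p.2 q.2) M.γ₀ M.α₀ M.θ₀) (probFilter P)
      (𝓝 (M.meanDeriv (EuclideanSpace.single b 1))) := by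
  obtain ⟨hi, heq⟩ := hJ.integrable_pψ hM b
  rw [← heq]
  have key := tendsto_pairAverage (f := fun z : Z × Z => M.pψ b z.1 z.2 M.γ₀ M.α₀ M.θ₀)
    hM.measurable_W hM.law hM.indep (hM.measurable_p₀ b).stronglyMeasurable hi
  simpa only using key

lemma JacobianRegular.tendsto_jacHat (hJ : M.JacobianRegular P) (hM : M.Standing P) :
    Tendsto (fun q : ℕ × Ω => M.jacHat q.1 (M.sample q.1 q.2)) (probFilter P)
      (𝓝 M.meanDeriv) := by
  refine tendsto_clm_of_tendsto_single fun b => ?_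
  have h1 : ∀ l : Sym2 (Fin K), Tendsto (fun q : ℕ × Ω => (q.1.choose 2 : ℝ)⁻¹ •
      ∑ p ∈ M.block q.1 l, (M.pψ b (M.W p.1 q.2) (M.W p.2 q.2) (M.γcf q.1 l (M.sample q.1 q.2))
        (M.αcf q.1 l (M.sample q.1 q.2)) M.θ₀
        - M.pψ b (M.W p.1 q.2) (M.W p.2 q.2) M.γ₀ M.α₀ M.θ₀)) (probFilter P) (𝓝 0) := by
    intro l
    rw [tendsto_zero_iff_enorm_tendsto_zero]
    have h2 := hM.tendsto_block_average (l := l) (u := fun n x z =>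
      ‖M.pψ b z.1 z.2 (M.γcf n l x) (M.αcf n l x) M.θ₀ - M.pψ b z.1 z.2 M.γ₀ M.α₀ M.θ₀‖ₑ)
      (fun n => ((hM.measurable_pcf b n l).sub ((hM.measurable_p₀ b).comp measurable_snd)).enorm)
      (fun n x x' hx => by simp only [hM.γcf_dependsOn n l hx, hM.αcf_dependsOn n l hx])
      (hJ.partial_cf b l).tendsto
    exact tendsto_of_tendsto_of_tendsto_of_le_of_le tendsto_const_nhds h2 (fun _ => zero_le)
      fun q => enorm_inv_natCast_smul_sum_le _ _ _
  have h3 := (tendsto_finsetSum (Finset.univ : Finset (Sym2 (Fin K))) fun l _ => h1 l).add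
    (hJ.tendsto_pairAverage_pψ hM b)
  rw [Finset.sum_const_zero, zero_add] at h3
  refine h3.congr fun q => ?_
  rw [← sum_block (M := M), Finset.smul_sum, ← Finset.sum_add_distrib, jacHat, smul_apply,
    sum_apply, Finset.smul_sum]
  refine Finset.sum_congr rfl fun l _ => ?_
  rw [← smul_add, ← Finset.sum_add_distrib, sum_apply]
  congr 1
  refine Finset.sum_congr rfl fun p _ => ?_
  rw [sub_add_cancel]
  rfl

lemma tendsto_enorm_rpow {α : Type*} {l : Filter α} {u : α → Vec k} (hu : Tendsto u l (𝓝 0))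
    {c : ℝ} (hc : 0 < c) : Tendsto (fun a => ‖‖u a‖ ^ c‖ₑ) l (𝓝 0) := by
  rw [← tendsto_zero_iff_enorm_tendsto_zero]
  have h := (Real.continuous_rpow_const hc.le).tendsto 0
  rw [Real.zero_rpow hc.ne'] at h
  exact h.comp (tendsto_zero_iff_norm_tendsto_zero.1 hu)

/-- First order expansion of the cross-fitted moment, with a remainder `o_p(‖θ̂ - θ₀‖)`. -/
lemma JacobianRegular.exists_expansion (hJ : M.JacobianRegular P) (hM : M.Standing P)
    (hθ : Tendsto (fun q : ℕ × Ω => M.θhat q.1 (M.sample q.1 q.2) - M.θ₀) (probFilter P) (𝓝 0)) :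
    ∃ ρ : ℕ × Ω → ℝ, Tendsto ρ (probFilter P) (𝓝 0) ∧ ∀ᶠ q in probFilter P,
      ‖M.ψhat q.1 (M.sample q.1 q.2) (M.θhat q.1 (M.sample q.1 q.2))
        - M.ψhat q.1 (M.sample q.1 q.2) M.θ₀
        - M.meanDeriv (M.θhat q.1 (M.sample q.1 q.2) - M.θ₀)‖
      ≤ ρ q * ‖M.θhat q.1 (M.sample q.1 q.2) - M.θ₀‖ := by
  obtain ⟨N, hN, -, C, hC, ε, hε, d, -, hd2, -, hfix, hcf, -⟩ := hJ.smooth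
  obtain ⟨r, hr, hrN⟩ := Metric.mem_nhds_iff.1 hN
  set u : ℕ × Ω → Vec k := fun q => M.θhat q.1 (M.sample q.1 q.2) - M.θ₀ with hu
  set D : ℕ × Ω → ℝ := fun q => (q.1.choose 2 : ℝ)⁻¹ * ∑ l : Sym2 (Fin K), ∑ p ∈ M.block q.1 l,
    (d (M.W p.1 q.2) (M.W p.2 q.2) (M.γcf q.1 l (M.sample q.1 q.2))
      (M.αcf q.1 l (M.sample q.1 q.2)) : ℝ) with hD
  have hDb : BddInProb P fun q => ‖D q‖ₑ := by
    have h1 : ∀ l : Sym2 (Fin K), BddInProb P (fun q : ℕ × Ω => (q.1.choose 2 : ℝ≥0∞)⁻¹ *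
        ∑ p ∈ M.block q.1 l, (d (M.W p.1 q.2) (M.W p.2 q.2) (M.γcf q.1 l (M.sample q.1 q.2))
          (M.αcf q.1 l (M.sample q.1 q.2)) : ℝ≥0∞)) := by
      intro l
      refine hM.bddInProb_block_average (l := l) (C := C) (u := fun n x z =>
        (d z.1 z.2 (M.γcf n l x) (M.αcf n l x) : ℝ≥0∞))
        (fun n => (hd2 n l).coe_nnreal_ennreal)
        (fun n x x' hx => by simp only [hM.γcf_dependsOn n l hx, hM.αcf_dependsOn n l hx])
        ENNReal.coe_ne_top ?_
      filter_upwards [(hJ.γcf_consistent l).tendsto.eventually_lt_const hε,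
        (hJ.αcf_consistent l).tendsto.eventually_lt_const hε] with q h1 h2
      exact (hfix _ (hM.γcf_mem _ _ _) _ (hM.αcf_mem _ _ _) h1 h2).2
    refine (BddInProb.sum fun l (_ : l ∈ Finset.univ) => h1 l).mono
      (Eventually.of_forall fun q => ?_)
    simp only [hD]
    rw [Finset.mul_sum]
    refine (enorm_sum_le _ _).trans (Finset.sum_le_sum fun l _ => ?_)
    refine (enorm_inv_natCast_smul_sum_le _ _ _).trans (le_of_eq ?_)
    simp
  refine ⟨fun q => ‖M.jacHat q.1 (M.sample q.1 q.2) - M.meanDeriv‖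
    + D q * ‖u q‖ ^ (1 / (C : ℝ)), ?_, ?_⟩
  · have h1 := tendsto_iff_norm_sub_tendsto_zero.1 (hJ.tendsto_jacHat hM)
    have h2 : Tendsto (fun q => D q * ‖u q‖ ^ (1 / (C : ℝ))) (probFilter P) (𝓝 0) := by
      rw [tendsto_zero_iff_enorm_tendsto_zero]
      simp_rw [enorm_mul]
      exact hDb.mul_tendsto_zero (tendsto_enorm_rpow hθ (by positivity))
    simpa using h1.add h2
  · have hsm : ∀ᶠ q : ℕ × Ω in probFilter P, ∀ l : Sym2 (Fin K), ∀ p ∈ M.block q.1 l,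
        M.SmoothOn N C (d (M.W p.1 q.2) (M.W p.2 q.2) (M.γcf q.1 l (M.sample q.1 q.2))
            (M.αcf q.1 l (M.sample q.1 q.2)))
          (M.γcf q.1 l (M.sample q.1 q.2)) (M.αcf q.1 l (M.sample q.1 q.2))
          (M.W p.1 q.2) (M.W p.2 q.2) :=
      eventually_all.2 fun l => (hcf l).eventually
    have hball : ∀ᶠ q in probFilter P, ‖u q‖ < r := by
      have := (tendsto_zero_iff_norm_tendsto_zero.1 hθ).eventually_lt_const hr
      exact this
    filter_upwards [hsm, hball] with q hq hqr
    set x := M.sample q.1 q.2 with hx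
    have e1 : M.ψhat q.1 x (M.θhat q.1 x) - M.ψhat q.1 x M.θ₀ - M.jacHat q.1 x (u q)
        = (q.1.choose 2 : ℝ)⁻¹ • ∑ l : Sym2 (Fin K), ∑ p ∈ M.block q.1 l,
          (M.ψ (x p.1) (x p.2) (M.γcf q.1 l x) (M.αcf q.1 l x) (M.θhat q.1 x)
            - M.ψ (x p.1) (x p.2) (M.γcf q.1 l x) (M.αcf q.1 l x) M.θ₀
            - M.Dψ (x p.1) (x p.2) (M.γcf q.1 l x) (M.αcf q.1 l x) M.θ₀ (u q)) := by
      simp only [ψhat, jacHat, smul_apply, sum_apply, ← smul_sub, ← Finset.sum_sub_distrib, ψ]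
    have e2 : ‖M.ψhat q.1 x (M.θhat q.1 x) - M.ψhat q.1 x M.θ₀ - M.jacHat q.1 x (u q)‖
        ≤ D q * ‖u q‖ ^ (1 / (C : ℝ)) * ‖u q‖ := by
      rw [e1, norm_smul, Real.norm_of_nonneg (by positivity), hD]
      simp only
      rw [mul_assoc, mul_assoc]
      refine mul_le_mul_of_nonneg_left ?_ (by positivity)
      rw [Finset.sum_mul]
      refine (norm_sum_le _ _).trans (Finset.sum_le_sum fun l _ => ?_)
      rw [Finset.sum_mul]
      refine (norm_sum_le _ _).trans (Finset.sum_le_sum fun p hp => ?_)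
      have := (hq l p hp).norm_taylor_le hrN hqr
      rw [mul_assoc] at this
      exact this
    have e3 : M.ψhat q.1 x (M.θhat q.1 x) - M.ψhat q.1 x M.θ₀ - M.meanDeriv (u q)
        = (M.ψhat q.1 x (M.θhat q.1 x) - M.ψhat q.1 x M.θ₀ - M.jacHat q.1 x (u q))
          + (M.jacHat q.1 x - M.meanDeriv) (u q) := by
      rw [sub_apply]; abel
    rw [e3, add_mul, add_comm (_ * _)]
    exact (norm_add_le _ _).trans (add_le_add e2 (ContinuousLinearMap.le_opNorm _ _))

/-- The scaled cross-fitted moment at the truth is `O_p(1)`. -/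
lemma bddInProb_sqrt_smul_ψhat (hM : M.Standing P) (hMS : M.MeanSquare P)
    (hI : M.InteractionRate P) (hB : M.SmallBias P) (hJ : M.JacobianRegular P) :
    BddInProb P fun q => ‖Real.sqrt q.1 • M.ψhat q.1 (M.sample q.1 q.2) M.θ₀‖ₑ := by
  have := hM.isProbabilityMeasure
  have hfm := hM.measurable_ψ₀
  have hf2 : MemLp M.ψ₀ 2 (M.F₀.prod M.F₀) := hMS.memLp
  set U : ℕ × Ω → Vec k := fun q => (Real.sqrt q.1 * (q.1.choose 2 : ℝ)⁻¹) •
    ∑ p ∈ indexPairs q.1, M.ψ₀ (M.W p.1 q.2, M.W p.2 q.2) with hU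
  have hU2 : BddInProb P fun q => ‖U q‖ₑ ^ 2 := by
    refine BddInProb.of_lintegral_le (C := 16 * ∫⁻ z, ‖M.ψ₀ z‖ₑ ^ 2 ∂(M.F₀.prod M.F₀)) ?_
      (fun n => ?_) ?_
    · rw [lintegral_enorm_sq_eq hf2]
      exact ENNReal.mul_ne_top (by simp) ENNReal.ofReal_ne_top
    · have hp : ∀ p : Fin n × Fin n, Measurable fun ω => M.ψ₀ (M.W p.1 ω, M.W p.2 ω) :=
        fun p =>
        hfm.comp ((hM.measurable_W _).prodMk (hM.measurable_W _))
      exact (((Finset.measurable_fun_sum (indexPairs n) fun p _ => hp p).const_smul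
        (Real.sqrt n * (n.choose 2 : ℝ)⁻¹)).enorm.pow_const 2).aemeasurable
    · filter_upwards [eventually_ge_atTop 2] with n hn
      have h1 := lintegral_enorm_sq_centered_sum_le (μ := P) hn (Y := fun i : Fin n => M.W i)
        (fun i => hM.measurable_W i) (fun i => hM.law i)
        (hM.indep.precomp Fin.val_injective) hfm.stronglyMeasurable
        (subset_refl (indexPairs n))
      simpa only [hM.integral_ψ₀, sub_zero] using h1
  have h1 : BddInProb P fun q => 1 + ‖U q‖ₑ ^ 2 :=
    (BddInProb.of_tendsto ENNReal.one_ne_top tendsto_const_nhds).add hU2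
  have h2 : BddInProb P fun q => ‖Real.sqrt q.1 • M.ψhat q.1 (M.sample q.1 q.2) M.θ₀ - U q‖ₑ :=
    BddInProb.of_tendsto ENNReal.zero_ne_top
      (tendsto_zero_iff_enorm_tendsto_zero.1 (tendsto_sqrt_smul_ψhat_sub hM hMS hI hB hJ))
  refine (h2.add h1).mono (Eventually.of_forall fun q => ?_)
  have h3 : ‖U q‖ₑ ≤ 1 + ‖U q‖ₑ ^ 2 := by
    rcases le_total ‖U q‖ₑ 1 with h | h
    · exact h.trans le_self_add
    · exact (le_self_pow h two_ne_zero).trans le_add_self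
  calc ‖Real.sqrt q.1 • M.ψhat q.1 (M.sample q.1 q.2) M.θ₀‖ₑ
      = ‖(Real.sqrt q.1 • M.ψhat q.1 (M.sample q.1 q.2) M.θ₀ - U q) + U q‖ₑ := by
        rw [sub_add_cancel]
    _ ≤ _ := (enorm_add_le _ _).trans (by gcongr)

/-- Linear representation of the estimator. On the event where the remainder of the expansion is at
most half of the linear term, `‖θ̂ - θ₀‖` is at most a multiple of the moment at the truth, so that
the remainder is `o_p(n^{-1/2})`. -/
lemma tendsto_linearization (hM : M.Standing P) (hMS : M.MeanSquare P)
    (hI : M.InteractionRate P) (hB : M.SmallBias P) (hJ : M.JacobianRegular P)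
    (hθ : Tendsto (fun q : ℕ × Ω => M.θhat q.1 (M.sample q.1 q.2) - M.θ₀) (probFilter P) (𝓝 0))
    {T : Vec k →L[ℝ] Vec k} (hT : ∀ v, T (M.meanDeriv v) = v) :
    Tendsto (fun q : ℕ × Ω => Real.sqrt q.1 • (M.θhat q.1 (M.sample q.1 q.2) - M.θ₀)
      + T (Real.sqrt q.1 • M.ψhat q.1 (M.sample q.1 q.2) M.θ₀)) (probFilter P) (𝓝 0) := by
  obtain ⟨ρ, hρ, hexp⟩ := hJ.exists_expansion hM hθ
  have hlim : Tendsto (fun q => ‖Real.sqrt q.1 • M.ψhat q.1 (M.sample q.1 q.2) M.θ₀‖ₑ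
      * ‖2 * ‖T‖ ^ 2 * ρ q‖ₑ) (probFilter P) (𝓝 0) := by
    refine (bddInProb_sqrt_smul_ψhat hM hMS hI hB hJ).mul_tendsto_zero ?_
    rw [← tendsto_zero_iff_enorm_tendsto_zero]
    simpa using hρ.const_mul (2 * ‖T‖ ^ 2)
  rw [tendsto_zero_iff_enorm_tendsto_zero]
  refine tendsto_of_tendsto_of_tendsto_of_le_of_le' tendsto_const_nhds hlim
    (Eventually.of_forall fun _ => zero_le) ?_
  have hsmall : ∀ᶠ q in probFilter P, ‖T‖ * ρ q < 1 / 2 := by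
    have h := hρ.const_mul ‖T‖
    rw [mul_zero] at h
    exact h.eventually_lt_const (by norm_num)
  filter_upwards [hexp, hsmall, hM.solves.eventually] with q h1 h2 h3
  obtain ⟨n, ω⟩ := q
  simp only at h1 h2 h3 ⊢
  set x := M.sample n ω
  set u := M.θhat n x - M.θ₀ with hu
  set m := M.ψhat n x M.θ₀ with hm
  have h4 : ‖u + T m‖ ≤ ‖T‖ * (ρ (n, ω) * ‖u‖) := by
    have e : u + T m = -T (M.ψhat n x (M.θhat n x) - m - M.meanDeriv u) := by
      rw [h3.2, map_sub, hT, map_sub, map_zero]; abel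
    rw [e, norm_neg]
    exact (T.le_opNorm _).trans (by gcongr)
  have h5 : ‖u‖ ≤ 2 * ‖T‖ * ‖m‖ := by
    have e1 : ‖u‖ ≤ ‖u + T m‖ + ‖T m‖ := by
      simpa using norm_sub_le (u + T m) (T m)
    have e2 := T.le_opNorm m
    nlinarith [norm_nonneg u]
  have h6 : ‖u + T m‖ ≤ ‖m‖ * ‖2 * ‖T‖ ^ 2 * ρ (n, ω)‖ := by
    calc ‖u + T m‖ ≤ ‖T‖ * (ρ (n, ω) * ‖u‖) := h4
      _ ≤ ‖T‖ * (|ρ (n, ω)| * ‖u‖) := by gcongr; exact le_abs_self _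
      _ ≤ ‖T‖ * (|ρ (n, ω)| * (2 * ‖T‖ * ‖m‖)) := by gcongr
      _ = _ := by rw [norm_mul, Real.norm_of_nonneg (by positivity), Real.norm_eq_abs]; ring
  rw [map_smul, ← smul_add, enorm_smul, enorm_smul, mul_assoc]
  refine mul_le_mul_right ?_ _
  rw [← ofReal_norm, ← ofReal_norm, ← ofReal_norm, ← ENNReal.ofReal_mul (norm_nonneg _)]
  exact ENNReal.ofReal_le_ofReal h6

end UModel

/-! ### Consistency of the variance estimator -/

section Averages

/-- The weak law of large numbers for a function of one observation. -/
lemma tendsto_sampleAverage {Ω Z : Type*} [MeasurableSpace Ω] [MeasurableSpace Z]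
    {μ : Measure Ω} [IsProbabilityMeasure μ] {F : Measure Z} {W : ℕ → Ω → Z}
    (hW : ∀ i, Measurable (W i)) (hlaw : ∀ i, μ.map (W i) = F) (hind : iIndepFun W μ)
    {f : Z → ℝ} (hf : Measurable f) (hfi : Integrable f F) :
    Tendsto (fun q : ℕ × Ω => (q.1 : ℝ)⁻¹ * ∑ i : Fin q.1, f (W i q.2)) (probFilter μ)
      (𝓝 (∫ w, f w ∂F)) := by
  have hmp : ∀ i, MeasurePreserving (W i) μ F := fun i => ⟨hW i, hlaw i⟩
  have hae := strong_law_ae_real (μ := μ) (fun i ω => f (W i ω))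
    ((hmp 0).integrable_comp_of_integrable hfi)
    (fun i j hij => (hind.indepFun hij).comp hf hf)
    (fun i => IdentDistrib.comp ⟨(hW i).aemeasurable, (hW 0).aemeasurable, by rw [hlaw, hlaw]⟩ hf)
  have h0 : ∫ ω, f (W 0 ω) ∂μ = ∫ w, f w ∂F := by
    rw [← hlaw 0, integral_map (hW 0).aemeasurable hf.aestronglyMeasurable]
  rw [h0] at hae
  have hm := tendstoInMeasure_of_tendsto_ae (f := fun (n : ℕ) ω =>
    (∑ i ∈ Finset.range n, f (W i ω)) / n)
    (fun n => (by fun_prop : Measurable _).aestronglyMeasurable) hae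
  rw [tendstoInMeasure_iff_tendsto_probFilter] at hm
  refine hm.congr fun q => ?_
  rw [div_eq_inv_mul, Finset.sum_range]

/-- Second moments of an array that is close in mean square to one with convergent second
moments. -/
lemma tendsto_average_mul {α : Type*} {l : Filter α} {k : ℕ} {n : α → ℕ}
    {v w : ∀ q, Fin (n q) → Vec k}
    (h0 : Tendsto (fun q => (n q : ℝ)⁻¹ * ∑ i, ‖v q i - w q i‖ ^ 2) l (𝓝 0)) {c s : ℝ}
    (hw : Tendsto (fun q => (n q : ℝ)⁻¹ * ∑ i, ‖w q i‖ ^ 2) l (𝓝 c)) {a b : Fin k}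
    (hs : Tendsto (fun q => (n q : ℝ)⁻¹ * ∑ i, w q i a * w q i b) l (𝓝 s)) :
    Tendsto (fun q => (n q : ℝ)⁻¹ * ∑ i, v q i a * v q i b) l (𝓝 s) := by
  have hlim : Tendsto (fun q => (n q : ℝ)⁻¹ * ∑ i, ‖v q i - w q i‖ ^ 2
      + 2 * (Real.sqrt ((n q : ℝ)⁻¹ * ∑ i, ‖v q i - w q i‖ ^ 2)
        * Real.sqrt ((n q : ℝ)⁻¹ * ∑ i, ‖w q i‖ ^ 2))) l (𝓝 0) := by
    have h1 := h0.add (((Real.continuous_sqrt.tendsto 0).comp h0).mul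
      ((Real.continuous_sqrt.tendsto c).comp hw) |>.const_mul 2)
    simpa using h1
  have hdiff : Tendsto (fun q => (n q : ℝ)⁻¹ * ∑ i, v q i a * v q i b
      - (n q : ℝ)⁻¹ * ∑ i, w q i a * w q i b) l (𝓝 0) := by
    refine squeeze_zero_norm (fun q => ?_) hlim
    have hcoord : ∀ (x : Vec k) (e : Fin k), |x e| ≤ ‖x‖ := fun x e => by
      simpa using PiLp.norm_apply_le x e
    have hterm : ∀ i, |v q i a * v q i b - w q i a * w q i b|
        ≤ ‖v q i - w q i‖ ^ 2 + 2 * (‖v q i - w q i‖ * ‖w q i‖) := by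
      intro i
      have e : v q i a * v q i b - w q i a * w q i b
          = (v q i - w q i) a * (v q i - w q i) b + (v q i - w q i) a * w q i b
            + w q i a * (v q i - w q i) b := by
        simp only [PiLp.sub_apply]; ring
      rw [e]
      refine (abs_add_three _ _ _).trans ?_
      simp only [abs_mul]
      have h1 := mul_le_mul (hcoord (v q i - w q i) a) (hcoord (v q i - w q i) b)
        (abs_nonneg _) (norm_nonneg _)
      have h2 := mul_le_mul (hcoord (v q i - w q i) a) (hcoord (w q i) b)
        (abs_nonneg _) (norm_nonneg _)
      have h3 := mul_le_mul (hcoord (w q i) a) (hcoord (v q i - w q i) b)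
        (abs_nonneg _) (norm_nonneg _)
      nlinarith
    have hn : (0 : ℝ) ≤ (n q : ℝ)⁻¹ := by positivity
    rw [← mul_sub, ← Finset.sum_sub_distrib, Real.norm_eq_abs, abs_mul, abs_of_nonneg hn]
    calc (n q : ℝ)⁻¹ * |∑ i, (v q i a * v q i b - w q i a * w q i b)|
        ≤ (n q : ℝ)⁻¹ * ∑ i, (‖v q i - w q i‖ ^ 2 + 2 * (‖v q i - w q i‖ * ‖w q i‖)) :=
          mul_le_mul_of_nonneg_left ((Finset.abs_sum_le_sum_abs _ _).trans
            (Finset.sum_le_sum fun i _ => hterm i)) hn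
      _ = (n q : ℝ)⁻¹ * ∑ i, ‖v q i - w q i‖ ^ 2
          + 2 * ((n q : ℝ)⁻¹ * ∑ i, ‖v q i - w q i‖ * ‖w q i‖) := by
          rw [Finset.sum_add_distrib, ← Finset.mul_sum]; ring
      _ ≤ _ := by
          refine add_le_add le_rfl (mul_le_mul_of_nonneg_left ?_ zero_le_two)
          rw [Real.sqrt_mul hn, Real.sqrt_mul hn]
          calc (n q : ℝ)⁻¹ * ∑ i, ‖v q i - w q i‖ * ‖w q i‖
              ≤ (n q : ℝ)⁻¹ * (Real.sqrt (∑ i, ‖v q i - w q i‖ ^ 2)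
                * Real.sqrt (∑ i, ‖w q i‖ ^ 2)) :=
                mul_le_mul_of_nonneg_left (Real.sum_mul_le_sqrt_mul_sqrt _ _ _) hn
            _ = (Real.sqrt (n q : ℝ)⁻¹ * Real.sqrt (n q : ℝ)⁻¹) *
                (Real.sqrt (∑ i, ‖v q i - w q i‖ ^ 2) * Real.sqrt (∑ i, ‖w q i‖ ^ 2)) := by
                rw [Real.mul_self_sqrt hn]
            _ = _ := by ring
  simpa using hdiff.add hs

lemma tendsto_matrix_inv {α : Type*} {l : Filter α} {k : ℕ}
    {X : α → Matrix (Fin k) (Fin k) ℝ} {B : Matrix (Fin k) (Fin k) ℝ} (hB : IsUnit B)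
    (h : Tendsto X l (𝓝 B)) : Tendsto (fun a => (X a)⁻¹) l (𝓝 B⁻¹) := by
  have hdet : B.det ≠ 0 := ((Matrix.isUnit_iff_isUnit_det B).1 hB).ne_zero
  simp only [Matrix.inv_def, Ring.inverse_eq_inv']
  have h1 : Tendsto (fun a => (X a).det) l (𝓝 B.det) :=
    ((continuous_id.matrix_det).tendsto B).comp h
  have h2 : Tendsto (fun a => (X a).adjugate) l (𝓝 B.adjugate) :=
    ((continuous_id.matrix_adjugate).tendsto B).comp h
  exact (h1.inv₀ hdet).smul h2

end Averages

namespace UModel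

variable {Ω Z G A : Type*} [MeasurableSpace Z] {k K : ℕ} {M : UModel Ω Z G A k K}
  [MeasurableSpace Ω] [NormedAddCommGroup G] [NormedAddCommGroup A] {P : Measure Ω}
  [IsProbabilityMeasure P]

/-- The conditional mean of `ψ` given one observation is the projection of the kernel. -/
lemma ψproj_ae_eq (hM : M.Standing P) (hMS : M.MeanSquare P) :
    M.ψproj P =ᵐ[P] fun ω => kernelProj M.F₀ M.ψ₀ (M.W 0 ω) := by
  have := hM.isProbabilityMeasure
  have hW0 := hM.measurable_W 0
  have hfm := hM.measurable_ψ₀.stronglyMeasurable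
  have hf2 : MemLp M.ψ₀ 2 (M.F₀.prod M.F₀) := hMS.memLp
  have hmp : MeasurePreserving (fun ω => (M.W 0 ω, M.W 1 ω)) P (M.F₀.prod M.F₀) :=
    measurePreserving_pair hM.measurable_W hM.law hM.indep (by norm_num)
  have hmp0 : MeasurePreserving (M.W 0) P M.F₀ := ⟨hW0, hM.law 0⟩
  have hπm := stronglyMeasurable_kernelProj (F := M.F₀) hfm
  have hπi : Integrable (kernelProj M.F₀ M.ψ₀) M.F₀ :=
    (memLp_kernelProj hfm hf2).integrable one_le_two
  have hfi : Integrable (fun ω => M.ψ₀ (M.W 0 ω, M.W 1 ω)) P :=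
    hmp.integrable_comp_of_integrable (hf2.integrable one_le_two)
  refine (ae_eq_condExp_of_forall_setIntegral_eq hW0.comap_le hfi (fun s _ _ =>
    (hmp0.integrable_comp_of_integrable hπi).integrableOn) ?_ ?_).symm
  · rintro s ⟨t, ht, rfl⟩ -
    have e1 := setIntegral_map (μ := P) (g := M.W 0) ht
      (hπm.aestronglyMeasurable) hW0.aemeasurable
    have e2 := setIntegral_map (μ := P) (g := fun ω => (M.W 0 ω, M.W 1 ω))
      (ht.prod MeasurableSet.univ) hfm.aestronglyMeasurable hmp.aemeasurable
    have e3 := setIntegral_prod (μ := M.F₀) (ν := M.F₀) (s := t) (t := Set.univ) M.ψ₀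
      (hf2.integrable one_le_two).integrableOn
    rw [hmp.map_eq, e3] at e2
    rw [hM.law] at e1
    simp only [Measure.restrict_univ] at e2
    refine e1.symm.trans (e2.trans ?_)
    congr 2
    ext ω
    simp
  · exact (hπm.comp_measurable (comap_measurable (M.W 0))).aestronglyMeasurable

/-- The entries of `Σ` as second moments of twice the projection. -/
lemma Sig_apply (hM : M.Standing P) (hMS : M.MeanSquare P) (a b : Fin k) :
    M.Sig P a b = ∫ ω, ((2 : ℝ) • kernelProj M.F₀ M.ψ₀ (M.W 0 ω)) a
      * ((2 : ℝ) • kernelProj M.F₀ M.ψ₀ (M.W 0 ω)) b ∂P := by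
  have := hM.isProbabilityMeasure
  have hfm := hM.measurable_ψ₀.stronglyMeasurable
  have hf2 : MemLp M.ψ₀ 2 (M.F₀.prod M.F₀) := hMS.memLp
  have hmp0 : MeasurePreserving (M.W 0) P M.F₀ := ⟨hM.measurable_W 0, hM.law 0⟩
  have hπm := stronglyMeasurable_kernelProj (F := M.F₀) hfm
  have hπi : Integrable (kernelProj M.F₀ M.ψ₀) M.F₀ :=
    (memLp_kernelProj hfm hf2).integrable one_le_two
  have h0 : ∀ e : Fin k, ∫ ω, kernelProj M.F₀ M.ψ₀ (M.W 0 ω) e ∂P = 0 := by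
    intro e
    have h1 : ∫ ω, kernelProj M.F₀ M.ψ₀ (M.W 0 ω) ∂P = 0 := by
      have := integral_map (hM.measurable_W 0).aemeasurable (μ := P)
        (f := kernelProj M.F₀ M.ψ₀) hπm.aestronglyMeasurable
      rw [← this, hM.law, integral_kernelProj (hf2.integrable one_le_two), hM.integral_ψ₀]
    have h2 := (EuclideanSpace.proj (𝕜 := ℝ) e).integral_comp_comm
      (hmp0.integrable_comp_of_integrable hπi)
    simp only [Function.comp_def, h1, map_zero] at h2
    exact h2
  have hae := ψproj_ae_eq hM hMS
  have hc : ∀ e : Fin k, (fun ω => M.ψproj P ω e) =ᵐ[P]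
      fun ω => kernelProj M.F₀ M.ψ₀ (M.W 0 ω) e := fun e => by
    filter_upwards [hae] with ω hω
    rw [hω]
  rw [Sig, Matrix.of_apply, covariance, integral_congr_ae (hc a), integral_congr_ae (hc b), h0, h0,
    ← integral_const_mul]
  refine integral_congr_ae ?_
  filter_upwards [hae] with ω hω
  simp only [hω, PiLp.smul_apply, smul_eq_mul]
  ring

/-- Consistency of `B̂`. The full-sample first steps are not independent of the observations at
which `ψ` is evaluated, so that expectations over the sample are used in place of cross-fitting. -/
lemma JacobianRegular.tendsto_Bhat (hJ : M.JacobianRegular P) (hM : M.Standing P)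
    (hθ : Tendsto (fun q : ℕ × Ω => M.θhat q.1 (M.sample q.1 q.2) - M.θ₀) (probFilter P) (𝓝 0)) :
    Tendsto (fun q : ℕ × Ω => M.Bhat q.1 (M.sample q.1 q.2)) (probFilter P) (𝓝 M.B) := by
  obtain ⟨N, hN, -, C, hC, ε, hε, d, -, -, hd3, -, -, hfull, hdC⟩ := hJ.smooth
  set D : ℕ × Ω → ℝ≥0∞ := fun q => (q.1.choose 2 : ℝ≥0∞)⁻¹ * ∑ p ∈ indexPairs q.1,
    (d (M.W p.1 q.2) (M.W p.2 q.2) (M.γhat q.1 (M.sample q.1 q.2))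
      (M.αhat q.1 (M.sample q.1 q.2)) : ℝ≥0∞) with hD
  have hdm : ∀ n (p : Fin n × Fin n), Measurable fun ω =>
      (d (M.W p.1 ω) (M.W p.2 ω) (M.γhat n (M.sample n ω)) (M.αhat n (M.sample n ω)) : ℝ≥0∞) :=
    fun n p => ((hd3 n p.1 p.2).comp (hM.measurePreserving_sample n).measurable).coe_nnreal_ennreal
  have hDb : BddInProb P D := by
    refine BddInProb.of_lintegral_le (C := C) ENNReal.coe_ne_top (fun n => ?_) ?_
    · exact ((Finset.measurable_fun_sum (indexPairs n) fun p _ => hdm n p).const_mul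
        ((n.choose 2 : ℝ≥0∞)⁻¹)).aemeasurable
    · filter_upwards [hdC] with n hn
      simp only [hD]
      rwa [lintegral_const_mul _ (Finset.measurable_fun_sum _ fun p _ => hdm n p),
        lintegral_finsetSum _ fun p _ => hdm n p]
  refine tendsto_pi_nhds.2 fun a => tendsto_pi_nhds.2 fun b => ?_
  -- the three parts: from `θ̂` to `θ₀`, from estimated to true first steps, and the U-statistic
  have h1 : Tendsto (fun q : ℕ × Ω => (q.1.choose 2 : ℝ)⁻¹ • ∑ p ∈ indexPairs q.1,
      (M.pψ b (M.W p.1 q.2) (M.W p.2 q.2) (M.γhat q.1 (M.sample q.1 q.2))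
          (M.αhat q.1 (M.sample q.1 q.2)) (M.θhat q.1 (M.sample q.1 q.2))
        - M.pψ b (M.W p.1 q.2) (M.W p.2 q.2) (M.γhat q.1 (M.sample q.1 q.2))
          (M.αhat q.1 (M.sample q.1 q.2)) M.θ₀)) (probFilter P) (𝓝 0) := by
    rw [tendsto_zero_iff_enorm_tendsto_zero]
    have hlim := hDb.mul_tendsto_zero (tendsto_enorm_rpow hθ (c := 1 / (C : ℝ)) (by positivity))
    refine tendsto_of_tendsto_of_tendsto_of_le_of_le' tendsto_const_nhds hlim
      (Eventually.of_forall fun _ => zero_le) ?_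
    have hθN : ∀ᶠ q : ℕ × Ω in probFilter P, M.θhat q.1 (M.sample q.1 q.2) ∈ N := by
      have h := hθ.add_const M.θ₀
      simp only [sub_add_cancel, zero_add] at h
      exact h hN
    filter_upwards [hfull.eventually, hθN] with q hq hqN
    refine (enorm_inv_natCast_smul_sum_le _ _ _).trans ?_
    rw [hD]
    simp only
    rw [mul_assoc, Finset.sum_mul]
    refine mul_le_mul_right (Finset.sum_le_sum fun p hp => ?_) _
    have h2 := (hq p hp _ hqN).2
    have h3 := ContinuousLinearMap.le_opNorm
      (M.Dψ (M.W p.1 q.2) (M.W p.2 q.2) (M.γhat q.1 (M.sample q.1 q.2))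
          (M.αhat q.1 (M.sample q.1 q.2)) (M.θhat q.1 (M.sample q.1 q.2))
        - M.Dψ (M.W p.1 q.2) (M.W p.2 q.2) (M.γhat q.1 (M.sample q.1 q.2))
          (M.αhat q.1 (M.sample q.1 q.2)) M.θ₀) (EuclideanSpace.single b 1)
    rw [PiLp.norm_single, norm_one, mul_one, sub_apply] at h3
    have h4 := ENNReal.ofReal_le_ofReal (h3.trans h2)
    rw [ofReal_norm, ENNReal.ofReal_mul (NNReal.coe_nonneg _), ENNReal.ofReal_coe_nnreal] at h4
    refine h4.trans (le_of_eq ?_)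
    rw [Real.enorm_of_nonneg (by positivity)]
  have h2 : Tendsto (fun q : ℕ × Ω => (q.1.choose 2 : ℝ)⁻¹ • ∑ p ∈ indexPairs q.1,
      (M.pψ b (M.W p.1 q.2) (M.W p.2 q.2) (M.γhat q.1 (M.sample q.1 q.2))
          (M.αhat q.1 (M.sample q.1 q.2)) M.θ₀
        - M.pψ b (M.W p.1 q.2) (M.W p.2 q.2) M.γ₀ M.α₀ M.θ₀)) (probFilter P) (𝓝 0) := by
    rw [tendsto_zero_iff_enorm_tendsto_zero]
    have hm : ∀ n (p : Fin n × Fin n), Measurable fun ω =>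
        ‖M.pψ b (M.W p.1 ω) (M.W p.2 ω) (M.γhat n (M.sample n ω)) (M.αhat n (M.sample n ω)) M.θ₀
          - M.pψ b (M.W p.1 ω) (M.W p.2 ω) M.γ₀ M.α₀ M.θ₀‖ₑ := fun n p =>
      (((hM.measurable_phat b n p.1 p.2).comp (hM.measurePreserving_sample n).measurable).sub
        ((hM.measurable_p₀ b).comp
          ((hM.measurable_W p.1).prodMk (hM.measurable_W p.2)))).enorm
    have hlim := tendsto_probFilter_of_lintegral (P := P) (X := fun n ω =>
        (n.choose 2 : ℝ≥0∞)⁻¹ * ∑ p ∈ indexPairs n,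
        ‖M.pψ b (M.W p.1 ω) (M.W p.2 ω) (M.γhat n (M.sample n ω)) (M.αhat n (M.sample n ω)) M.θ₀
          - M.pψ b (M.W p.1 ω) (M.W p.2 ω) M.γ₀ M.α₀ M.θ₀‖ₑ)
      (fun n => ((Finset.measurable_fun_sum _ fun p _ => hm n p).const_mul _).aemeasurable)
      ((hJ.partial_hat b).congr fun n => by
        rw [lintegral_const_mul _ (Finset.measurable_fun_sum _ fun p _ => hm n p),
          lintegral_finsetSum _ fun p _ => hm n p])
    exact tendsto_of_tendsto_of_tendsto_of_le_of_le tendsto_const_nhds hlim (fun _ => zero_le)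
      fun q => enorm_inv_natCast_smul_sum_le _ _ _
  have h3 := ((h1.add h2).add (hJ.tendsto_pairAverage_pψ hM b))
  rw [zero_add, zero_add] at h3
  have h4 := ((EuclideanSpace.proj (𝕜 := ℝ) a).continuous.tendsto _).comp h3
  refine h4.congr fun q => ?_
  simp only [Function.comp, ← smul_add, ← Finset.sum_add_distrib, sub_add_sub_cancel,
    sub_add_cancel, Bhat, Matrix.of_apply]
  rw [map_smul, map_sum, smul_eq_mul]
  rfl

/-- Consistency of `Σ̂`: the leave-one-out averages of the estimated `ψ` are close in mean square to
those of the true `ψ`, hence to the projections. -/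
lemma VarianceConditions.tendsto_Sighat (hV : M.VarianceConditions P) (hM : M.Standing P)
    (hMS : M.MeanSquare P) :
    Tendsto (fun q : ℕ × Ω => M.Sighat q.1 (M.sample q.1 q.2)) (probFilter P)
      (𝓝 (M.Sig P)) := by
  have := hM.isProbabilityMeasure
  have hfm := hM.measurable_ψ₀.stronglyMeasurable
  have hf2 : MemLp M.ψ₀ 2 (M.F₀.prod M.F₀) := hMS.memLp
  have hmp0 : MeasurePreserving (M.W 0) P M.F₀ := ⟨hM.measurable_W 0, hM.law 0⟩
  have hπm := stronglyMeasurable_kernelProj (F := M.F₀) hfm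
  have hπ2 := memLp_kernelProj hfm hf2
  have hπc : ∀ a : Fin k, MemLp (fun w => kernelProj M.F₀ M.ψ₀ w a) 2 M.F₀ := fun a =>
    (EuclideanSpace.proj (𝕜 := ℝ) a).comp_memLp' hπ2
  have hcm : ∀ a : Fin k, Measurable fun w => kernelProj M.F₀ M.ψ₀ w a := fun a =>
    (EuclideanSpace.proj (𝕜 := ℝ) a).continuous.measurable.comp hπm.measurable
  set v : ∀ q : ℕ × Ω, Fin q.1 → Vec k := fun q i => ((q.1 : ℝ) - 1)⁻¹ •
    ∑ j ∈ Finset.univ.erase i, M.ψ (M.W i q.2) (M.W j q.2) (M.γhat q.1 (M.sample q.1 q.2))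
      (M.αhat q.1 (M.sample q.1 q.2)) (M.θhat q.1 (M.sample q.1 q.2)) with hv
  set w : ∀ q : ℕ × Ω, Fin q.1 → Vec k := fun q i => kernelProj M.F₀ M.ψ₀ (M.W i q.2) with hw
  have hloo := tendsto_leaveOneOut_sub_projection hM.measurable_W hM.law hM.indep hfm hf2
  have hQ : Tendsto (fun q : ℕ × Ω => (q.1 : ℝ)⁻¹ * ∑ i, ‖v q i - w q i‖ ^ 2) (probFilter P)
      (𝓝 0) := by
    have h1 := hV.g_loo.tendsto
    have h2 := hV.φ_loo.tendsto
    rw [← tendsto_zero_iff_enorm_tendsto_zero] at h1 h2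
    have h3 := ((h1.add h2).add hloo).const_mul 3
    simp only [add_zero, mul_zero] at h3
    refine squeeze_zero (fun q => by positivity) (fun q => ?_) h3
    have hn : (0 : ℝ) ≤ (q.1 : ℝ)⁻¹ := by positivity
    rw [← mul_add, ← mul_add, mul_left_comm, ← Finset.sum_add_distrib, ← Finset.sum_add_distrib,
      Finset.mul_sum _ _ (3 : ℝ)]
    refine mul_le_mul_of_nonneg_left (Finset.sum_le_sum fun i _ => ?_) hn
    have hsq : ∀ x y z : Vec k, ‖x + y + z‖ ^ 2 ≤ 3 * (‖x‖ ^ 2 + ‖y‖ ^ 2 + ‖z‖ ^ 2) := by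
      intro x y z
      have h := norm_add₃_le (a := x) (b := y) (c := z)
      have h' := pow_le_pow_left₀ (norm_nonneg _) h 2
      nlinarith [sq_nonneg (‖x‖ - ‖y‖), sq_nonneg (‖y‖ - ‖z‖), sq_nonneg (‖x‖ - ‖z‖)]
    refine le_trans (le_of_eq ?_) (hsq _ _ _)
    congr 2
    simp only [hv, hw, ψ₀, ψ, Finset.sum_add_distrib, smul_add]
    abel
  have hw2 := tendsto_sampleAverage hM.measurable_W hM.law hM.indep
    (f := fun z => ‖kernelProj M.F₀ M.ψ₀ z‖ ^ 2) (hπm.measurable.norm.pow_const 2)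
    (integrable_norm_sq_of_memLp hπ2)
  refine tendsto_pi_nhds.2 fun a => tendsto_pi_nhds.2 fun b => ?_
  have hab : Integrable (fun z => kernelProj M.F₀ M.ψ₀ z a * kernelProj M.F₀ M.ψ₀ z b) M.F₀ :=
    (hπc a).integrable_mul (hπc b)
  have hs := tendsto_sampleAverage hM.measurable_W hM.law hM.indep
    (f := fun z => kernelProj M.F₀ M.ψ₀ z a * kernelProj M.F₀ M.ψ₀ z b) ((hcm a).mul (hcm b)) hab
  have hmain := (tendsto_average_mul (n := Prod.fst) hQ hw2 hs).const_mul 4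
  have hSig : M.Sig P a b
      = 4 * ∫ z, kernelProj M.F₀ M.ψ₀ z a * kernelProj M.F₀ M.ψ₀ z b ∂M.F₀ := by
    have e := integral_map (μ := P) (hM.measurable_W 0).aemeasurable
      (f := fun z => kernelProj M.F₀ M.ψ₀ z a * kernelProj M.F₀ M.ψ₀ z b)
      ((hcm a).mul (hcm b)).aestronglyMeasurable
    rw [hM.law] at e
    rw [Sig_apply hM hMS, e, ← integral_const_mul]
    refine integral_congr_ae (ae_of_all _ fun ω => ?_)
    simp only [PiLp.smul_apply, smul_eq_mul]
    ring
  rw [hSig]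
  refine hmain.congr fun q => ?_
  simp only [hv, Sighat, Matrix.of_apply, PiLp.smul_apply, smul_eq_mul, sample]
  rw [div_eq_mul_inv, mul_inv, mul_assoc, mul_assoc, Finset.mul_sum, Finset.mul_sum,
    Finset.mul_sum, Finset.mul_sum, Finset.mul_sum]
  refine Finset.sum_congr rfl fun i _ => ?_
  rw [sq, mul_inv]
  ring

end UModel

/-! ### Asymptotic normality -/

namespace UModel

variable {Ω Z G A : Type*} [MeasurableSpace Z] {k K : ℕ} {M : UModel Ω Z G A k K}

lemma toEuclideanCLM_B_inv_meanDeriv (hB : IsUnit M.B) (v : Vec k) :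
    Matrix.toEuclideanCLM (𝕜 := ℝ) M.B⁻¹ (M.meanDeriv v) = v := by
  have hB' : M.meanDeriv v = Matrix.toEuclideanCLM (𝕜 := ℝ) M.B v := by
    ext a
    rw [Matrix.ofLp_toEuclideanCLM]
    conv_lhs => rw [← (EuclideanSpace.basisFun (Fin k) ℝ).sum_repr v]
    simp only [EuclideanSpace.basisFun_repr, EuclideanSpace.basisFun_apply, map_sum, map_smul,
      Matrix.mulVec, dotProduct, WithLp.ofLp_sum, Finset.sum_apply, PiLp.smul_apply, smul_eq_mul]
    exact Finset.sum_congr rfl fun b _ => mul_comm _ _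
  rw [hB', ← mul_apply_eq_comp, ← map_mul,
    Matrix.nonsing_inv_mul _ ((Matrix.isUnit_iff_isUnit_det _).1 hB), map_one]
  rfl

variable [MeasurableSpace Ω] [NormedAddCommGroup G] [NormedAddCommGroup A] {P : Measure Ω}
  [IsProbabilityMeasure P]

/-- The influence function of `θ̂`: minus `B⁻¹` applied to twice the projection of `ψ`. -/
noncomputable def influence (M : UModel Ω Z G A k K) (w : Z) : Vec k :=
  -Matrix.toEuclideanCLM (𝕜 := ℝ) M.B⁻¹ ((2 : ℝ) • kernelProj M.F₀ M.ψ₀ w)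

lemma Standing.measurable_influence (hM : M.Standing P) : Measurable M.influence := by
  have := hM.isProbabilityMeasure
  exact ((Matrix.toEuclideanCLM (𝕜 := ℝ) M.B⁻¹).continuous.measurable.comp
    ((stronglyMeasurable_kernelProj
      hM.measurable_ψ₀.stronglyMeasurable).measurable.const_smul (2 : ℝ))).neg

lemma memLp_influence (hM : M.Standing P) (hMS : M.MeanSquare P) :
    MemLp M.influence 2 M.F₀ := by
  have := hM.isProbabilityMeasure
  exact ((Matrix.toEuclideanCLM (𝕜 := ℝ) M.B⁻¹).comp_memLp'
    ((memLp_kernelProj hM.measurable_ψ₀.stronglyMeasurable hMS.memLp).const_smul (2 : ℝ))).neg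

lemma integral_influence (hM : M.Standing P) (hMS : M.MeanSquare P) :
    ∫ w, M.influence w ∂M.F₀ = 0 := by
  have := hM.isProbabilityMeasure
  have hf2 : MemLp M.ψ₀ 2 (M.F₀.prod M.F₀) := hMS.memLp
  have hπ := ((memLp_kernelProj hM.measurable_ψ₀.stronglyMeasurable hf2).integrable
    one_le_two).smul (2 : ℝ)
  have h := (Matrix.toEuclideanCLM (𝕜 := ℝ) M.B⁻¹).integral_comp_comm hπ
  simp only [Pi.smul_apply] at h
  simp only [influence]
  rw [integral_neg, h, integral_smul, integral_kernelProj (hf2.integrable one_le_two),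
    hM.integral_ψ₀, smul_zero, map_zero, neg_zero]

/-- The asymptotic variance is the second moment matrix of the influence function. -/
lemma V_apply (hM : M.Standing P) (hMS : M.MeanSquare P) (a b : Fin k) :
    M.V P a b = ∫ ω, M.influence (M.W 0 ω) a * M.influence (M.W 0 ω) b ∂P := by
  have := hM.isProbabilityMeasure
  have hmp0 : MeasurePreserving (M.W 0) P M.F₀ := ⟨hM.measurable_W 0, hM.law 0⟩
  have hY : MemLp (fun ω => (2 : ℝ) • kernelProj M.F₀ M.ψ₀ (M.W 0 ω)) 2 P :=
    ((memLp_kernelProj hM.measurable_ψ₀.stronglyMeasurable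
      hMS.memLp).comp_measurePreserving hmp0).const_smul (2 : ℝ)
  have hYc : ∀ c : Fin k, MemLp
      (fun ω => ((2 : ℝ) • kernelProj M.F₀ M.ψ₀ (M.W 0 ω)) c) 2 P := fun c =>
    (EuclideanSpace.proj (𝕜 := ℝ) c).comp_memLp' hY
  obtain ⟨Y, hYdef⟩ : ∃ Y : Ω → Vec k,
    Y = fun ω => (2 : ℝ) • kernelProj M.F₀ M.ψ₀ (M.W 0 ω) := ⟨_, rfl⟩
  have hYc' : ∀ c : Fin k, MemLp (fun ω => Y ω c) 2 P := by simpa only [hYdef] using hYc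
  have hS : ∀ c d, M.Sig P c d = ∫ ω, Y ω c * Y ω d ∂P := by
    simpa only [hYdef] using Sig_apply hM hMS
  have hinf : ∀ ω (e : Fin k), M.influence (M.W 0 ω) e = -∑ c, M.B⁻¹ e c * Y ω c := by
    intro ω e
    simp only [influence, hYdef, PiLp.neg_apply, Matrix.ofLp_toEuclideanCLM, Matrix.mulVec,
      dotProduct]
  have hint : ∀ c d, Integrable (fun ω => Y ω c * Y ω d) P := fun c d =>
    (hYc' c).integrable_mul (hYc' d)
  have hexp : ∀ ω, M.influence (M.W 0 ω) a * M.influence (M.W 0 ω) b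
      = ∑ d, ∑ c, M.B⁻¹ a c * M.B⁻¹ b d * (Y ω c * Y ω d) := by
    intro ω
    rw [hinf, hinf, neg_mul_neg, Finset.sum_mul_sum, Finset.sum_comm]
    exact Finset.sum_congr rfl fun d _ => Finset.sum_congr rfl fun c _ => by ring
  simp only [hexp]
  rw [integral_finsetSum _ fun d _ => integrable_finsetSum _ fun c _ => (hint c d).const_mul _]
  rw [V, ← Matrix.transpose_nonsing_inv, Matrix.mul_apply]
  refine Finset.sum_congr rfl fun d _ => ?_
  rw [integral_finsetSum _ fun c _ => (hint c d).const_mul _, Matrix.mul_apply, Finset.sum_mul]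
  refine Finset.sum_congr rfl fun c _ => ?_
  rw [integral_const_mul, Matrix.transpose_apply, hS]
  ring

/-- The asymptotic linear representation of `θ̂`. -/
lemma tendsto_sqrt_smul_sub_sum_influence (hM : M.Standing P) (hMS : M.MeanSquare P)
    (hI : M.InteractionRate P) (hb : M.SmallBias P) (hJ : M.JacobianRegular P)
    (hθ : Tendsto (fun q : ℕ × Ω => M.θhat q.1 (M.sample q.1 q.2) - M.θ₀) (probFilter P) (𝓝 0))
    (hB : IsUnit M.B) :
    Tendsto (fun q : ℕ × Ω => Real.sqrt q.1 • (M.θhat q.1 (M.sample q.1 q.2) - M.θ₀)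
      - (Real.sqrt q.1)⁻¹ • ∑ i ∈ Finset.range q.1, M.influence (M.W i q.2))
      (probFilter P) (𝓝 0) := by
  have := hM.isProbabilityMeasure
  obtain ⟨T, hT⟩ : ∃ T : Vec k →L[ℝ] Vec k, T = Matrix.toEuclideanCLM (𝕜 := ℝ) M.B⁻¹ := ⟨_, rfl⟩
  have hTB : ∀ v, T (M.meanDeriv v) = v := by
    rw [hT]; exact toEuclideanCLM_B_inv_meanDeriv hB
  have h1 := tendsto_linearization hM hMS hI hb hJ hθ hTB
  have h2 := tendsto_sqrt_smul_ψhat_sub hM hMS hI hb hJ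
  have h3 := tendsto_pairAverage_sub_projection hM.measurable_W hM.law hM.indep
    hM.measurable_ψ₀.stronglyMeasurable hMS.memLp hM.integral_ψ₀ hM.ψ₀_symm
  have h4 := (T.continuous.tendsto _).comp (h2.add h3)
  have h5 := h1.sub h4
  simp only [add_zero, map_zero, sub_zero] at h5
  refine h5.congr fun q => ?_
  have hsum : (Real.sqrt q.1)⁻¹ • ∑ i ∈ Finset.range q.1, M.influence (M.W i q.2)
      = -T ((Real.sqrt q.1)⁻¹ • ∑ i : Fin q.1, (2 : ℝ) • kernelProj M.F₀ M.ψ₀ (M.W i q.2)) := by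
    rw [Finset.sum_range, map_smul, map_sum, ← smul_neg, ← Finset.sum_neg_distrib, hT]
    rfl
  rw [hsum]
  simp only [Function.comp, map_add, map_sub, ψ₀]
  abel

/-- `√n (θ̂ - θ₀)` is asymptotically normal with variance `V`. -/
lemma tendstoInDistribution_sqrt_smul (hM : M.Standing P) (hMS : M.MeanSquare P)
    (hI : M.InteractionRate P) (hb : M.SmallBias P) (hJ : M.JacobianRegular P)
    (hθ : Tendsto (fun q : ℕ × Ω => M.θhat q.1 (M.sample q.1 q.2) - M.θ₀) (probFilter P) (𝓝 0))
    (hB : IsUnit M.B) :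
    TendstoInDistribution
      (fun (n : ℕ) ω => Real.sqrt n • (M.θhat n (M.sample n ω) - M.θ₀)) atTop
      (id : Vec k → Vec k) (fun _ => P) (multivariateGaussian 0 (M.V P)) := by
  have := hM.isProbabilityMeasure
  have hmp0 : MeasurePreserving (M.W 0) P M.F₀ := ⟨hM.measurable_W 0, hM.law 0⟩
  have hinf := hM.measurable_influence
  have h0 : ∫ ω, M.influence (M.W 0 ω) ∂P = 0 := by
    have e := integral_map (μ := P) (hM.measurable_W 0).aemeasurable (f := M.influence)
      hinf.aestronglyMeasurable
    rw [← e, hM.law, integral_influence hM hMS]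
  have hident : ∀ i, IdentDistrib (fun ω => M.influence (M.W i ω)) (fun ω => M.influence (M.W 0 ω))
      P P := fun i =>
    have h : IdentDistrib (M.W i) (M.W 0) P P := ⟨(hM.measurable_W i).aemeasurable,
      (hM.measurable_W 0).aemeasurable, by rw [hM.law, hM.law]⟩
    h.comp hinf
  have hclt := tendstoInDistribution_inv_sqrt_smul_sum (P := P)
    (X := fun i ω => M.influence (M.W i ω)) (fun i => hinf.comp (hM.measurable_W i))
    (hM.indep.comp (fun _ => M.influence) fun _ => hinf)
    hident
    ((memLp_influence hM hMS).comp_measurePreserving hmp0) h0 (S := M.V P) (V_apply hM hMS)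
  refine tendstoInDistribution_of_tendstoInMeasure_sub _ _ hclt ?_ fun n => ?_
  · exact tendstoInMeasure_iff_tendsto_probFilter.2
      (tendsto_sqrt_smul_sub_sum_influence hM hMS hI hb hJ hθ hB)
  · have h := (hM.measurable_θhat n).comp (hM.measurePreserving_sample n).measurable
    exact ((h.sub_const M.θ₀).const_smul (Real.sqrt n)).aemeasurable

end UModel

theorem mainTheorem1 {Ω Z G A : Type*} [MeasurableSpace Ω] [MeasurableSpace Z]
    [NormedAddCommGroup G] [NormedAddCommGroup A] {k K : ℕ}
    (P : Measure Ω) [IsProbabilityMeasure P] (M : UModel Ω Z G A k K)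
    (h_standing : M.Standing P)
    (h_meanSquare : M.MeanSquare P)
    (h_interaction : M.InteractionRate P)
    (h_bias : M.SmallBias P)
    (h_jacobian : M.JacobianRegular P)
    (h_variance : M.VarianceConditions P)
    (h_consistent : TendstoInMeasure P (fun n ω => M.θhat n (M.sample n ω)) atTop
      (fun _ => M.θ₀))
    (h_B : IsUnit M.B)
    (h_V : IsUnit (M.V P)) :
    TendstoInDistribution
        (fun (n : ℕ) ω => Real.sqrt n • (M.θhat n (M.sample n ω) - M.θ₀)) atTop
        (id : Vec k → Vec k) (fun _ => P) (multivariateGaussian 0 (M.V P)) ∧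
      ∀ a b : Fin k, TendstoInMeasure P (fun n ω => M.Vhat n (M.sample n ω) a b) atTop
        (fun _ => M.V P a b) := by
  have hθ : Tendsto (fun q : ℕ × Ω => M.θhat q.1 (M.sample q.1 q.2) - M.θ₀) (probFilter P)
      (𝓝 0) := by
    simpa using (tendstoInMeasure_iff_tendsto_probFilter.1 h_consistent).sub_const M.θ₀
  refine ⟨UModel.tendstoInDistribution_sqrt_smul h_standing h_meanSquare h_interaction h_bias
    h_jacobian hθ h_B, fun a b => tendstoInMeasure_iff_tendsto_probFilter.2 ?_⟩
  have hBhat := h_jacobian.tendsto_Bhat h_standing hθ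
  have hBT : IsUnit M.B.transpose := by
    rw [Matrix.isUnit_iff_isUnit_det, Matrix.det_transpose, ← Matrix.isUnit_iff_isUnit_det]
    exact h_B
  have hVhat := ((tendsto_matrix_inv h_B hBhat).mul
    (h_variance.tendsto_Sighat h_standing h_meanSquare)).mul
    (tendsto_matrix_inv hBT ((continuous_id.matrix_transpose.tendsto _).comp hBhat))
  exact tendsto_pi_nhds.1 (tendsto_pi_nhds.1 hVhat a) b
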